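/- Let $d\geq 1$, let $(a_n)_{n\ge1}$, $(b_n)_{n\ge1}$ be complex sequences with $a_1b_1\neq 0$, and let $(\lambda_n)_{n\ge1}$, $(\mu_n)_{n\ge1}$ be strictly increasing sequences of positive reals tending to $\infty$. Assume: (A1) the series $\phi(s)=\sum_{n\ge1} a_n\lambda_n^{-s}$ and $\psi(s)=\sum_{n\ge1} b_n\mu_n^{-s}$ converge absolutely in some half-plane $\Re s\ge\sigma^*$ with $\sigma^*>0$; (A2) for some $\alpha_\nu>0$, $\beta_\nu,\widetilde\beta_\nu\in\mathbb C$ $(1\le\nu\le d)$ and some $\omega\in\mathbb C$ with $|\omega|=1$, putting $\Delta(s)=\prod_{\nu}\Gamma(\alpha_\nu s+\beta_\nu)$ and $\widetilde\Delta(s)=\prod_\nu\Gamma(\alpha_\nu s+\widetilde\beta_\nu)$, the meromorphic continuations of $\phi,\psi$ satisfy $\Delta(s)\phi(s)=\omega\,\widetilde\Delta(1-s)\psi(1-s)$; (A3) $\Delta(s)\phi(s)$ (hence also $\widetilde\Delta(s)\psi(s)$) extends meromorphically to $\mathbb C$, all its poles lie in a disk $|s|<R$ for some $R>0$, and $\Delta(\sigma+it)\phi(\sigma+it)\to0$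 as $|t|\to\infty$, uniformly in every vertical strip $b\le\sigma\le b'$. Put $A=\sum_\nu\alpha_\nu$, $B=\sum_\nu\beta_\nu$, $\widetilde B=\sum_\nu\widetilde\beta_\nu$, and define $\vartheta,\xi\in\mathbb R$ by $$-\vartheta+i\xi=\frac1{4A}-\frac12-\frac{B-\widetilde B}{2A}.$$ Suppose $0<2A<1$ and that one of the following holds: (a) $\phi$ is entire; (b) $\xi=0$ and all poles of $\phi$ are real; (c) all poles of $\phi$ lie in $\Re s<1-\vartheta+\frac1{2A}$. Then there is a constant $C>0$, independent of $n$, such that for all sufficiently large $n$, $$\lambda_{n+1}-\lambda_n\le C\,\lambda_n^{1-1/(2A)}.$$ Consequently, for $0<D<1$ no function in the Selberg class has degree $D$. Here the Selberg class consists of the functions $F$ such that: $F(s)=\sum_{n\ge1}a(n)n^{-s}$ converges absolutely for $\Re s>1$; $(s-1)^mF(s)$ is entire of finite order for some integer $m\ge0$; $\Phi(s)=\omega\,\overline{\Phi(1-\bar s)}$ where $\Phi(s)=Q^s\prod_{j=1}^r\Gamma(\alpha_js+\beta_j)F(s)$ for some $Q>0$, $\alpha_j>0$, $\Re\beta_j\ge0$,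 $|\omega|=1$; $a(n)\ll_\varepsilon n^\varepsilon$ for every $\varepsilon>0$; and $\log F(s)=\sum_{n}b(n)n^{-s}$ for $\Re s>1$, where $b(n)=0$ unless $n$ is a prime power $p^k$, $k\ge1$, and $b(n)\ll n^\theta$ for some $\theta<1/2$. The degree of $F$ is $2\sum_j\alpha_j$. -/

import Mathlib

open Filter Topology

noncomputable section

namespace ShortGap

/-- The gamma factor `∏_{ν=1}^d Γ(α_ν s + β_ν)`. -/
def gammaFactor {d : ℕ} (α : Fin d → ℝ) (β : Fin d → ℂ) (s : ℂ) : ℂ :=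
  ∏ ν, Complex.Gamma ((α ν : ℂ) * s + β ν)

/-- `A = α_1 + ⋯ + α_d`. -/
def sumA {d : ℕ} (α : Fin d → ℝ) : ℝ := ∑ ν, α ν

/-- The constant `1/(4A) - 1/2 - (B - B')/(2A) = -ϑ + iξ`, where `B = ∑ β_ν` and `B' = ∑ β'_ν`
(the parameters of the gamma factors on the two sides of the functional equation). -/
def shiftConst {d : ℕ} (α : Fin d → ℝ) (β β' : Fin d → ℂ) : ℂ :=
  1 / (4 * (sumA α : ℂ)) - 1 / 2 - (∑ ν, β ν - ∑ ν, β' ν) / (2 * (sumA α : ℂ))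

/-- `ϑ`, minus the real part of `shiftConst`. -/
def vartheta {d : ℕ} (α : Fin d → ℝ) (β β' : Fin d → ℂ) : ℝ := -(shiftConst α β β').re

/-- `ξ`, the imaginary part of `shiftConst`. -/
def xi {d : ℕ} (α : Fin d → ℝ) (β β' : Fin d → ℂ) : ℝ := (shiftConst α β β').im

/-- `s` is a pole of the meromorphic function `f`. -/
def IsPole (f : ℂ → ℂ) (s : ℂ) : Prop := meromorphicOrderAt f s < 0

/-- Admissible coefficients and frequencies of a general Dirichlet series
`∑_{n ≥ 1} c_n ℓ_n^{-s}`. Sequences are indexed from `0`: `c n`, `ℓ n` stand for `c_{n+1}`,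
`ℓ_{n+1}`. Only the first coefficient is required not to vanish. -/
structure IsDirichletDatum (c : ℕ → ℂ) (ℓ : ℕ → ℝ) : Prop where
  first_ne_zero : c 0 ≠ 0
  pos : ∀ n, 0 < ℓ n
  strictMono : StrictMono ℓ
  tendsto : Tendsto ℓ atTop atTop

/-- In the closed half-plane `Re s ≥ σ`, the series `∑ c_n ℓ_n^{-s}` converges absolutely, and its
sum is `f s`. -/
def IsDirichletSum (c : ℕ → ℂ) (ℓ : ℕ → ℝ) (σ : ℝ) (f : ℂ → ℂ) : Prop :=
  ∀ s : ℂ, σ ≤ s.re →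
    Summable (fun n => ‖c n * (ℓ n : ℂ) ^ (-s)‖) ∧ HasSum (fun n => c n * (ℓ n : ℂ) ^ (-s)) (f s)

/-- The standing assumptions on two Dirichlet series with a functional equation.
`φ` and `ψ` denote the meromorphic functions on `ℂ` that continue the two series. They are taken
in normal form: analytic away from their poles. -/
structure Assumptions {d : ℕ} (a b : ℕ → ℂ) (lam mu : ℕ → ℝ) (α : Fin d → ℝ) (β β' : Fin d → ℂ)
    (ω : ℂ) (φ ψ : ℂ → ℂ) : Prop where
  datum_left : IsDirichletDatum a lam
  datum_right : IsDirichletDatum b mu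
  /-- Absolute convergence in a common half-plane `Re s ≥ σ`, `σ > 0`. -/
  absConv : ∃ σ : ℝ, 0 < σ ∧ IsDirichletSum a lam σ φ ∧ IsDirichletSum b mu σ ψ
  alpha_pos : ∀ ν, 0 < α ν
  norm_omega : ‖ω‖ = 1
  /-- The functional equation, an identity of meromorphic functions on `ℂ`: it holds off a closed
  discrete set. -/
  functionalEq : (fun s => gammaFactor α β s * φ s) =ᶠ[codiscrete ℂ]
    fun s => ω * gammaFactor α β' (1 - s) * ψ (1 - s)
  /-- Meromorphic continuation to `ℂ`. -/
  meromorphic_left : MeromorphicNFOn φ Set.univ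
  meromorphic_right : MeromorphicNFOn ψ Set.univ
  /-- All poles of `Δ φ` lie in a disk. -/
  poles_bounded : ∃ R : ℝ, 0 < R ∧ ∀ s, IsPole (fun z => gammaFactor α β z * φ z) s → ‖s‖ < R
  /-- `Δ(σ + it) φ(σ + it) → 0` as `|t| → ∞`, uniformly in every vertical strip. -/
  decay : ∀ x y ε : ℝ, 0 < ε → ∃ T : ℝ, ∀ s : ℂ, x ≤ s.re → s.re ≤ y → T ≤ |s.im| →
    ‖gammaFactor α β s * φ s‖ < ε

/-- The Selberg class axioms other than the functional equation, for `F` with Dirichlet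
coefficients `a(n)`, `n ≥ 1` (the value `a 0` plays no role). The value of `F` at the only possible
singularity `s = 1` is left free. -/
structure IsSelbergSeries (a : ℕ → ℂ) (F : ℂ → ℂ) : Prop where
  /-- `F(s) = ∑ a(n) n^{-s}`, absolutely convergent for `Re s > 1`. -/
  dirichlet : ∀ s : ℂ, 1 < s.re → LSeriesHasSum a s (F s)
  /-- For some integer `m ≥ 0`, `(s - 1)^m F(s)` is an entire function of finite order. -/
  continuation : ∃ (m : ℕ) (G : ℂ → ℂ), Differentiable ℂ G ∧ (∀ s, s ≠ 1 → (s - 1) ^ m * F s = G s) ∧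
    ∃ C ρ : ℝ, ∀ s, ‖G s‖ ≤ C * Real.exp (‖s‖ ^ ρ)
  /-- Ramanujan hypothesis: `a(n) ≪ n^ε` for every `ε > 0`. -/
  ramanujan : ∀ ε : ℝ, 0 < ε → ∃ C : ℝ, ∀ n : ℕ, 1 ≤ n → ‖a n‖ ≤ C * (n : ℝ) ^ ε
  /-- Euler product: `log F(s) = ∑ b(n) n^{-s}` for `Re s > 1`, where `b(n) = 0` unless `n` is a
  prime power `p^k` with `k ≥ 1`, and `b(n) ≪ n^θ` for some `θ < 1/2`. -/
  euler : ∃ (b : ℕ → ℂ) (θ C : ℝ), θ < 1 / 2 ∧ (∀ n : ℕ, ¬ IsPrimePow n → b n = 0) ∧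
    (∀ n : ℕ, 1 ≤ n → ‖b n‖ ≤ C * (n : ℝ) ^ θ) ∧
    ∀ s : ℂ, 1 < s.re → LSeriesSummable b s ∧ F s = Complex.exp (LSeries b s)

/-- The completed function `Q^s ∏_j Γ(α_j s + β_j) F(s)`. -/
def completed {r : ℕ} (Q : ℝ) (α : Fin r → ℝ) (β : Fin r → ℂ) (F : ℂ → ℂ) (s : ℂ) : ℂ :=
  (Q : ℂ) ^ s * gammaFactor α β s * F s

/-- `F` satisfies a functional equation of Selberg type, `Φ(s) = ω · conj Φ(1 - conj s)` as
meromorphic functions, with `Φ(s) = Q^s ∏_j Γ(α_j s + β_j) F(s)`. -/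
structure IsSelbergFunctionalEq {r : ℕ} (Q : ℝ) (α : Fin r → ℝ) (β : Fin r → ℂ) (ω : ℂ)
    (F : ℂ → ℂ) : Prop where
  Q_pos : 0 < Q
  alpha_pos : ∀ j, 0 < α j
  beta_re_nonneg : ∀ j, 0 ≤ (β j).re
  norm_omega : ‖ω‖ = 1
  eq : completed Q α β F =ᶠ[codiscrete ℂ]
    fun s => ω * (starRingEnd ℂ) (completed Q α β F (1 - (starRingEnd ℂ) s))

/-- The elements of the Selberg class that satisfy a functional equation of degree
`2 ∑_j α_j = D`. -/
def selbergClass (D : ℝ) : Set (ℂ → ℂ) :=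
  {F | (∃ a : ℕ → ℂ, IsSelbergSeries a F) ∧
    ∃ (r : ℕ) (Q : ℝ) (α : Fin r → ℝ) (β : Fin r → ℂ) (ω : ℂ),
      IsSelbergFunctionalEq Q α β ω F ∧ 2 * sumA α = D}

end ShortGap

end

/-!
The gaps are controlled by a Fourier-type summation formula, tested against wave packets.

Let `k = 2A`, and let `P` be a polynomial clearing the poles of `φ`, so that `E = P φ` is entire. In
the variable `z = k s` the gamma factors have total slope `1/2`, and the frequencies become
`l n = λ_n^{1/k}` and `m n = μ_n^{1/k}`. Pair `E` with the Mellin transform of a test function `v`.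
On a line far to the right, Mellin inversion turns the pairing into a sum over the values of
`v`, modified by a differential operator coming from `P`, at the points `l n`; it vanishes if no
`l n` lies in the support of `v`. On a line far to the left, the functional equation writes
`E(-N + it)` as a kernel `K(t)` times the dual series. By Stirling's formula and the reflection
formula (`exists_kernel_asymptotics`), `K(t)` is a combination of `Γ(θ - it) e^{±πt/2} e^{iqt}` up
to a relative error `O(1/t)`; and the pairing of such a kernel with `mellin v` is, up to a power of
`u`, the Fourier transform of `v` at the frequencies `±M n`, `M n = m n e^q`
(`integral_mellin_mul_Gamma`). Phragmén–Lindelöf allows the contour shift between the lines.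

Now let `v` be a bump of length `2H` around `u₀`, oscillating with frequency `-M 0`. On the dual
side, the term `n = 0` has size proportional to `H`. All other terms together are bounded
independently of `H`, as their frequencies are separated from `M 0`, and the error of the kernel
contributes `O(u₀^{-1/2})`. For `H` large but fixed and all large `u₀`, the dual side is therefore
nonzero, so some `l n` lies within `H` of `u₀` (`exists_frequency_near`). Hence the `λ_n^{1/k}` have
bounded gaps (`exists_rpow_frequency_near`), and since `1/k ≥ 1`, the mean value inequality yields
the stated bound for `λ_{n+1} - λ_n` (`exists_gap_le`).

For `F` in the Selberg class of degree `0 < D < 1` the frequencies are `n/Q`, with constant gaps,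
while the bound `C (n/Q)^{1 - 1/D}` tends to zero.
-/

namespace ShortGap

open Complex Asymptotics MeasureTheory

/-! ### Stirling's formula in the closed right half-plane -/

/-- The exponent `(z - 1/2) log z - z` of Stirling's approximation to `Γ(z) / √(2π)`. -/
noncomputable def stirlingLog (z : ℂ) : ℂ := (z - 1 / 2) * log z - z

/-- The increment `stirlingLog (z + 1) - stirlingLog z - log z`. -/
noncomputable def binetTerm (z : ℂ) : ℂ := (z + 1 / 2) * log (1 + 1 / z) - 1

lemma norm_binetTerm_le {z : ℂ} (hz : 2 ≤ ‖z‖) : ‖binetTerm z‖ ≤ 2 / ‖z‖ ^ 2 := by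
  have hz0 : z ≠ 0 := by
    rintro rfl
    simp at hz
    linarith
  have hzpos : 0 < ‖z‖ := by linarith
  set x : ℂ := 1 / z with hx
  have hzx : z * x = 1 := by rw [hx]; field_simp
  have hxn : ‖x‖ = 1 / ‖z‖ := by simp [hx]
  have hx2 : ‖x‖ ≤ 1 / 2 := by
    rw [hxn]
    exact one_div_le_one_div_of_le (by norm_num) hz
  have hlog := norm_log_sub_logTaylor_le 2 (z := x) (by linarith)
  have hT : logTaylor 3 x = x - x ^ 2 / 2 := by
    simp [logTaylor_succ, logTaylor_zero]
    ring
  norm_num at hlog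
  rw [hT] at hlog
  have hinv : (1 - ‖x‖)⁻¹ ≤ 2 := by
    rw [inv_le_comm₀ (by linarith) (by norm_num)]
    linarith
  have hlog' : ‖log (1 + x) - (x - x ^ 2 / 2)‖ ≤ ‖x‖ ^ 3 * 2 / 3 := by
    refine hlog.trans ?_
    gcongr
  have key : binetTerm z = (z + 1 / 2) * (log (1 + x) - (x - x ^ 2 / 2)) - x ^ 2 / 4 := by
    rw [binetTerm, ← hx]
    linear_combination (1 - x / 2) * hzx
  have h1 : ‖z + 1 / 2‖ ≤ ‖z‖ * (5 / 4) := by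
    refine (norm_add_le _ _).trans ?_
    norm_num
    linarith
  rw [key]
  refine (norm_sub_le _ _).trans ?_
  rw [norm_mul]
  have h2 : ‖x ^ 2 / 4‖ = ‖x‖ ^ 2 / 4 := by simp
  rw [h2]
  have h3 : ‖z‖ * ‖x‖ = 1 := by rw [hxn]; field_simp
  have h4 : 2 / ‖z‖ ^ 2 = 2 * ‖x‖ ^ 2 := by rw [hxn]; field_simp
  rw [h4]
  have h5 : ‖z + 1 / 2‖ * ‖log (1 + x) - (x - x ^ 2 / 2)‖ ≤
      (‖z‖ * (5 / 4)) * (‖x‖ ^ 3 * 2 / 3) := by gcongr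
  have h6 : (‖z‖ * (5 / 4)) * (‖x‖ ^ 3 * 2 / 3) = 5 / 6 * ‖x‖ ^ 2 := by
    linear_combination (5 / 6 * ‖x‖ ^ 2) * h3
  nlinarith [sq_nonneg ‖x‖]

/-- The logarithm is additive on products of a point of the closed right half-plane and a point of
the open one. -/
lemma log_mul_of_re_nonneg {a b : ℂ} (ha : 0 ≤ a.re) (ha0 : a ≠ 0) (hb : 0 < b.re) :
    log (a * b) = log a + log b := by
  have hb0 : b ≠ 0 := by rintro rfl; simp at hb
  rw [log_mul_eq_add_log_iff ha0 hb0]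
  have h1 := abs_le.mp (abs_arg_le_pi_div_two_iff.mpr ha)
  have h2 := abs_lt.mp (abs_arg_lt_pi_div_two_iff.mpr (Or.inl hb))
  constructor <;> linarith [h1.1, h1.2, h2.1, h2.2]

lemma re_one_add_pos {y : ℂ} (hy : ‖y‖ < 1) : 0 < (1 + y).re := by
  have := (abs_le.mp (abs_re_le_norm y)).1
  simp
  linarith

lemma stirlingLog_add_one {z : ℂ} (hz : 0 ≤ z.re) (hz0 : z ≠ 0) :
    stirlingLog (z + 1) = stirlingLog z + log z + binetTerm z := by
  have h1 : z + 1 = z * (1 + 1 / z) := by field_simp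
  have h2 : 0 < (1 + 1 / z).re := by
    have h := div_nonneg hz (normSq_nonneg z)
    simp only [add_re, one_re, one_div, inv_re]
    linarith
  have h3 : log (z + 1) = log z + log (1 + 1 / z) := by
    rw [h1]; exact log_mul_of_re_nonneg hz hz0 h2
  rw [stirlingLog, stirlingLog, binetTerm, h3]
  ring

lemma exp_stirlingLog_add_nat {z : ℂ} (hz : 0 ≤ z.re) (hz0 : z ≠ 0) (n : ℕ) :
    exp (stirlingLog (z + n)) = exp (stirlingLog z) * (∏ j ∈ Finset.range n, (z + j)) *
      exp (∑ j ∈ Finset.range n, binetTerm (z + j)) := by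
  induction n with
  | zero => simp
  | succ n ih =>
    have hne : z + n ≠ 0 := by
      intro h
      have hre := congrArg re h
      have him := congrArg im h
      simp at hre him
      apply hz0
      apply Complex.ext
      · simp
        have : (0 : ℝ) ≤ n := n.cast_nonneg
        linarith
      · simpa using him
    have hre : 0 ≤ (z + n).re := by
      simp
      positivity
    rw [Nat.cast_succ, ← add_assoc, stirlingLog_add_one hre hne, exp_add, exp_add, ih, exp_log hne,
      Finset.prod_range_succ, Finset.sum_range_succ, exp_add]
    ring

/-- Real Stirling, in the form needed for the Euler–Gauss product of `Γ(z)`. -/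
lemma tendsto_factorial_mul_exp_neg_stirlingLog {z : ℂ} (hz : 0 ≤ z.re) :
    Tendsto (fun n : ℕ => (n : ℂ) ^ z * (n.factorial : ℂ) * exp (-stirlingLog (z + (n + 1 : ℕ))))
      atTop (𝓝 (Real.sqrt (2 * Real.pi) : ℂ)) := by
  have hst : Tendsto (fun n : ℕ => ((Stirling.stirlingSeq n * Real.sqrt 2 : ℝ) : ℂ)) atTop
      (𝓝 ((Real.sqrt Real.pi * Real.sqrt 2 : ℝ) : ℂ)) :=
    (continuous_ofReal.tendsto _).comp (Stirling.tendsto_stirlingSeq_sqrt_pi.mul_const _)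
  have hs : (Real.sqrt Real.pi * Real.sqrt 2 : ℝ) = Real.sqrt (2 * Real.pi) := by
    rw [Real.sqrt_mul (by norm_num), mul_comm]
  rw [hs] at hst
  have hinv : Tendsto (fun n : ℕ => (z + 1) / (n : ℂ)) atTop (𝓝 0) :=
    tendsto_const_div_atTop_nhds_zero_nat (z + 1)
  have hn : Tendsto (fun n : ℕ => (n : ℂ) * log (1 + (z + 1) / n)) atTop (𝓝 (z + 1)) := by
    apply tendsto_nat_mul_log_one_add_of_tendsto
    refine tendsto_const_nhds.congr' ?_
    filter_upwards [eventually_ne_atTop 0] with n hn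
    have : (n : ℂ) ≠ 0 := by exact_mod_cast hn
    field_simp
  have hl : Tendsto (fun n : ℕ => log (1 + (z + 1) / n)) atTop (𝓝 0) := by
    have : Tendsto (fun n : ℕ => 1 + (z + 1) / (n : ℂ)) atTop (𝓝 (1 + 0)) := hinv.const_add 1
    rw [add_zero] at this
    simpa using this.clog (by simp)
  have hlim : Tendsto (fun n : ℕ => exp (z + 1 - ((n : ℂ) * log (1 + (z + 1) / n) +
      (z + 1 / 2) * log (1 + (z + 1) / n)))) atTop (𝓝 1) := by
    have h := (hn.add (hl.const_mul (z + 1 / 2))).const_sub (z + 1)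
    have h' := (continuous_exp.tendsto _).comp h
    simpa [Function.comp_def] using h'
  have := hst.mul hlim
  rw [mul_one] at this
  refine this.congr' ?_
  filter_upwards [eventually_ne_atTop 0] with n hn0
  have hnC : (n : ℂ) ≠ 0 := by exact_mod_cast hn0
  have hnpos : (0 : ℝ) < n := by exact_mod_cast Nat.pos_of_ne_zero hn0
  have hfac : ((Stirling.stirlingSeq n * Real.sqrt 2 : ℝ) : ℂ) =
      n.factorial * exp (-((n + 1 / 2) * log n - n)) := by
    have hreal : Stirling.stirlingSeq n * Real.sqrt 2 =
        n.factorial * Real.exp (-((n + 1 / 2) * Real.log n - n)) := by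
      have e1 : Real.exp (-((n + 1 / 2) * Real.log n - n)) =
          1 / (Real.sqrt n * (n / Real.exp 1) ^ n) := by
        have hsq : Real.sqrt n = Real.exp (1 / 2 * Real.log n) := by
          rw [Real.sqrt_eq_rpow, Real.rpow_def_of_pos hnpos, mul_comm]
        have hpow : ((n : ℝ) / Real.exp 1) ^ n = Real.exp (n * Real.log n - n) := by
          have : (n : ℝ) / Real.exp 1 = Real.exp (Real.log n - 1) := by
            rw [Real.exp_sub, Real.exp_log hnpos]
          rw [this, ← Real.exp_nat_mul]
          ring_nf
        rw [hsq, hpow, ← Real.exp_add, one_div (Real.exp _), ← Real.exp_neg]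
        congr 1
        ring
      rw [e1, Stirling.stirlingSeq, Real.sqrt_mul (by norm_num)]
      field_simp
    rw [hreal, ← natCast_log]
    push_cast
    rfl
  have hlog : log (z + (n + 1 : ℕ)) = log n + log (1 + (z + 1) / n) := by
    have h2 : 0 < (1 + (z + 1) / n).re := by
      rw [add_re, one_re, div_natCast_re, add_re, one_re]
      positivity
    rw [← log_mul_of_re_nonneg (by simp) hnC h2]
    congr 1
    push_cast
    field_simp
    ring
  rw [hfac, cpow_def_of_ne_zero hnC, stirlingLog, hlog, mul_assoc, ← exp_add, mul_right_comm,
    ← exp_add, mul_comm]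
  congr 2
  push_cast
  ring

lemma sum_norm_binetTerm_le {z : ℂ} (hz : 0 ≤ z.re) (hz2 : 2 ≤ ‖z‖) (n : ℕ) :
    ∑ j ∈ Finset.range n, ‖binetTerm (z + j)‖ ≤ 8 / ‖z‖ := by
  set R := ‖z‖ with hR
  have hterm : ∀ j : ℕ, ‖binetTerm (z + j)‖ ≤ 4 * (1 / (R + j - 1) - 1 / (R + j)) := by
    intro j
    have hj : (0 : ℝ) ≤ j := j.cast_nonneg
    have hsq : R ^ 2 + j ^ 2 ≤ ‖z + j‖ ^ 2 := by
      rw [hR, Complex.sq_norm, Complex.sq_norm, normSq_apply, normSq_apply]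
      simp
      nlinarith
    have h2 : 2 ≤ ‖z + j‖ := by
      by_contra hcon
      push Not at hcon
      nlinarith [norm_nonneg (z + j)]
    refine (norm_binetTerm_le h2).trans ?_
    have h3 : (R + j) ^ 2 ≤ 2 * ‖z + j‖ ^ 2 := by nlinarith [sq_nonneg (R - j)]
    have h4 : 2 / ‖z + j‖ ^ 2 ≤ 4 / (R + j) ^ 2 := by
      rw [div_le_div_iff₀ (by positivity) (by positivity)]
      linarith
    refine h4.trans ?_
    have h5 : 0 < R + j - 1 := by linarith
    have h6 : 0 < R + j := by linarith
    rw [div_sub_div _ _ h5.ne' h6.ne', ← mul_div_assoc, div_le_div_iff₀ (by positivity)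
      (by positivity)]
    nlinarith
  have hsum : ∀ n : ℕ, ∑ j ∈ Finset.range n, (1 / (R + j - 1) - 1 / (R + j)) =
      1 / (R - 1) - 1 / (R + n - 1) := by
    intro n
    induction n with
    | zero => simp
    | succ n ih =>
      rw [Finset.sum_range_succ, ih]
      push_cast
      ring_nf
  have hn : (0 : ℝ) ≤ n := n.cast_nonneg
  calc ∑ j ∈ Finset.range n, ‖binetTerm (z + j)‖
      ≤ ∑ j ∈ Finset.range n, 4 * (1 / (R + j - 1) - 1 / (R + j)) :=
        Finset.sum_le_sum fun j _ => hterm j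
    _ = 4 * (1 / (R - 1) - 1 / (R + n - 1)) := by rw [← Finset.mul_sum, hsum]
    _ ≤ 4 * (1 / (R - 1)) := by
        have : 0 ≤ 1 / (R + n - 1) := by
          apply div_nonneg zero_le_one
          linarith
        linarith
    _ ≤ 8 / R := by
        rw [mul_one_div, div_le_div_iff₀ (by linarith) (by linarith)]
        linarith

/-- Stirling's formula with relative error `O(1/|z|)`, uniformly in the closed right half-plane.
It follows from Gauss's product for `Γ` by telescoping `stirlingLog`. -/
theorem norm_Gamma_div_stirling_sub_one_le {z : ℂ} (hz : 0 ≤ z.re) (hz8 : 8 ≤ ‖z‖) :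
    ‖Gamma z / (Real.sqrt (2 * Real.pi) * exp (stirlingLog z)) - 1‖ ≤ 16 / ‖z‖ := by
  have hz0 : z ≠ 0 := by
    rintro rfl
    norm_num at hz8
  have hsq : (Real.sqrt (2 * Real.pi) : ℂ) ≠ 0 := by
    rw [ofReal_ne_zero]
    positivity
  have hbt := (tendsto_factorial_mul_exp_neg_stirlingLog hz).div_const
    (Real.sqrt (2 * Real.pi) : ℂ)
  rw [div_self hsq] at hbt
  have hG := (GammaSeq_tendsto_Gamma z).div_const (Real.sqrt (2 * Real.pi) * exp (stirlingLog z))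
  have hquot := (hG.div hbt one_ne_zero).sub_const 1
  rw [div_one] at hquot
  refine le_of_tendsto hquot.norm ?_
  filter_upwards [eventually_ne_atTop 0] with n hn0
  have hnC : (n : ℂ) ≠ 0 := by exact_mod_cast hn0
  have hprod : ∏ j ∈ Finset.range (n + 1), (z + j) ≠ 0 := by
    rw [Finset.prod_ne_zero_iff]
    intro j _ h
    have h1 : (z + j).re = 0 := by rw [h]; simp
    have h2 : (z + j).im = 0 := by rw [h]; simp
    simp at h1 h2
    have hj : (0 : ℝ) ≤ j := j.cast_nonneg
    exact hz0 (Complex.ext (by simp; linarith) (by simpa using h2))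
  have hcp : (n : ℂ) ^ z ≠ 0 := by simp [cpow_eq_zero_iff, hnC]
  have hf : (n.factorial : ℂ) ≠ 0 := by exact_mod_cast n.factorial_ne_zero
  set S := ∑ j ∈ Finset.range (n + 1), binetTerm (z + j) with hS
  -- Gauss's product divided by its own Stirling approximation telescopes to `exp S`
  have hval : GammaSeq z n / (Real.sqrt (2 * Real.pi) * exp (stirlingLog z)) /
      ((n : ℂ) ^ z * (n.factorial : ℂ) * exp (-stirlingLog (z + (n + 1 : ℕ))) /
        (Real.sqrt (2 * Real.pi) : ℂ)) = exp S := by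
    rw [GammaSeq, exp_neg, exp_stirlingLog_add_nat hz hz0]
    field_simp
    rfl
  rw [Pi.div_apply, hval]
  have hSn : ‖S‖ ≤ 8 / ‖z‖ :=
    (norm_sum_le _ _).trans (sum_norm_binetTerm_le hz (by linarith) _)
  have hS1 : ‖S‖ ≤ 1 := hSn.trans (by rw [div_le_one (by linarith)]; exact hz8)
  refine (norm_exp_sub_one_le hS1).trans ?_
  rw [show (16 : ℝ) / ‖z‖ = 2 * (8 / ‖z‖) by ring]
  gcongr

/-! ### Gamma quotients on vertical lines -/

/-- `f(t) = 1 + O(1/t)` along the filter `l`. -/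
def AsympOne (l : Filter ℝ) (f : ℝ → ℂ) : Prop := (fun t => f t - 1) =O[l] (fun t : ℝ => t⁻¹)

lemma tendsto_inv_of_le_cocompact {l : Filter ℝ} (hl : l ≤ cocompact ℝ) :
    Tendsto (fun t : ℝ => t⁻¹) l (𝓝 0) :=
  (tendsto_inv₀_cobounded (α := ℝ)).mono_left (by rwa [Metric.cobounded_eq_cocompact])

lemma AsympOne.tendsto {l : Filter ℝ} (hl : l ≤ cocompact ℝ) {f : ℝ → ℂ} (hf : AsympOne l f) :
    Tendsto f l (𝓝 1) := by
  have h := (IsBigO.trans_tendsto hf (tendsto_inv_of_le_cocompact hl)).add_const 1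
  simpa using h

lemma AsympOne.mul {l : Filter ℝ} (hl : l ≤ cocompact ℝ) {f g : ℝ → ℂ} (hf : AsympOne l f)
    (hg : AsympOne l g) : AsympOne l (fun t => f t * g t) := by
  have h1 : (fun t => (f t - 1) * g t) =O[l] (fun t : ℝ => t⁻¹) := by
    simpa using IsBigO.mul hf ((hg.tendsto hl).isBigO_one ℝ)
  refine (h1.add hg).congr_left fun t => ?_
  ring

lemma AsympOne.inv {l : Filter ℝ} (hl : l ≤ cocompact ℝ) {f : ℝ → ℂ} (hf : AsympOne l f) :
    AsympOne l (fun t => (f t)⁻¹) := by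
  have ht := hf.tendsto hl
  have h1 : (fun t => (f t - 1) * (-(f t)⁻¹)) =O[l] (fun t : ℝ => t⁻¹) := by
    have h2 : Tendsto (fun t => -(f t)⁻¹) l (𝓝 (-(1 : ℂ)⁻¹)) := (ht.inv₀ one_ne_zero).neg
    simpa using IsBigO.mul hf (h2.isBigO_one ℝ)
  refine h1.congr' ?_ EventuallyEq.rfl
  filter_upwards [ht.eventually_ne one_ne_zero] with t h
  field_simp
  ring

lemma AsympOne.const_one (l : Filter ℝ) : AsympOne l (fun _ => 1) := by
  unfold AsympOne
  simpa using isBigO_zero _ _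

lemma AsympOne.finset_prod {ι : Type*} {l : Filter ℝ} (hl : l ≤ cocompact ℝ) (s : Finset ι)
    {f : ι → ℝ → ℂ} (hf : ∀ i, AsympOne l (f i)) : AsympOne l (fun t => ∏ i ∈ s, f i t) := by
  classical
  induction s using Finset.induction_on with
  | empty => simpa using AsympOne.const_one l
  | insert i s hi ih =>
    simp only [Finset.prod_insert hi]
    exact (hf i).mul hl ih

lemma AsympOne.multiset_prod {ι : Type*} {l : Filter ℝ} (hl : l ≤ cocompact ℝ) (s : Multiset ι)
    {f : ι → ℝ → ℂ} (hf : ∀ i, AsympOne l (f i)) :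
    AsympOne l (fun t => (s.map fun i => f i t).prod) := by
  induction s using Multiset.induction_on with
  | empty => simpa using AsympOne.const_one l
  | cons i s ih =>
    simp only [Multiset.map_cons, Multiset.prod_cons]
    exact (hf i).mul hl ih

lemma AsympOne.congr' {l : Filter ℝ} {f g : ℝ → ℂ} (hf : AsympOne l f) (h : f =ᶠ[l] g) :
    AsympOne l g := by
  refine IsBigO.congr' hf ?_ EventuallyEq.rfl
  filter_upwards [h] with t ht
  rw [ht]

lemma AsympOne.mono {l l' : Filter ℝ} {f : ℝ → ℂ} (hf : AsympOne l f) (h : l' ≤ l) :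
    AsympOne l' f := IsBigO.mono hf h

lemma AsympOne.exp {l : Filter ℝ} (hl : l ≤ cocompact ℝ) {D : ℝ → ℂ}
    (hD : D =O[l] (fun t : ℝ => t⁻¹)) : AsympOne l (fun t => Complex.exp (D t)) := by
  have ht : Tendsto D l (𝓝 0) := hD.trans_tendsto (tendsto_inv_of_le_cocompact hl)
  refine IsBigO.trans ?_ hD
  refine IsBigO.of_bound 2 ?_
  have hn : Tendsto (fun t => ‖D t‖) l (𝓝 0) := by simpa using ht.norm
  filter_upwards [hn.eventually_le_const one_pos] with t h
  exact norm_exp_sub_one_le h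

/-- Stirling's exponent of `Γ(α w + δ)`, with the logarithm expanded at `α w`. -/
noncomputable def stirlingLine (α : ℝ) (δ w : ℂ) : ℂ :=
  (α * w + δ - 1 / 2) * (log w + Real.log α) - α * w

lemma eventually_abs_ge_cocompact (C : ℝ) : ∀ᶠ t : ℝ in cocompact ℝ, C ≤ |t| := by
  have := tendsto_norm_cocompact_atTop (E := ℝ)
  exact this.eventually_ge_atTop C

/-- The points `-it` are used as base points so that `Re w = 0` and `log w` is explicit. -/
lemma asympOne_Gamma_line {α : ℝ} (hα : 0 < α) {δ : ℂ} (hδ : 0 < δ.re) :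
    AsympOne (cocompact ℝ) (fun t : ℝ => Gamma (α * (-(t * I)) + δ) /
      (Real.sqrt (2 * Real.pi) * Complex.exp (stirlingLine α δ (-(t * I))))) := by
  have hle : cocompact ℝ ≤ cocompact ℝ := le_rfl
  set ζ : ℝ → ℂ := fun t => α * (-(t * I)) + δ with hζ
  have hnorm : ∀ t : ℝ, α * |t| - ‖δ‖ ≤ ‖ζ t‖ := by
    intro t
    have h := norm_sub_norm_le (α * (-(t * I)) : ℂ) (-δ)
    simp only [norm_mul, norm_neg, norm_real, norm_I, mul_one, Real.norm_eq_abs, abs_of_pos hα,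
      sub_neg_eq_add] at h
    exact h
  -- Stirling's formula at `ζ t`, followed by the expansion of the exponent at `α w`
  have h1 : AsympOne (cocompact ℝ)
      (fun t => Gamma (ζ t) / (Real.sqrt (2 * Real.pi) * Complex.exp (stirlingLog (ζ t)))) := by
    refine IsBigO.of_bound (32 / α) ?_
    filter_upwards [eventually_abs_ge_cocompact ((8 + 2 * ‖δ‖) / α + 1),
      eventually_abs_ge_cocompact (16 / α)] with t ht ht'
    have h2 : 8 + 2 * ‖δ‖ ≤ α * |t| := by
      have : (8 + 2 * ‖δ‖) / α ≤ |t| := by linarith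
      rw [div_le_iff₀ hα] at this
      linarith
    have h2' : 16 ≤ α * |t| := by
      rw [div_le_iff₀ hα] at ht'
      linarith
    have h3 := hnorm t
    have h4 : α * |t| / 2 ≤ ‖ζ t‖ := by linarith
    have h5 : 8 ≤ ‖ζ t‖ := by linarith
    have hre : 0 ≤ (ζ t).re := by simp [hζ]; exact hδ.le
    refine (norm_Gamma_div_stirling_sub_one_le hre h5).trans ?_
    have htpos : 0 < |t| := by
      rcases (abs_nonneg t).lt_or_eq with h | h
      · exact h
      · rw [← h] at h2'; linarith
    rw [norm_inv, Real.norm_eq_abs, ← div_eq_mul_inv, div_div, div_le_div_iff₀ (by linarith)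
      (by positivity)]
    linarith
  have h2 : AsympOne (cocompact ℝ)
      (fun t => Complex.exp (stirlingLog (ζ t) - stirlingLine α δ (-(t * I)))) := by
    apply AsympOne.exp hle
    refine IsBigO.of_bound (‖δ‖ ^ 2 / α + ‖δ - 1 / 2‖ * (3 / 2 * (‖δ‖ / α))) ?_
    filter_upwards [eventually_abs_ge_cocompact (2 * ‖δ‖ / α + 1)] with t ht
    have hquot : 0 ≤ 2 * ‖δ‖ / α := by positivity
    have htpos : 0 < |t| := by linarith
    have ht0 : t ≠ 0 := abs_pos.mp htpos
    set w : ℂ := -(t * I) with hw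
    have hw0 : w ≠ 0 := by simp [hw, ht0]
    have hwn : ‖w‖ = |t| := by simp [hw]
    have hαC : (α : ℂ) ≠ 0 := by exact_mod_cast hα.ne'
    set y : ℂ := δ / (α * w) with hy
    have hyn : ‖y‖ = ‖δ‖ / (α * |t|) := by
      rw [hy, norm_div, norm_mul, hwn, norm_real, Real.norm_eq_abs, abs_of_pos hα]
    have hy2 : ‖y‖ ≤ 1 / 2 := by
      rw [hyn, div_le_iff₀ (by positivity)]
      have : 2 * ‖δ‖ / α ≤ |t| := by linarith
      rw [div_le_iff₀ hα] at this
      linarith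
    have hwy : α * w * y = δ := by rw [hy]; field_simp
    have hlogζ : log (ζ t) = log w + Real.log α + log (1 + y) := by
      have e : ζ t = (α * w) * (1 + y) := by
        rw [hζ]; simp only; rw [mul_add, hwy, mul_one]
      rw [e, log_mul_of_re_nonneg (by simp [hw]) (mul_ne_zero hαC hw0)
        (re_one_add_pos (by linarith)), log_ofReal_mul hα hw0]
      ring
    have hD : stirlingLog (ζ t) - stirlingLine α δ w =
        α * w * (log (1 + y) - y) + (δ - 1 / 2) * log (1 + y) := by
      rw [stirlingLog, stirlingLine, hlogζ]
      simp only [hζ]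
      rw [← hw]
      linear_combination hwy
    rw [hD, norm_inv, Real.norm_eq_abs]
    have b1 : ‖log (1 + y) - y‖ ≤ ‖y‖ ^ 2 := by
      refine (norm_log_one_add_sub_self_le (by linarith)).trans ?_
      have hinv : (1 - ‖y‖)⁻¹ ≤ 2 := by
        rw [inv_le_comm₀ (by linarith) (by norm_num)]
        linarith
      have : ‖y‖ ^ 2 * (1 - ‖y‖)⁻¹ ≤ ‖y‖ ^ 2 * 2 := by gcongr
      linarith
    have b2 := norm_log_one_add_half_le_self hy2
    refine (norm_add_le _ _).trans ?_
    rw [add_mul]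
    apply add_le_add
    · rw [norm_mul, norm_mul, hwn, norm_real, Real.norm_eq_abs, abs_of_pos hα]
      calc α * |t| * ‖log (1 + y) - y‖ ≤ α * |t| * ‖y‖ ^ 2 := by gcongr
        _ = ‖δ‖ ^ 2 / α * |t|⁻¹ := by rw [hyn]; field_simp
    · rw [norm_mul]
      calc ‖δ - 1 / 2‖ * ‖log (1 + y)‖ ≤ ‖δ - 1 / 2‖ * (3 / 2 * ‖y‖) := by gcongr
        _ = ‖δ - 1 / 2‖ * (3 / 2 * (‖δ‖ / α)) * |t|⁻¹ := by rw [hyn]; field_simp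
  refine (h1.mul hle h2).congr' (Eventually.of_forall fun t => ?_)
  simp only
  rw [exp_sub]
  have hs : (Real.sqrt (2 * Real.pi) : ℂ) ≠ 0 := by
    rw [ofReal_ne_zero]; positivity
  have he : ζ t = α * (-(t * I)) + δ := rfl
  rw [← he]
  field_simp [Complex.exp_ne_zero]

lemma log_neg_mul_I {t : ℝ} (ht : t ≠ 0) :
    log (-(t * I)) = Real.log |t| - (SignType.sign t : ℝ) * (Real.pi / 2) * I := by
  rcases lt_or_gt_of_ne ht with h | h
  · have : (-(t * I) : ℂ) = ((-t : ℝ) : ℂ) * I := by push_cast; ring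
    rw [this, log_ofReal_mul (by linarith) I_ne_zero, log_I, abs_of_neg h, sign_neg h]
    push_cast
    simp
  · have : (-(t * I) : ℂ) = (t : ℂ) * (-I) := by ring
    rw [this, log_ofReal_mul h (neg_ne_zero.mpr I_ne_zero), log_neg_I, abs_of_pos h, sign_pos h]
    simp
    ring

/-- The decay of `Γ` on a vertical line. -/
lemma isBigO_Gamma_line {θ : ℂ} (hθ : 0 < θ.re) :
    (fun t : ℝ => Gamma (-(t * I) + θ)) =O[cocompact ℝ]
      (fun t : ℝ => |t| ^ (θ.re - 1 / 2) * Real.exp (-(Real.pi / 2 * |t|))) := by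
  have hle : cocompact ℝ ≤ cocompact ℝ := le_rfl
  have h1 := ((asympOne_Gamma_line one_pos hθ).tendsto hle).isBigO_one ℝ
  have h2 : (fun t : ℝ => (Real.sqrt (2 * Real.pi) * Complex.exp (stirlingLine 1 θ (-(t * I))) : ℂ))
      =O[cocompact ℝ] (fun t : ℝ => |t| ^ (θ.re - 1 / 2) * Real.exp (-(Real.pi / 2 * |t|))) := by
    refine IsBigO.of_bound (Real.sqrt (2 * Real.pi) * Real.exp (Real.pi / 2 * |θ.im|)) ?_
    filter_upwards [eventually_abs_ge_cocompact 1] with t ht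
    have htpos : 0 < |t| := by linarith
    have ht0 : t ≠ 0 := abs_pos.mp htpos
    rw [norm_mul, norm_real, Real.norm_of_nonneg (Real.sqrt_nonneg _), norm_exp, mul_assoc]
    gcongr
    rw [Real.norm_of_nonneg (by positivity), Real.rpow_def_of_pos htpos, ← Real.exp_add,
      ← Real.exp_add, Real.exp_le_exp, stirlingLine, log_neg_mul_I ht0]
    set ε : ℝ := (SignType.sign t : ℝ) with hε
    have hs1 : ε * t = |t| := by
      rcases lt_or_gt_of_ne ht0 with h | h
      · simp [hε, sign_neg h, abs_of_neg h]
      · simp [hε, sign_pos h, abs_of_pos h]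
    have hs2 : ε * θ.im ≤ |θ.im| := by
      rcases lt_or_gt_of_ne ht0 with h | h
      · simp [hε, sign_neg h]; exact neg_le_abs _
      · simp [hε, sign_pos h]; exact le_abs_self _
    have hre : ((((1 : ℝ) : ℂ) * -(t * I) + θ - 1 / 2) * ((Real.log |t| : ℂ) -
        (ε : ℂ) * (Real.pi / 2) * I + (Real.log 1 : ℝ)) - ((1 : ℝ) : ℂ) * -(t * I)).re =
        Real.log |t| * (θ.re - 1 / 2) - Real.pi / 2 * (ε * t) + Real.pi / 2 * (ε * θ.im) := by
      have e : (Real.pi / 2 : ℂ) = ((Real.pi / 2 : ℝ) : ℂ) := by push_cast; ring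
      rw [e]
      simp
      ring
    rw [hre, hs1]
    nlinarith [mul_le_mul_of_nonneg_left hs2 (by positivity : 0 ≤ Real.pi / 2)]
  have h3 := h1.mul h2
  refine (h3.congr_left fun t => ?_).trans (isBigO_of_le _ fun t => by simp)
  have hs : (Real.sqrt (2 * Real.pi) : ℂ) ≠ 0 := by
    rw [ofReal_ne_zero]; positivity
  rw [div_mul_cancel₀ _ (mul_ne_zero hs (Complex.exp_ne_zero _))]
  simp

/-- A polynomial compared with its leading monomial, on the line `Re z = -N`. -/
lemma asympOne_polynomial {P : Polynomial ℂ} (hP : P ≠ 0) (N : ℝ) :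
    AsympOne (cocompact ℝ) (fun t : ℝ => P.eval (-N + t * I) /
      (P.leadingCoeff * (t * I) ^ P.natDegree)) := by
  have hle : cocompact ℝ ≤ cocompact ℝ := le_rfl
  have hroot : ∀ ρ : ℂ, AsympOne (cocompact ℝ) (fun t : ℝ => (-N + t * I - ρ) / (t * I)) := by
    intro ρ
    refine IsBigO.of_bound ‖(N : ℂ) + ρ‖ ?_
    filter_upwards [eventually_abs_ge_cocompact 1] with t ht
    have ht0 : (t : ℂ) ≠ 0 := by
      have : 0 < |t| := by linarith
      exact_mod_cast abs_pos.mp this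
    have : (-N + t * I - ρ) / (t * I) - 1 = -(N + ρ) / (t * I) := by
      field_simp [I_ne_zero]
      ring
    rw [this, norm_div, norm_neg]
    simp [div_eq_mul_inv]
  refine (AsympOne.multiset_prod hle P.roots hroot).congr' ?_
  filter_upwards [eventually_abs_ge_cocompact 1] with t ht
  have hsplit := IsAlgClosed.splits P
  have hev : P.eval (-N + t * I) = P.leadingCoeff * (P.roots.map fun ρ => -N + t * I - ρ).prod :=
    hsplit.eval_eq_prod_roots _
  have hlc : P.leadingCoeff ≠ 0 := Polynomial.leadingCoeff_ne_zero.mpr hP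
  rw [hev, Multiset.prod_map_div, Multiset.map_const', Multiset.prod_replicate,
    ← hsplit.natDegree_eq_card_roots, mul_div_mul_left _ _ hlc]

/-- A polynomial times a product of `Γ`-factors of total slope `1` is, on a vertical line, a single
`Γ`-factor times an exponential, up to a relative error `O(1/t)`. -/
lemma asympOne_Gamma_quotient {d : ℕ} {α : Fin d → ℝ} (hα : ∀ ν, 0 < α ν)
    (hsum : ∑ ν, α ν = 1 / 2) {P : Polynomial ℂ} (hP : P ≠ 0) (N : ℝ) {δ δ' : Fin d → ℂ}
    (hδ : ∀ ν, 0 < (δ ν).re) (hδ' : ∀ ν, 0 < (δ' ν).re) {θ : ℂ} (hθ : 0 < θ.re)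
    (hθd : θ - 1 / 2 = ∑ ν, (δ ν + δ' ν - 1) + P.natDegree) :
    ∃ (κ : ℂ) (q : ℝ), κ ≠ 0 ∧ AsympOne (cocompact ℝ) (fun t : ℝ =>
      P.eval (-N + t * I) * (∏ ν, Gamma (α ν * (-(t * I)) + δ ν) * Gamma (α ν * (-(t * I)) + δ' ν)) /
        (κ * Complex.exp (q * (t * I)) * Gamma (-(t * I) + θ))) := by
  have hle : cocompact ℝ ≤ cocompact ℝ := le_rfl
  set S : ℂ := (Real.sqrt (2 * Real.pi) : ℂ) with hS
  have hS0 : S ≠ 0 := by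
    rw [hS, ofReal_ne_zero]; positivity
  have hlc : P.leadingCoeff ≠ 0 := Polynomial.leadingCoeff_ne_zero.mpr hP
  set c₀ : ℂ := ∑ ν, (δ ν + δ' ν - 1) * Real.log (α ν) with hc₀
  set q : ℝ := -∑ ν, 2 * α ν * Real.log (α ν) with hq
  refine ⟨P.leadingCoeff * (-1) ^ P.natDegree * (∏ _ν : Fin d, S * S) * Complex.exp c₀ / S, q, ?_, ?_⟩
  · refine div_ne_zero (mul_ne_zero (mul_ne_zero (mul_ne_zero hlc ?_) ?_) (Complex.exp_ne_zero _)) hS0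
    · exact pow_ne_zero _ (by norm_num)
    · exact Finset.prod_ne_zero_iff.mpr fun _ _ => mul_ne_zero hS0 hS0
  have h1 := AsympOne.finset_prod hle Finset.univ fun ν =>
    (asympOne_Gamma_line (hα ν) (hδ ν)).mul hle (asympOne_Gamma_line (hα ν) (hδ' ν))
  have h2 := (asympOne_Gamma_line one_pos hθ).inv hle
  have h3 := ((asympOne_polynomial hP N).mul hle h1).mul hle h2
  refine h3.congr' ?_
  filter_upwards [eventually_abs_ge_cocompact 1] with t ht
  have htpos : 0 < |t| := by linarith
  have ht0 : t ≠ 0 := abs_pos.mp htpos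
  have htC : (t : ℂ) ≠ 0 := by exact_mod_cast ht0
  set w : ℂ := -(t * I) with hw
  have hw0 : w ≠ 0 := by simp [hw, ht0]
  have htw : (t * I : ℂ) = -w := by rw [hw]; ring
  have hG : Gamma (w + θ) ≠ 0 := Gamma_ne_zero_of_re_pos (by simp [hw, hθ])
  -- Stirling's exponents add up
  have hexp : (∏ ν, (S * Complex.exp (stirlingLine (α ν) (δ ν) w)) *
      (S * Complex.exp (stirlingLine (α ν) (δ' ν) w))) * w ^ P.natDegree =
      (∏ _ν : Fin d, S * S) * Complex.exp c₀ * Complex.exp (q * (-w)) *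
        Complex.exp (stirlingLine 1 θ w) := by
    have e1 : w ^ P.natDegree = Complex.exp (P.natDegree * log w) := by
      rw [Complex.exp_nat_mul, exp_log hw0]
    have e2 : (∏ ν, (S * Complex.exp (stirlingLine (α ν) (δ ν) w)) *
        (S * Complex.exp (stirlingLine (α ν) (δ' ν) w))) = (∏ _ν : Fin d, S * S) *
        Complex.exp (∑ ν, (stirlingLine (α ν) (δ ν) w + stirlingLine (α ν) (δ' ν) w)) := by
      rw [Complex.exp_sum, ← Finset.prod_mul_distrib]
      refine Finset.prod_congr rfl fun ν _ => ?_
      rw [Complex.exp_add]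
      ring
    rw [e1, e2, mul_assoc, ← Complex.exp_add, mul_assoc, mul_assoc, ← Complex.exp_add,
      ← Complex.exp_add]
    congr 2
    have hsumC : (∑ ν, (α ν : ℂ)) = 1 / 2 := by
      rw [← ofReal_sum, hsum]; push_cast; rfl
    have e3 : ∑ ν, (stirlingLine (α ν) (δ ν) w + stirlingLine (α ν) (δ' ν) w) =
        2 * (∑ ν, (α ν : ℂ)) * w * (log w - 1) + (∑ ν, (δ ν + δ' ν - 1)) * log w + c₀ +
        (∑ ν, 2 * (α ν : ℂ) * Real.log (α ν)) * w := by
      rw [hc₀]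
      simp only [Finset.mul_sum, Finset.sum_mul, ← Finset.sum_add_distrib]
      refine Finset.sum_congr rfl fun ν _ => ?_
      simp only [stirlingLine]
      ring
    have e4 : (∑ ν, 2 * (α ν : ℂ) * Real.log (α ν)) = -(q : ℂ) := by
      rw [hq]; push_cast; ring
    rw [e3, e4, hsumC, stirlingLine]
    simp only [ofReal_one, Real.log_one, ofReal_zero]
    linear_combination (-log w) * hθd
  rw [htw]
  simp only [ofReal_one, one_mul]
  have hprod0 : (∏ ν, (S * Complex.exp (stirlingLine (α ν) (δ ν) w)) *
      (S * Complex.exp (stirlingLine (α ν) (δ' ν) w))) ≠ 0 :=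
    Finset.prod_ne_zero_iff.mpr fun _ _ => mul_ne_zero (mul_ne_zero hS0 (Complex.exp_ne_zero _))
      (mul_ne_zero hS0 (Complex.exp_ne_zero _))
  have hSS : (∏ _ν : Fin d, S * S) ≠ 0 :=
    Finset.prod_ne_zero_iff.mpr fun _ _ => mul_ne_zero hS0 hS0
  have hdist : (∏ ν, Gamma (α ν * w + δ ν) / (S * Complex.exp (stirlingLine (α ν) (δ ν) w)) *
      (Gamma (α ν * w + δ' ν) / (S * Complex.exp (stirlingLine (α ν) (δ' ν) w)))) =
      (∏ ν, Gamma (α ν * w + δ ν) * Gamma (α ν * w + δ' ν)) /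
      (∏ ν, (S * Complex.exp (stirlingLine (α ν) (δ ν) w)) *
      (S * Complex.exp (stirlingLine (α ν) (δ' ν) w))) := by
    rw [← Finset.prod_div_distrib]
    refine Finset.prod_congr rfl fun ν _ => ?_
    rw [div_mul_div_comm]
  rw [hdist]
  set G := ∏ ν, Gamma (α ν * w + δ ν) * Gamma (α ν * w + δ' ν)
  set A := ∏ ν, (S * Complex.exp (stirlingLine (α ν) (δ ν) w)) *
      (S * Complex.exp (stirlingLine (α ν) (δ' ν) w))
  set B := ∏ _ν : Fin d, S * S
  set p := Polynomial.eval (-(N : ℂ) + -w) P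
  have hA : A = B * Complex.exp c₀ * Complex.exp (q * (-w)) *
        Complex.exp (stirlingLine 1 θ w) / w ^ P.natDegree := by
    rw [← hexp, mul_div_cancel_right₀ _ (pow_ne_zero _ hw0)]
  rw [hA, neg_pow w]
  have hw1 := pow_ne_zero P.natDegree hw0
  have hm1 : ((-1 : ℂ)) ^ P.natDegree ≠ 0 := pow_ne_zero _ (by norm_num)
  field_simp
  rw [hS]

/-- `sin(πζ)` is dominated by one of its two exponentials; `s = ±1` selects the half-plane. -/
lemma asympOne_sin {l : Filter ℝ} {s : ℝ} (hs : s = 1 ∨ s = -1)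
    (hl : Tendsto (fun t => s * t) l atTop) {α : ℝ} (hα : 0 < α) (β : ℂ) (N : ℝ) :
    AsympOne l (fun t : ℝ => Complex.sin (Real.pi * (α * (-N + t * I) + β)) /
      (s * I / 2 * Complex.exp (-(s * I * (Real.pi * (α * (-N + t * I) + β)))))) := by
  have hs2 : (s : ℂ) * s = 1 := by rcases hs with rfl | rfl <;> simp
  have hs0 : (s : ℂ) ≠ 0 := left_ne_zero_of_mul_eq_one hs2
  set x : ℝ → ℂ := fun t => Real.pi * (α * (-N + t * I) + β) with hx
  have hsin : ∀ t, Complex.sin (x t) / (s * I / 2 * Complex.exp (-(s * I * x t))) - 1 =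
      -Complex.exp (2 * (s * I * x t)) := by
    intro t
    have e1 : Complex.sin (x t) = s * I / 2 * (Complex.exp (-(s * I * x t)) -
        Complex.exp (s * I * x t)) := by
      rw [Complex.sin]
      rcases hs with rfl | rfl
      · push_cast
        ring_nf
      · push_cast
        ring_nf
    have e2 : Complex.exp (s * I * x t) =
        Complex.exp (-(s * I * x t)) * Complex.exp (2 * (s * I * x t)) := by
      rw [← Complex.exp_add]
      ring_nf
    have h2 : (s * I / 2 : ℂ) ≠ 0 := by simp [hs0]
    rw [e1, mul_div_mul_left _ _ h2, sub_div, div_self (Complex.exp_ne_zero _), e2,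
      mul_div_cancel_left₀ _ (Complex.exp_ne_zero _)]
    ring
  refine IsBigO.congr_left ?_ fun t => (hsin t).symm
  have hpos : 0 < 2 * Real.pi * α := by positivity
  refine IsBigO.of_bound (Real.exp (2 * Real.pi * |β.im|) / (2 * Real.pi * α)) ?_
  filter_upwards [hl.eventually_gt_atTop 0] with t ht
  have hst : |t| = s * t := by
    rcases hs with rfl | rfl
    · rw [one_mul] at ht ⊢; exact abs_of_pos ht
    · rw [neg_one_mul] at ht ⊢; exact abs_of_neg (by linarith)
  have hsβ : -(s * β.im) ≤ |β.im| := by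
    rcases hs with rfl | rfl
    · rw [one_mul]; exact neg_le_abs _
    · simpa using le_abs_self _
  rw [norm_neg, norm_exp, norm_inv, Real.norm_eq_abs, hst]
  have hre : (2 * (s * I * x t)).re = -(2 * Real.pi * α * (s * t)) + 2 * Real.pi * (-(s * β.im)) := by
    simp [hx]
    ring
  rw [hre, Real.exp_add, mul_comm, div_mul_eq_mul_div, mul_div_assoc]
  gcongr
  rw [Real.exp_neg, ← one_div, ← one_div, div_div]
  apply one_div_le_one_div_of_le (by positivity)
  have := Real.add_one_le_exp (2 * Real.pi * α * (s * t))
  linarith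

lemma asympOne_prod_sin {l : Filter ℝ} {s : ℝ} (hs : s = 1 ∨ s = -1) (hlc : l ≤ cocompact ℝ)
    (hl : Tendsto (fun t => s * t) l atTop) {d : ℕ} {α : Fin d → ℝ} (hα : ∀ ν, 0 < α ν)
    (hsum : ∑ ν, α ν = 1 / 2) (β : Fin d → ℂ) (N : ℝ) :
    AsympOne l (fun t : ℝ => (∏ ν, Complex.sin (Real.pi * (α ν * (-N + t * I) + β ν)) / Real.pi) /
      ((∏ ν, s * I / 2 / Real.pi * Complex.exp (-(s * I * Real.pi * (-(N * α ν) + β ν)))) *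
        Complex.exp (s * (Real.pi / 2 * t)))) := by
  refine (AsympOne.finset_prod hlc Finset.univ fun ν =>
    asympOne_sin hs hl (hα ν) (β ν) N).congr' (Eventually.of_forall fun t => ?_)
  have hsumC : (∑ ν, (α ν : ℂ)) = 1 / 2 := by
    rw [← ofReal_sum, hsum]; push_cast; rfl
  have hpi : (Real.pi : ℂ) ≠ 0 := by exact_mod_cast Real.pi_ne_zero
  have e : Complex.exp (s * (Real.pi / 2 * t)) = ∏ ν, Complex.exp (s * (Real.pi * α ν * t)) := by
    rw [← Complex.exp_sum]
    congr 1
    rw [← Finset.mul_sum, ← Finset.sum_mul, ← Finset.mul_sum, hsumC]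
    ring
  simp only
  rw [e, ← Finset.prod_mul_distrib, ← Finset.prod_div_distrib]
  refine Finset.prod_congr rfl fun ν _ => ?_
  have e2 : Complex.exp (-(s * I * (Real.pi * (α ν * (-N + t * I) + β ν)))) =
      Complex.exp (-(s * I * Real.pi * (-(N * α ν) + β ν))) *
        Complex.exp (s * (Real.pi * α ν * t)) := by
    rw [← Complex.exp_add]
    congr 1
    linear_combination (-(s * Real.pi * α ν * t : ℂ)) * I_sq
  rw [e2]
  field_simp

/-- A function that is `O(|t|^y)` at infinity and continuous is bounded by a constant multiple of
`(1 + |t|)^y` throughout. -/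
lemma exists_bound_of_isBigO {f : ℝ → ℂ} (hf : Continuous f) {y : ℝ}
    (h : f =O[cocompact ℝ] (fun t : ℝ => |t| ^ y)) :
    ∃ C : ℝ, 0 < C ∧ ∀ t, ‖f t‖ ≤ C * (1 + |t|) ^ y := by
  have hg : (fun t : ℝ => |t| ^ y) =O[cocompact ℝ] (fun t : ℝ => (1 + |t|) ^ y) := by
    refine IsBigO.of_bound (2 ^ |y|) ?_
    filter_upwards [eventually_abs_ge_cocompact 1] with t ht
    have htpos : 0 < |t| := by linarith
    rw [Real.norm_of_nonneg (by positivity), Real.norm_of_nonneg (by positivity)]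
    rcases le_total 0 y with hy | hy
    · calc |t| ^ y ≤ (1 + |t|) ^ y := by
            apply Real.rpow_le_rpow htpos.le (by linarith) hy
        _ = 1 * (1 + |t|) ^ y := (one_mul _).symm
        _ ≤ 2 ^ |y| * (1 + |t|) ^ y := by
            gcongr
            exact Real.one_le_rpow (by norm_num) (abs_nonneg _)
    · have h2 : (2 * |t|) ^ y ≤ (1 + |t|) ^ y :=
        Real.rpow_le_rpow_of_nonpos (by linarith) (by linarith) hy
      calc |t| ^ y = 2 ^ |y| * (2 * |t|) ^ y := by
            rw [Real.mul_rpow (by norm_num) htpos.le, ← mul_assoc, ← Real.rpow_add (by norm_num),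
              abs_of_nonpos hy]
            simp
        _ ≤ 2 ^ |y| * (1 + |t|) ^ y := by gcongr
  obtain ⟨C₁, hC₁pos, hC₁⟩ := (h.trans hg).exists_pos
  rw [IsBigOWith] at hC₁
  obtain ⟨K, hK, hKsub⟩ := mem_cocompact.mp hC₁
  have hcont : ContinuousOn (fun t => ‖f t‖ / (1 + |t|) ^ y) K := by
    apply Continuous.continuousOn
    refine hf.norm.div ?_ fun t => by positivity
    exact (by fun_prop : Continuous fun t : ℝ => 1 + |t|).rpow_const fun t => Or.inl (by positivity)
  obtain ⟨C₂, hC₂⟩ := (hK.image_of_continuousOn hcont).bddAbove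
  refine ⟨max C₁ C₂, lt_max_of_lt_left hC₁pos, fun t => ?_⟩
  have hpos : 0 < (1 + |t|) ^ y := by positivity
  by_cases ht : t ∈ K
  · have := hC₂ ⟨t, ht, rfl⟩
    simp only at this
    rw [div_le_iff₀ hpos] at this
    exact this.trans (by gcongr; exact le_max_right _ _)
  · have := hKsub ht
    simp only [Set.mem_ofPred_eq, Real.norm_of_nonneg hpos.le] at this
    exact this.trans (by gcongr; exact le_max_left _ _)

/-- The reflection formula; at the poles of `Γ`, where `Gamma` takes the value `0`, both sides
vanish. -/
lemma Gamma_inv_eq_mul_sin {z : ℂ} (hz : 0 < (1 - z).re) :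
    (Gamma z)⁻¹ = Gamma (1 - z) * (Complex.sin (Real.pi * z) / Real.pi) := by
  have h := Gamma_mul_Gamma_one_sub z
  have h1 := Gamma_ne_zero_of_re_pos hz
  have hpi : (Real.pi : ℂ) ≠ 0 := by exact_mod_cast Real.pi_ne_zero
  by_cases hs : Complex.sin (Real.pi * z) = 0
  · rw [hs, div_zero] at h
    rw [(mul_eq_zero.mp h).resolve_right h1, hs]
    simp
  · have h0 : Gamma z ≠ 0 := by
      intro h0
      rw [h0, zero_mul] at h
      exact div_ne_zero hpi hs h.symm
    rw [eq_div_iff hs] at h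
    apply inv_eq_of_mul_eq_one_right
    rw [← mul_div_assoc, ← mul_div_assoc, ← mul_assoc, h, div_self hpi]

/-- One half (`t → s∞`) of the asymptotic expansion of the kernel. -/
lemma isBigO_sub_of_asympOne {l : Filter ℝ} {s : ℝ} (hs : s = 1 ∨ s = -1) (hlc : l ≤ cocompact ℝ)
    (hl : Tendsto (fun t => s * t) l atTop) {θ : ℂ} (hθ : 0 < θ.re) {κ c c' : ℂ} {q : ℝ}
    (hκ : κ ≠ 0) (hc : c ≠ 0) {X Y : ℝ → ℂ}
    (hX : AsympOne l fun t => X t / (κ * Complex.exp (q * (t * I)) * Gamma (-(t * I) + θ)))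
    (hY : AsympOne l fun t => Y t / (c * Complex.exp (s * (Real.pi / 2 * t)))) :
    (fun t : ℝ => X t * Y t - κ * Complex.exp (q * (t * I)) * Gamma (-(t * I) + θ) *
      (c * Complex.exp (s * (Real.pi / 2 * t)) + c' * Complex.exp (-s * (Real.pi / 2 * t))))
      =O[l] (fun t : ℝ => |t| ^ (θ.re - 3 / 2)) := by
  have hG : (fun t : ℝ => Gamma (-(t * I) + θ)) =O[l] (fun t : ℝ => |t| ^ (θ.re - 1 / 2) *
      Real.exp (-(Real.pi / 2 * |t|))) := (isBigO_Gamma_line hθ).mono hlc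
  have hst : ∀ᶠ t in l, s * t = |t| ∧ 1 ≤ |t| := by
    filter_upwards [hl.eventually_ge_atTop 1] with t ht
    have : s * t = |t| := by
      rcases hs with rfl | rfl
      · rw [one_mul] at ht ⊢; exact (abs_of_pos (by linarith)).symm
      · rw [neg_one_mul] at ht ⊢; exact (abs_of_neg (by linarith)).symm
    exact ⟨this, this ▸ ht⟩
  have hnexp : ∀ a t : ℝ, ‖Complex.exp (a * (Real.pi / 2 * t))‖ = Real.exp (Real.pi / 2 * (a * t)) := by
    intro a t
    rw [norm_exp]
    congr 1
    have : (a * (Real.pi / 2 * t) : ℂ) = ((a * (Real.pi / 2 * t) : ℝ) : ℂ) := by push_cast; rfl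
    rw [this, ofReal_re]
    ring
  have hq : (fun t : ℝ => κ * Complex.exp (q * (t * I))) =O[l] (fun _ : ℝ => (1 : ℝ)) := by
    refine IsBigO.of_bound ‖κ‖ (Eventually.of_forall fun t => ?_)
    have : (q * (t * I) : ℂ) = ((q * t : ℝ) : ℂ) * I := by push_cast; ring
    rw [norm_mul, this, norm_exp_ofReal_mul_I]
    simp
  -- towards `s∞` the factor `e^{sπt/2}` cancels the decay of `Γ`, and `e^{-sπt/2}` doubles it
  have hmain : (fun t : ℝ => κ * Complex.exp (q * (t * I)) * Gamma (-(t * I) + θ) *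
      (c * Complex.exp (s * (Real.pi / 2 * t)))) =O[l] (fun t : ℝ => |t| ^ (θ.re - 1 / 2)) := by
    have he : (fun t : ℝ => c * Complex.exp (s * (Real.pi / 2 * t))) =O[l]
        (fun t : ℝ => Real.exp (Real.pi / 2 * |t|)) := by
      refine IsBigO.of_bound ‖c‖ ?_
      filter_upwards [hst] with t ht
      rw [norm_mul, hnexp, ht.1, Real.norm_of_nonneg (Real.exp_pos _).le]
    refine ((hq.mul hG).mul he).trans (isBigO_of_le _ fun t => ?_)
    rw [one_mul, mul_assoc, ← Real.exp_add]
    simp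
  have hsmall : (fun t : ℝ => κ * Complex.exp (q * (t * I)) * Gamma (-(t * I) + θ) *
      (c' * Complex.exp (-s * (Real.pi / 2 * t)))) =O[l] (fun t : ℝ => |t| ^ (θ.re - 3 / 2)) := by
    have he : (fun t : ℝ => c' * Complex.exp (-s * (Real.pi / 2 * t))) =O[l]
        (fun _ : ℝ => (1 : ℝ)) := by
      refine IsBigO.of_bound ‖c'‖ ?_
      filter_upwards [hst] with t ht
      have h := hnexp (-s) t
      push_cast at h
      rw [norm_mul, h, neg_mul, ht.1, norm_one]
      gcongr
      rw [Real.exp_le_one_iff]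
      have := Real.pi_pos
      nlinarith [abs_nonneg t]
    refine ((hq.mul hG).mul he).trans (IsBigO.of_bound 1 ?_)
    filter_upwards [hst] with t ht
    have htpos : 0 < |t| := by linarith [ht.2]
    rw [one_mul, one_mul, mul_one, Real.norm_of_nonneg (by positivity),
      Real.norm_of_nonneg (by positivity), show θ.re - 1 / 2 = θ.re - 3 / 2 + 1 by ring,
      Real.rpow_add htpos, Real.rpow_one, mul_assoc]
    apply mul_le_of_le_one_right (by positivity)
    rw [Real.exp_neg, ← div_eq_mul_inv, div_le_one (Real.exp_pos _)]
    have h1 := Real.add_one_le_exp (Real.pi / 2 * |t|)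
    have h2 := Real.pi_gt_three
    nlinarith
  have hXY := hX.mul hlc hY
  have hdiff : (fun t : ℝ => X t * Y t - κ * Complex.exp (q * (t * I)) * Gamma (-(t * I) + θ) *
      (c * Complex.exp (s * (Real.pi / 2 * t)))) =O[l] (fun t : ℝ => |t| ^ (θ.re - 3 / 2)) := by
    refine ((hmain.mul hXY).congr_left fun t => ?_).trans (IsBigO.of_bound 1 ?_)
    · have hΓ : Gamma (-(t * I) + θ) ≠ 0 := Gamma_ne_zero_of_re_pos (by simpa using hθ)
      have := Complex.exp_ne_zero (q * (t * I))
      have := Complex.exp_ne_zero (s * (Real.pi / 2 * t))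
      field_simp
    · filter_upwards [hst] with t ht
      have htpos : 0 < |t| := by linarith [ht.2]
      rw [norm_mul, norm_inv, Real.norm_of_nonneg (by positivity), Real.norm_eq_abs, one_mul,
        Real.norm_of_nonneg (by positivity), show θ.re - 1 / 2 = θ.re - 3 / 2 + 1 by ring,
        Real.rpow_add htpos, Real.rpow_one, mul_inv_cancel_right₀ htpos.ne']
  refine (hdiff.sub hsmall).congr_left fun t => ?_
  ring

/-- The `Γ`-kernel `P(z) Δ'(k - z) / Δ(z)` on a line `Re z = -N` far to the left: up to an error
smaller by a factor `1/|t|`, it is a combination of the two kernels `Γ(θ - it) e^{±πt/2}`, which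
are themselves Mellin transforms of oscillating exponentials. -/
theorem exists_kernel_asymptotics {d : ℕ} {α : Fin d → ℝ} (hα : ∀ ν, 0 < α ν)
    (hsum : ∑ ν, α ν = 1 / 2) {P : Polynomial ℂ} (hP : P ≠ 0) {k N : ℝ} {β β' : Fin d → ℂ}
    (hβ' : ∀ ν, 0 < (α ν * (k + N) + β' ν).re) (hβ : ∀ ν, 0 < (1 - β ν + α ν * N).re) {θ : ℂ}
    (hθ : 0 < θ.re) (hθd : θ - 1 / 2 = ∑ ν, (β' ν - β ν) + (k / 2 + N) + P.natDegree) :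
    Continuous (fun t : ℝ => P.eval (-N + t * I) *
        (∏ ν, Gamma (α ν * (k - (-N + t * I)) + β' ν)) *
          (∏ ν, Gamma (α ν * (-N + t * I) + β ν))⁻¹) ∧
    ∃ (q : ℝ) (e₁ e₂ : ℂ) (C : ℝ), e₁ ≠ 0 ∧ 0 < C ∧ ∀ t : ℝ,
      ‖P.eval (-N + t * I) * (∏ ν, Gamma (α ν * (k - (-N + t * I)) + β' ν)) *
          (∏ ν, Gamma (α ν * (-N + t * I) + β ν))⁻¹ -
        Complex.exp (q * (t * I)) * Gamma (-(t * I) + θ) *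
          (e₁ * Complex.exp (Real.pi / 2 * t) + e₂ * Complex.exp (-(Real.pi / 2 * t)))‖ ≤
        C * (1 + |t|) ^ (θ.re - 3 / 2) := by
  have hsumC : (∑ ν, (α ν : ℂ)) = 1 / 2 := by
    rw [← ofReal_sum, hsum]; push_cast; rfl
  have hδsum : ∑ ν, (α ν * (k + N) + β' ν + (1 - β ν + α ν * N) - 1) =
      ∑ ν, (β' ν - β ν) + (k / 2 + N) := by
    have : ∀ ν, (α ν * (k + N) + β' ν + (1 - β ν + α ν * N) - 1 : ℂ) =
        (β' ν - β ν) + α ν * (k + 2 * N) := fun ν => by ring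
    simp only [this, Finset.sum_add_distrib, ← Finset.sum_mul, hsumC]
    ring
  -- the reflection formula splits the kernel into `Γ`-factors `X` and sines `Y`
  obtain ⟨κ, q, hκ, hX⟩ := asympOne_Gamma_quotient hα hsum hP N hβ' hβ hθ (by rw [hδsum]; exact hθd)
  set c : ℝ → ℂ := fun s =>
    ∏ ν, s * I / 2 / Real.pi * Complex.exp (-(s * I * Real.pi * (-(N * α ν) + β ν))) with hc
  have hpi : (Real.pi : ℂ) ≠ 0 := by exact_mod_cast Real.pi_ne_zero
  have hc0 : ∀ s : ℝ, s ≠ 0 → c s ≠ 0 := by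
    intro s hs
    have : (s : ℂ) ≠ 0 := by exact_mod_cast hs
    exact Finset.prod_ne_zero_iff.mpr fun ν _ => mul_ne_zero (by simp [this, Real.pi_ne_zero])
      (Complex.exp_ne_zero _)
  set X : ℝ → ℂ := fun t => P.eval (-N + t * I) *
    (∏ ν, Gamma (α ν * (-(t * I)) + (α ν * (k + N) + β' ν)) *
      Gamma (α ν * (-(t * I)) + (1 - β ν + α ν * N))) with hXdef
  set Y : ℝ → ℂ := fun t => ∏ ν, Complex.sin (Real.pi * (α ν * (-N + t * I) + β ν)) / Real.pi
    with hYdef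
  have hXY : ∀ t : ℝ, P.eval (-N + t * I) * (∏ ν, Gamma (α ν * (k - (-N + t * I)) + β' ν)) *
          (∏ ν, Gamma (α ν * (-N + t * I) + β ν))⁻¹ = X t * Y t := by
    intro t
    rw [hXdef, hYdef]
    simp only
    rw [← Finset.prod_inv_distrib, mul_assoc, mul_assoc, ← Finset.prod_mul_distrib,
      ← Finset.prod_mul_distrib]
    congr 1
    refine Finset.prod_congr rfl fun ν _ => ?_
    have hre : 0 < (1 - (α ν * (-N + t * I) + β ν)).re := by
      have := hβ ν
      simp at this ⊢
      linarith
    rw [Gamma_inv_eq_mul_sin hre, mul_assoc]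
    congr 2
    · ring
    · congr 1; ring
  have hloc : cocompact ℝ = atBot ⊔ atTop := cocompact_eq_atBot_atTop
  have htop : (atTop : Filter ℝ) ≤ cocompact ℝ := hloc ▸ le_sup_right
  have hbot : (atBot : Filter ℝ) ≤ cocompact ℝ := hloc ▸ le_sup_left
  have htop' : Tendsto (fun t : ℝ => (1 : ℝ) * t) atTop atTop :=
    (tendsto_id (x := atTop)).congr fun t => (one_mul t).symm
  have hbot' : Tendsto (fun t : ℝ => (-1 : ℝ) * t) atBot atTop := by
    simpa using tendsto_neg_atBot_atTop
  -- each of the two exponentials is visible at one end only, and negligible at the other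
  have h1 := isBigO_sub_of_asympOne (Or.inl rfl) htop htop' hθ hκ (hc0 1 one_ne_zero)
    (c' := c (-1)) (hX.mono htop) (asympOne_prod_sin (Or.inl rfl) htop htop' hα hsum β N)
  have h2 := isBigO_sub_of_asympOne (Or.inr rfl) hbot hbot' hθ hκ (hc0 (-1) (by norm_num))
    (c' := c 1) (hX.mono hbot) (asympOne_prod_sin (Or.inr rfl) hbot hbot' hα hsum β N)
  set E : ℝ → ℂ := fun t => X t * Y t - Complex.exp (q * (t * I)) * Gamma (-(t * I) + θ) *
          (κ * c 1 * Complex.exp (Real.pi / 2 * t) + κ * c (-1) * Complex.exp (-(Real.pi / 2 * t)))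
    with hE
  have hEO : E =O[cocompact ℝ] (fun t : ℝ => |t| ^ (θ.re - 3 / 2)) := by
    rw [hloc]
    refine IsBigO.sup ?_ ?_
    · refine h2.congr_left fun t => ?_
      rw [hE]
      push_cast
      simp only [neg_neg, one_mul, neg_one_mul]
      ring
    · refine h1.congr_left fun t => ?_
      rw [hE]
      push_cast
      simp only [one_mul, neg_one_mul]
      ring
  have hcontG : ∀ (a : ℝ) (δ : ℂ), 0 < δ.re → Continuous fun t : ℝ => Gamma (a * (-(t * I)) + δ) := by
    intro a δ hδ
    rw [continuous_iff_continuousAt]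
    intro t
    have h : ContinuousAt Gamma (a * (-(t * I)) + δ) := by
      refine (differentiableAt_Gamma _ fun m h => ?_).continuousAt
      have hre := congrArg re h
      simp at hre
      have : (0 : ℝ) ≤ m := m.cast_nonneg
      linarith
    exact ContinuousAt.comp (f := fun t : ℝ => (a * (-(t * I)) + δ : ℂ)) h (by fun_prop)
  have hg := hcontG 1 θ hθ
  simp only [ofReal_one, one_mul] at hg
  have hXc : Continuous X := by
    refine Continuous.mul (P.continuous.comp (by fun_prop)) ?_
    exact continuous_finsetProd _ fun ν _ => (hcontG _ _ (hβ' ν)).mul (hcontG _ _ (hβ ν))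
  have hYc : Continuous Y := by
    refine continuous_finsetProd _ fun ν _ => ?_
    fun_prop
  have hcont : Continuous E := by
    rw [hE]
    fun_prop
  obtain ⟨C, hCpos, hC⟩ := exists_bound_of_isBigO hcont hEO
  refine ⟨(hXc.mul hYc).congr fun t => (hXY t).symm, q, κ * c 1, κ * c (-1), C,
    mul_ne_zero hκ (hc0 1 one_ne_zero), hCpos, fun t => ?_⟩
  rw [hXY]
  exact hC t

/-! ### Contour shifts and a polynomial Phragmén–Lindelöf principle -/

lemma integrable_of_norm_le_inv_one_add_sq {f : ℝ → ℂ} (hf : Continuous f) {C : ℝ}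
    (h : ∀ y, ‖f y‖ ≤ C * (1 + y ^ 2)⁻¹) : Integrable f :=
  (integrable_inv_one_add_sq.const_mul C).mono' hf.aestronglyMeasurable (Eventually.of_forall h)

/-- The integral of a rapidly decaying entire function does not depend on the vertical line. -/
lemma integral_vertical_line_eq {f : ℂ → ℂ} (hf : Differentiable ℂ f) {a b C : ℝ} (hab : a ≤ b)
    (hC : ∀ x y : ℝ, a ≤ x → x ≤ b → ‖f (x + y * I)‖ ≤ C * (1 + y ^ 2)⁻¹) :
    ∫ y : ℝ, f (a + y * I) = ∫ y : ℝ, f (b + y * I) := by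
  have hcont : ∀ x : ℝ, Continuous fun y : ℝ => f (x + y * I) := fun x =>
    hf.continuous.comp (by fun_prop)
  have hint : ∀ x : ℝ, a ≤ x → x ≤ b → Integrable fun y : ℝ => f (x + y * I) := fun x h1 h2 =>
    integrable_of_norm_le_inv_one_add_sq (hcont x) fun y => hC x y h1 h2
  have hlim : ∀ x : ℝ, a ≤ x → x ≤ b → Tendsto (fun T : ℝ => ∫ y in (-T)..T, f (x + y * I)) atTop
      (𝓝 (∫ y : ℝ, f (x + y * I))) := fun x h1 h2 =>
    intervalIntegral_tendsto_integral (hint x h1 h2) tendsto_neg_atTop_atBot tendsto_id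
  have hrect : ∀ T : ℝ, (∫ x in a..b, f (x + (-T : ℝ) * I)) - (∫ x in a..b, f (x + (T : ℝ) * I)) +
      I * (∫ y in (-T)..T, f (b + y * I)) - I * ∫ y in (-T)..T, f (a + y * I) = 0 := by
    intro T
    have h := integral_boundary_rect_eq_zero_of_differentiableOn f (a + (-T : ℝ) * I)
      (b + (T : ℝ) * I) hf.differentiableOn
    simpa using h
  have hsq : Tendsto (fun T : ℝ => C * (1 + T ^ 2)⁻¹ * |b - a|) atTop (𝓝 0) := by
    have h1 : Tendsto (fun T : ℝ => 1 + T ^ 2) atTop atTop :=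
      tendsto_atTop_add_const_left _ _ (tendsto_pow_atTop two_ne_zero)
    simpa using ((tendsto_inv_atTop_zero.comp h1).const_mul C).mul_const |b - a|
  have hhor : ∀ ε : ℝ, ε ^ 2 = 1 → Tendsto (fun T : ℝ => ∫ x in a..b, f (x + (ε * T : ℝ) * I))
      atTop (𝓝 0) := by
    intro ε hε
    refine squeeze_zero_norm (fun T => ?_) hsq
    refine intervalIntegral.norm_integral_le_of_norm_le_const fun x hx => ?_
    rw [Set.uIoc_of_le hab] at hx
    have h := hC x (ε * T) hx.1.le hx.2
    rwa [mul_pow, hε, one_mul] at h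
  have h1 := hhor (-1) (by norm_num)
  have h2 := hhor 1 (by norm_num)
  simp only [neg_mul, one_mul] at h1 h2
  have htot := ((h1.sub h2).add ((hlim b hab le_rfl).const_mul I)).sub
    ((hlim a le_rfl hab).const_mul I)
  have hzero := tendsto_nhds_unique htot ((tendsto_congr hrect).mpr tendsto_const_nhds)
  rw [sub_zero, zero_add, ← mul_sub] at hzero
  have := (mul_eq_zero.mp hzero).resolve_left I_ne_zero
  exact (sub_eq_zero.mp this).symm

/-- An entire function of at most exponential-of-power growth in a vertical strip that is
polynomially bounded on the two edges is polynomially bounded in the strip. -/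
lemma norm_le_pow_of_vertical_strip {f : ℂ → ℂ} (hf : Differentiable ℂ f) {a b : ℝ} (hab : a < b)
    {B ρ T : ℝ} (hgrow : ∀ z : ℂ, a ≤ z.re → z.re ≤ b → T ≤ |z.im| →
      ‖f z‖ ≤ Real.exp (B * (1 + |z.im|) ^ ρ)) {C : ℝ} {M : ℕ}
    (ha : ∀ z : ℂ, z.re = a → ‖f z‖ ≤ C * (1 + |z.im|) ^ M)
    (hb : ∀ z : ℂ, z.re = b → ‖f z‖ ≤ C * (1 + |z.im|) ^ M) :
    ∃ C' : ℝ, ∀ z : ℂ, a ≤ z.re → z.re ≤ b → ‖f z‖ ≤ C' * (1 + |z.im|) ^ M := by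
  have hC0 : 0 ≤ C := by
    have := (norm_nonneg _).trans (ha a (by simp))
    simpa using this
  have hlow : ∀ z : ℂ, z.re ≤ b → 1 ≤ ‖z - (b + 1 : ℝ)‖ ∧ 1 + |z.im| ≤ 2 * ‖z - (b + 1 : ℝ)‖ := by
    intro z hz
    have h1 := abs_re_le_norm (z - (b + 1 : ℝ))
    have h2 := abs_im_le_norm (z - (b + 1 : ℝ))
    simp only [sub_re, ofReal_re, sub_im, ofReal_im, sub_zero] at h1 h2
    have h3 : 1 ≤ |z.re - (b + 1)| := by
      rw [abs_of_neg (by linarith)]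
      linarith
    exact ⟨h3.trans h1, by linarith⟩
  -- dividing by a power of `z - (b + 1)`, which has no zero in the strip, makes the edges bounded
  set g : ℂ → ℂ := fun z => f z / (z - (b + 1 : ℝ)) ^ M with hg
  have hedge : ∀ z : ℂ, z.re ≤ b → ‖f z‖ ≤ C * (1 + |z.im|) ^ M → ‖g z‖ ≤ C * 2 ^ M := by
    intro z hz h
    obtain ⟨h1, h2⟩ := hlow z hz
    rw [hg]
    simp only [norm_div, norm_pow]
    rw [div_le_iff₀ (by positivity), mul_assoc, ← mul_pow]
    exact h.trans (by gcongr)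
  have hgf : ∀ z : ℂ, z.re ≤ b → ‖g z‖ ≤ ‖f z‖ := by
    intro z hz
    rw [hg]
    simp only [norm_div, norm_pow]
    exact div_le_self (norm_nonneg _) (one_le_pow₀ (hlow z hz).1)
  have hdiff : DiffContOnCl ℂ g (re ⁻¹' Set.Ioo a b) := by
    apply DifferentiableOn.diffContOnCl
    have hcl : closure (re ⁻¹' Set.Ioo a b) ⊆ re ⁻¹' Set.Icc a b :=
      closure_minimal (Set.preimage_mono Set.Ioo_subset_Icc_self) (isClosed_Icc.preimage continuous_re)
    refine DifferentiableOn.mono (fun z hz => ?_) hcl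
    refine DifferentiableAt.differentiableWithinAt ?_
    refine hf.differentiableAt.div (by fun_prop) (pow_ne_zero _ fun h0 => ?_)
    have := (hlow z hz.2).1
    rw [h0, norm_zero] at this
    linarith
  have hPL : ∃ c < Real.pi / (b - a), ∃ B', g =O[comap (_root_.abs ∘ im) atTop ⊓
      𝓟 (re ⁻¹' Set.Ioo a b)] fun z => Real.exp (B' * Real.exp (c * |z.im|)) := by
    have hba : 0 < b - a := by linarith
    have hpos : 0 < Real.pi / (b - a) := div_pos Real.pi_pos hba
    set c := Real.pi / (b - a) / 2 with hc
    have hcpos : 0 < c := by positivity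
    refine ⟨c, by linarith, |B| * Real.exp c, IsBigO.of_bound 1 ?_⟩
    have hev : ∀ᶠ y : ℝ in atTop, (1 + y) ^ ρ ≤ Real.exp (c * (1 + y)) := by
      have h := (isLittleO_rpow_exp_pos_mul_atTop ρ hcpos).bound one_pos
      have h' := (tendsto_atTop_add_const_left atTop (1 : ℝ) tendsto_id).eventually h
      filter_upwards [h', eventually_ge_atTop 0] with y hy hy0
      rw [id, Real.norm_of_nonneg (Real.exp_pos _).le, one_mul] at hy
      exact (le_abs_self _).trans hy
    have hev2 : ∀ᶠ z : ℂ in comap (_root_.abs ∘ im) atTop,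
        (1 + |z.im|) ^ ρ ≤ Real.exp (c * (1 + |z.im|)) ∧ T ≤ |z.im| :=
      (tendsto_comap (f := _root_.abs ∘ im)).eventually (hev.and (eventually_ge_atTop T))
    filter_upwards [hev2.filter_mono inf_le_left,
      (mem_principal_self (re ⁻¹' Set.Ioo a b)) |> mem_inf_of_right] with z hz hzs
    rw [one_mul, Real.norm_of_nonneg (Real.exp_pos _).le]
    refine (hgf z hzs.2.le).trans ((hgrow z hzs.1.le hzs.2.le hz.2).trans ?_)
    rw [Real.exp_le_exp, mul_assoc, ← Real.exp_add]
    calc B * (1 + |z.im|) ^ ρ ≤ |B| * (1 + |z.im|) ^ ρ := by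
          gcongr
          exact le_abs_self _
      _ ≤ |B| * Real.exp (c * (1 + |z.im|)) := by
          gcongr
          exact hz.1
      _ = |B| * Real.exp (c + c * |z.im|) := by ring_nf
  refine ⟨C * 2 ^ M * (b - a + 1) ^ M, fun z hza hzb => ?_⟩
  have hbound : ‖g z‖ ≤ C * 2 ^ M := PhragmenLindelof.vertical_strip hdiff hPL
    (fun z hz => hedge z (by linarith) (ha z hz)) (fun z hz => hedge z hz.le (hb z hz)) hza hzb
  have hne : 0 < ‖z - (b + 1 : ℝ)‖ := by linarith [(hlow z hzb).1]
  rw [hg] at hbound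
  simp only [norm_div, norm_pow] at hbound
  rw [div_le_iff₀ (by positivity)] at hbound
  refine hbound.trans ?_
  rw [mul_assoc _ ((b - a + 1) ^ M), ← mul_pow]
  gcongr
  refine (norm_le_abs_re_add_abs_im _).trans ?_
  simp only [sub_re, ofReal_re, sub_im, ofReal_im, sub_zero]
  rw [abs_of_neg (by linarith)]
  nlinarith [abs_nonneg z.im]

section

open scoped ContDiff

/-! ### Mellin transforms of compactly supported smooth functions -/

/-- Smooth functions on `ℝ` that vanish outside `[a, b]`. -/
structure IsTest (v : ℝ → ℂ) (a b : ℝ) : Prop where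
  smooth : ContDiff ℝ ∞ v
  supp : ∀ u, u ∉ Set.Icc a b → v u = 0

namespace IsTest

variable {v : ℝ → ℂ} {a b : ℝ}

lemma continuous (hv : IsTest v a b) : Continuous v := hv.smooth.continuous

lemma deriv (hv : IsTest v a b) : IsTest (deriv v) a b where
  smooth := (contDiff_infty_iff_deriv.mp hv.smooth).2
  supp u hu := by
    have h : v =ᶠ[𝓝 u] fun _ => 0 := by
      filter_upwards [isClosed_Icc.isOpen_compl.mem_nhds hu] with x hx
      exact hv.supp x hx
    rw [h.deriv_eq]
    simp

lemma iterate_deriv (hv : IsTest v a b) (J : ℕ) : IsTest (_root_.deriv^[J] v) a b := by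
  induction J with
  | zero => exact hv
  | succ J ih =>
    rw [Function.iterate_succ_apply']
    exact ih.deriv

lemma add {w : ℝ → ℂ} (hv : IsTest v a b) (hw : IsTest w a b) : IsTest (fun u => v u + w u) a b where
  smooth := hv.smooth.add hw.smooth
  supp u hu := by rw [hv.supp u hu, hw.supp u hu, add_zero]

lemma const_mul (hv : IsTest v a b) (c : ℂ) : IsTest (fun u => c * v u) a b where
  smooth := contDiff_const.mul hv.smooth
  supp u hu := by rw [hv.supp u hu, mul_zero]

lemma id_mul (hv : IsTest v a b) : IsTest (fun u => (u : ℂ) * v u) a b where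
  smooth := (ofRealCLM.contDiff).mul hv.smooth
  supp u hu := by rw [hv.supp u hu, mul_zero]

lemma exists_bound (hv : IsTest v a b) : ∃ C : ℝ, 0 ≤ C ∧ ∀ u, ‖v u‖ ≤ C := by
  obtain ⟨C, hC⟩ := (isCompact_Icc.image (s := Set.Icc a b) hv.continuous.norm).bddAbove
  refine ⟨max C 0, le_max_right _ _, fun u => ?_⟩
  by_cases hu : u ∈ Set.Icc a b
  · exact (hC ⟨u, hu, rfl⟩).trans (le_max_left _ _)
  · rw [hv.supp u hu, norm_zero]
    exact le_max_right _ _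

lemma eventually_top (hv : IsTest v a b) : ∀ᶠ u in atTop, v u = 0 := by
  filter_upwards [eventually_gt_atTop b] with u hu
  exact hv.supp u fun h => by linarith [h.2]

lemma eventually_zero (hv : IsTest v a b) (ha : 0 < a) : ∀ᶠ u in 𝓝[>] (0 : ℝ), v u = 0 := by
  have : ∀ᶠ u in 𝓝 (0 : ℝ), u < a := eventually_lt_nhds ha
  filter_upwards [this.filter_mono nhdsWithin_le_nhds] with u hu
  exact hv.supp u fun h => by linarith [h.1]

lemma isBigO_top (hv : IsTest v a b) (y : ℝ) : v =O[atTop] (fun u : ℝ => u ^ y) := by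
  refine IsBigO.of_bound 0 ?_
  filter_upwards [hv.eventually_top] with u hu
  simp [hu]

lemma isBigO_zero (hv : IsTest v a b) (ha : 0 < a) (y : ℝ) :
    v =O[𝓝[>] 0] (fun u : ℝ => u ^ y) := by
  refine IsBigO.of_bound 0 ?_
  filter_upwards [hv.eventually_zero ha] with u hu
  simp [hu]

lemma mellinConvergent (hv : IsTest v a b) (ha : 0 < a) (z : ℂ) : MellinConvergent v z :=
  mellinConvergent_of_isBigO_rpow (a := z.re + 1) (b := z.re - 1)
    (hv.continuous.locallyIntegrable.locallyIntegrableOn _) (hv.isBigO_top _) (by linarith)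
    (hv.isBigO_zero ha _) (by linarith)

lemma differentiable_mellin (hv : IsTest v a b) (ha : 0 < a) : Differentiable ℂ (mellin v) :=
  fun z => mellin_differentiableAt_of_isBigO_rpow (a := z.re + 1) (b := z.re - 1)
    (hv.continuous.locallyIntegrable.locallyIntegrableOn _) (hv.isBigO_top _) (by linarith)
    (hv.isBigO_zero ha _) (by linarith)

lemma continuous_cpow_mul (hv : IsTest v a b) (ha : 0 < a) (z : ℂ) :
    Continuous fun u : ℝ => (u : ℂ) ^ z * v u := by
  rw [continuous_iff_continuousAt]
  intro u
  rcases lt_or_ge u a with hu | hu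
  · have : (fun u : ℝ => (u : ℂ) ^ z * v u) =ᶠ[𝓝 u] fun _ => 0 := by
      filter_upwards [eventually_lt_nhds hu] with x hx
      rw [hv.supp x fun h => by linarith [h.1], mul_zero]
    exact this.continuousAt
  · exact (continuousAt_ofReal_cpow_const u z (Or.inr (by linarith))).mul hv.continuous.continuousAt

lemma hasCompactSupport_mul (hv : IsTest v a b) (f : ℝ → ℂ) :
    HasCompactSupport fun u : ℝ => f u * v u := by
  refine HasCompactSupport.intro (isCompact_Icc (a := a) (b := b)) fun u hu => ?_
  rw [hv.supp u hu, mul_zero]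

lemma mellin_eq (hv : IsTest v a b) (ha : 0 < a) (z : ℂ) :
    mellin v z = ∫ u : ℝ, (u : ℂ) ^ (z - 1) * v u := by
  rw [mellin]
  refine setIntegral_eq_integral_of_forall_compl_eq_zero fun u hu => ?_
  rw [hv.supp u fun h => hu (ha.trans_le h.1), smul_zero]

lemma integrable_cpow_mul (hv : IsTest v a b) (ha : 0 < a) (z : ℂ) :
    Integrable fun u : ℝ => (u : ℂ) ^ z * v u :=
  (hv.continuous_cpow_mul ha z).integrable_of_hasCompactSupport (hv.hasCompactSupport_mul _)

lemma mellin_deriv (hv : IsTest v a b) (ha : 0 < a) (z : ℂ) :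
    mellin (_root_.deriv v) (z + 1) = -z * mellin v z := by
  rw [hv.mellin_eq ha, hv.deriv.mellin_eq ha, add_sub_cancel_right]
  have hder : ∀ u : ℝ, HasDerivAt (fun u : ℝ => (u : ℂ) ^ z * v u)
      ((u : ℂ) ^ z * _root_.deriv v u + z * ((u : ℂ) ^ (z - 1) * v u)) u := by
    intro u
    rcases lt_or_ge u a with hu | hu
    · have h0 : (fun u : ℝ => (u : ℂ) ^ z * v u) =ᶠ[𝓝 u] fun _ => 0 := by
        filter_upwards [eventually_lt_nhds hu] with x hx
        rw [hv.supp x fun h => by linarith [h.1], mul_zero]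
      rw [hv.supp u fun h => by linarith [h.1], hv.deriv.supp u fun h => by linarith [h.1]]
      simpa using (hasDerivAt_const u (0 : ℂ)).congr_of_eventuallyEq h0
    · have hupos : 0 < u := by linarith
      have h1 : HasDerivAt (fun u : ℝ => (u : ℂ) ^ z) (z * (u : ℂ) ^ (z - 1)) u := by
        have h := (hasDerivAt_id (u : ℂ)).cpow_const (c := z) (Or.inl (by simpa using hupos))
        simpa using h.comp_ofReal
      have h2 : HasDerivAt v (_root_.deriv v u) u :=
        ((hv.smooth.differentiable (by simp)) u).hasDerivAt
      convert! h1.mul h2 using 1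
      ring
  have hi1 := hv.deriv.integrable_cpow_mul ha z
  have hi2 := (hv.integrable_cpow_mul ha (z - 1)).const_mul z
  have h := integral_eq_zero_of_hasDerivAt_of_integrable hder (hi1.add hi2)
    (hv.integrable_cpow_mul ha z)
  rw [integral_add hi1 hi2, integral_const_mul] at h
  linear_combination h

lemma mellin_id_mul (v : ℝ → ℂ) (z : ℂ) :
    mellin (fun u => (u : ℂ) * v u) z = mellin v (z + 1) := by
  have h := mellin_cpow_smul v z 1
  simpa using h

/-- Multiplying the Mellin transform by a polynomial corresponds to applying a differential
operator in `u d/du` to the function, which does not enlarge the support. -/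
lemma exists_mellin_polynomial (hv : IsTest v a b) (ha : 0 < a) (P : Polynomial ℂ) :
    ∃ w, IsTest w a b ∧ ∀ z, mellin w z = P.eval z * mellin v z := by
  induction P using Polynomial.induction_on with
  | C c =>
    refine ⟨_, hv.const_mul c, fun z => ?_⟩
    rw [Polynomial.eval_C]
    exact mellin_const_smul v z c
  | add p q hp hq =>
    obtain ⟨w₁, h₁, e₁⟩ := hp
    obtain ⟨w₂, h₂, e₂⟩ := hq
    refine ⟨_, h₁.add h₂, fun z => ?_⟩
    rw [(hasMellin_add (h₁.mellinConvergent ha z) (h₂.mellinConvergent ha z)).2, e₁, e₂,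
      Polynomial.eval_add, add_mul]
  | monomial n c hp =>
    obtain ⟨w, hw, e⟩ := hp
    refine ⟨_, hw.deriv.id_mul.const_mul (-1), fun z => ?_⟩
    have h1 : mellin (fun u => (-1 : ℂ) * ((u : ℂ) * _root_.deriv w u)) z =
        -1 * mellin (fun u => (u : ℂ) * _root_.deriv w u) z := mellin_const_smul _ z (-1 : ℂ)
    rw [h1, mellin_id_mul, hw.mellin_deriv ha, e]
    simp only [Polynomial.eval_mul, Polynomial.eval_C, Polynomial.eval_pow, Polynomial.eval_X]
    ring

lemma norm_mellin_le (hv : IsTest v a b) (ha : 0 < a) {x₁ x₂ : ℝ} :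
    ∃ C : ℝ, 0 ≤ C ∧ ∀ z : ℂ, x₁ ≤ z.re → z.re ≤ x₂ → ‖mellin v z‖ ≤ C := by
  have hi : ∀ x : ℝ, Integrable fun u : ℝ => ‖(u : ℂ) ^ ((x : ℂ) - 1) * v u‖ := fun x =>
    (hv.integrable_cpow_mul ha _).norm
  refine ⟨∫ u : ℝ, (‖(u : ℂ) ^ ((x₁ : ℂ) - 1) * v u‖ + ‖(u : ℂ) ^ ((x₂ : ℂ) - 1) * v u‖),
    integral_nonneg fun u => by positivity, fun z h1 h2 => ?_⟩
  rw [hv.mellin_eq ha]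
  refine norm_integral_le_of_norm_le ((hi x₁).add (hi x₂)) (Eventually.of_forall fun u => ?_)
  by_cases hu : u ∈ Set.Icc a b
  · have hupos : 0 < u := ha.trans_le hu.1
    simp only [norm_mul, norm_cpow_eq_rpow_re_of_pos hupos, sub_re, one_re, ofReal_re]
    rw [← add_mul]
    gcongr
    rcases le_total 1 u with h | h
    · have := Real.rpow_le_rpow_of_exponent_le h (show z.re - 1 ≤ x₂ - 1 by linarith)
      linarith [Real.rpow_nonneg hupos.le (x₁ - 1)]
    · have := Real.rpow_le_rpow_of_exponent_ge hupos h (show x₁ - 1 ≤ z.re - 1 by linarith)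
      linarith [Real.rpow_nonneg hupos.le (x₂ - 1)]
  · simp [hv.supp u hu]

/-- Rapid decay of the Mellin transform in vertical strips. -/
lemma norm_mellin_mul_pow_le (hv : IsTest v a b) (ha : 0 < a) (x₁ x₂ : ℝ) (J : ℕ) :
    ∃ C : ℝ, 0 ≤ C ∧ ∀ z : ℂ, x₁ ≤ z.re → z.re ≤ x₂ → ‖mellin v z‖ * (1 + |z.im|) ^ J ≤ C := by
  obtain ⟨w, hw, e⟩ := hv.exists_mellin_polynomial ha
    ((Polynomial.X - Polynomial.C ((x₁ - 1 : ℝ) : ℂ)) ^ J)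
  obtain ⟨C, hC0, hC⟩ := hw.norm_mellin_le ha (x₁ := x₁) (x₂ := x₂)
  refine ⟨2 ^ J * C, by positivity, fun z h1 h2 => ?_⟩
  have h := hC z h1 h2
  rw [e] at h
  simp only [Polynomial.eval_pow, Polynomial.eval_sub, Polynomial.eval_X, Polynomial.eval_C,
    norm_mul, norm_pow] at h
  have hre := abs_re_le_norm (z - ((x₁ - 1 : ℝ) : ℂ))
  have him := abs_im_le_norm (z - ((x₁ - 1 : ℝ) : ℂ))
  simp only [sub_re, ofReal_re, sub_im, ofReal_im, sub_zero] at hre him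
  have h3 : 1 ≤ |z.re - (x₁ - 1)| := by
    rw [abs_of_pos (by linarith)]
    linarith
  have h4 : 1 + |z.im| ≤ 2 * ‖z - ((x₁ - 1 : ℝ) : ℂ)‖ := by linarith
  calc ‖mellin v z‖ * (1 + |z.im|) ^ J
      ≤ ‖mellin v z‖ * (2 * ‖z - ((x₁ - 1 : ℝ) : ℂ)‖) ^ J := by gcongr
    _ = 2 ^ J * (‖z - ((x₁ - 1 : ℝ) : ℂ)‖ ^ J * ‖mellin v z‖) := by rw [mul_pow]; ring
    _ ≤ 2 ^ J * C := by gcongr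

lemma continuous_mellin_line (hv : IsTest v a b) (ha : 0 < a) (σ : ℝ) :
    Continuous fun t : ℝ => mellin v (σ + t * I) :=
  (hv.differentiable_mellin ha).continuous.comp (by fun_prop)

/-- The Mellin transform times a function of polynomial growth is integrable on vertical lines. -/
lemma integrable_mellin_line (hv : IsTest v a b) (ha : 0 < a) (σ : ℝ) {f : ℝ → ℂ}
    (hf : AEStronglyMeasurable f) {C y : ℝ} (hC : ∀ t, ‖f t‖ ≤ C * (1 + |t|) ^ y) :
    Integrable fun t : ℝ => mellin v (σ + t * I) * f t := by
  have hC0 : 0 ≤ C := by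
    have := (norm_nonneg _).trans (hC 0)
    simpa using this
  obtain ⟨D, hD0, hD⟩ := hv.norm_mellin_mul_pow_le ha σ σ (⌈y⌉₊ + 2)
  refine (integrable_inv_one_add_sq.const_mul (D * C)).mono'
    ((hv.continuous_mellin_line ha σ).aestronglyMeasurable.mul hf) (Eventually.of_forall fun t => ?_)
  have h := hD (σ + t * I) (by simp) (by simp)
  simp only [add_im, ofReal_im, mul_im, ofReal_re, I_im, mul_one, I_re, mul_zero, zero_add,
    add_zero] at h
  have hbase : 1 ≤ 1 + |t| := by linarith [abs_nonneg t]
  have h1 : (1 + |t|) ^ y ≤ (1 + |t|) ^ ⌈y⌉₊ := by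
    rw [← Real.rpow_natCast]
    exact Real.rpow_le_rpow_of_exponent_le hbase (Nat.le_ceil y)
  have h2 : 1 + t ^ 2 ≤ (1 + |t|) ^ 2 := by
    nlinarith [abs_nonneg t, sq_abs t]
  rw [norm_mul, ← div_eq_mul_inv, le_div_iff₀ (by positivity)]
  calc ‖mellin v (σ + t * I)‖ * ‖f t‖ * (1 + t ^ 2)
      ≤ ‖mellin v (σ + t * I)‖ * (C * (1 + |t|) ^ ⌈y⌉₊) * (1 + |t|) ^ 2 := by
        gcongr
        exact (hC t).trans (by gcongr)
    _ = ‖mellin v (σ + t * I)‖ * (1 + |t|) ^ (⌈y⌉₊ + 2) * C := by ring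
    _ ≤ D * C := by gcongr

/-- Mellin inversion. -/
lemma integral_cpow_mul_mellin (hv : IsTest v a b) (ha : 0 < a) (σ : ℝ) {x : ℝ} (hx : 0 < x) :
    ∫ t : ℝ, (x : ℂ) ^ (-(σ + t * I)) * mellin v (σ + t * I) = 2 * Real.pi * v x := by
  have hint : VerticalIntegrable (mellin v) σ := by
    have h := hv.integrable_mellin_line ha σ (f := fun _ => 1) aestronglyMeasurable_const
      (C := 1) (y := 0) (by simp)
    simpa [VerticalIntegrable] using h
  have h := mellinInv_mellin_eq σ v hx (hv.mellinConvergent ha σ) hint hv.continuous.continuousAt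
  rw [mellinInv] at h
  rw [← h]
  simp only [smul_eq_mul, real_smul]
  rw [← mul_assoc]
  have : (Real.pi : ℂ) ≠ 0 := by exact_mod_cast Real.pi_ne_zero
  have e : (2 * Real.pi * ((1 / (2 * Real.pi) : ℝ) : ℂ)) = 1 := by
    push_cast
    field_simp
  rw [e, one_mul]

/-- Repeated integration by parts. -/
lemma abs_im_pow_mul_norm_mellin_le (hv : IsTest v a b) (ha : 0 < a) (z : ℂ) (J : ℕ) :
    |z.im| ^ J * ‖mellin v z‖ ≤ ‖mellin (_root_.deriv^[J] v) (z + J)‖ := by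
  induction J generalizing v z with
  | zero => simp
  | succ J ih =>
    have h := ih hv.deriv (z + 1)
    rw [hv.mellin_deriv ha, norm_mul, norm_neg] at h
    simp only [add_im, one_im, add_zero] at h
    rw [Function.iterate_succ_apply]
    have e : z + ((J + 1 : ℕ) : ℂ) = z + 1 + J := by push_cast; ring
    rw [e]
    refine le_trans ?_ h
    rw [pow_succ, mul_assoc]
    gcongr
    exact abs_im_le_norm z

/-- The trivial bound for the Mellin transform of a function supported in `[u₀/2, 2u₀]`. -/
lemma norm_mellin_le_rpow (hv : IsTest v a b) {u₀ : ℝ} (hu₀ : 0 < u₀) (ha : u₀ / 2 ≤ a)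
    (hb : b ≤ 2 * u₀) (hab : a ≤ b) {C : ℝ} (hC : ∀ u, ‖v u‖ ≤ C) (z : ℂ) :
    ‖mellin v z‖ ≤ (b - a) * C * (2 ^ |z.re - 1| * u₀ ^ (z.re - 1)) := by
  have ha0 : 0 < a := by linarith
  have hC0 : 0 ≤ C := (norm_nonneg _).trans (hC 0)
  rw [hv.mellin_eq ha0, ← setIntegral_eq_integral_of_forall_compl_eq_zero (s := Set.Icc a b)
    fun u hu => by rw [hv.supp u hu, mul_zero]]
  have h := norm_setIntegral_le_of_norm_le_const (μ := volume) (s := Set.Icc a b)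
    (f := fun u : ℝ => (u : ℂ) ^ (z - 1) * v u) (C := C * (2 ^ |z.re - 1| * u₀ ^ (z.re - 1)))
    (by simp) (fun u hu => ?_)
  · refine h.trans (le_of_eq ?_)
    rw [Real.volume_real_Icc_of_le hab]
    ring
  · have hupos : 0 < u := ha0.trans_le hu.1
    rw [norm_mul, norm_cpow_eq_rpow_re_of_pos hupos, mul_comm, sub_re, one_re]
    refine mul_le_mul (hC u) ?_ (by positivity) hC0
    set y := z.re - 1
    have e : u ^ y = (u / u₀) ^ y * u₀ ^ y := by
      rw [← Real.mul_rpow (by positivity) hu₀.le]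
      congr 1
      field_simp
    rw [e]
    gcongr
    have hle : u / u₀ ≤ 2 := by rw [div_le_iff₀ hu₀]; linarith [hu.2]
    have hge : 2⁻¹ ≤ u / u₀ := by rw [le_div_iff₀ hu₀]; linarith [hu.1]
    rcases le_total 0 y with hy | hy
    · rw [abs_of_nonneg hy]
      exact Real.rpow_le_rpow (by positivity) hle hy
    · rw [abs_of_nonpos hy]
      calc (u / u₀) ^ y ≤ (2⁻¹ : ℝ) ^ y := Real.rpow_le_rpow_of_nonpos (by norm_num) hge hy
        _ = 2 ^ (-y) := by rw [Real.inv_rpow (by norm_num), Real.rpow_neg (by norm_num)]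

end IsTest

/-! ### The Mellin–Barnes integral of a single `Γ`-factor -/

/-- Convergence of the Laplace integral of a power. -/
lemma integrableOn_cpow_mul_exp_neg {a r : ℂ} (ha : 0 < a.re) (hr : 0 < r.re) :
    IntegrableOn (fun u : ℝ => (u : ℂ) ^ (a - 1) * cexp (-(r * u))) (Set.Ioi 0) := by
  have hreal : IntegrableOn (fun u : ℝ => (u : ℂ) ^ (a - 1) * cexp (-((r.re : ℂ) * u)))
      (Set.Ioi 0) := by
    have h := Complex.integral_cpow_mul_exp_neg_mul_Ioi ha hr
    by_contra hcon
    rw [integral_undef hcon] at h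
    have hr0 : (r.re : ℂ) ≠ 0 := by exact_mod_cast hr.ne'
    have h1 : (1 / (r.re : ℂ)) ^ a ≠ 0 := by simp [cpow_eq_zero_iff, hr0]
    exact mul_ne_zero h1 (Gamma_ne_zero_of_re_pos ha) h.symm
  refine Integrable.mono hreal ?_ (Eventually.of_forall fun u => ?_)
  · have h2 : Measurable fun u : ℝ => (u : ℂ) ^ (a - 1) := measurable_ofReal.pow_const _
    exact (h2.mul (by fun_prop)).aestronglyMeasurable
  · simp [norm_exp]

/-- The Laplace transform of a power, continued from real to complex `r`. -/
lemma integral_cpow_mul_exp_neg {a r : ℂ} (ha : 0 < a.re) (hr : 0 < r.re) :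
    ∫ u in Set.Ioi (0 : ℝ), (u : ℂ) ^ (a - 1) * cexp (-(r * u)) = r ^ (-a) * Gamma a := by
  set U : Set ℂ := {z | 0 < z.re} with hU
  have hUo : IsOpen U := isOpen_lt continuous_const continuous_re
  have hUc : IsPreconnected U := (convex_halfSpace_re_gt 0).isPreconnected
  have hf : DifferentiableOn ℂ
      (fun r : ℂ => ∫ u in Set.Ioi (0 : ℝ), (u : ℂ) ^ (a - 1) * cexp (-(r * u))) U := by
    intro r₀ hr₀
    have hr₀' : 0 < r₀.re := hr₀
    have hs : {z : ℂ | r₀.re / 2 < z.re} ∈ 𝓝 r₀ :=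
      (isOpen_lt continuous_const continuous_re).mem_nhds (by simp; linarith)
    have hmeas : ∀ (c r : ℂ), AEStronglyMeasurable
        (fun u : ℝ => (u : ℂ) ^ c * cexp (-(r * u))) (volume.restrict (Set.Ioi 0)) := by
      intro c r
      have h2 : Measurable fun u : ℝ => (u : ℂ) ^ c := measurable_ofReal.pow_const _
      exact (h2.mul (by fun_prop)).aestronglyMeasurable
    have hb := (integrableOn_cpow_mul_exp_neg (a := a + 1) (r := (r₀.re / 2 : ℝ))
      (by simp; linarith) (by simpa using hr₀')).norm
    have h := hasDerivAt_integral_of_dominated_loc_of_deriv_le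
      (μ := volume.restrict (Set.Ioi 0)) (F := fun r (u : ℝ) => (u : ℂ) ^ (a - 1) * cexp (-(r * u)))
      (F' := fun r (u : ℝ) => (u : ℂ) ^ (a - 1) * (cexp (-(r * u)) * (-u))) hs
      (Eventually.of_forall fun r => hmeas _ r) (integrableOn_cpow_mul_exp_neg ha hr₀)
      ?_ ?_ hb ?_
    · exact h.2.differentiableAt.differentiableWithinAt
    · refine ((hmeas (a - 1) r₀).mul
        (by fun_prop : Continuous fun u : ℝ => (-u : ℂ)).aestronglyMeasurable).congr
        (Eventually.of_forall fun u => ?_)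
      simp only [Pi.mul_apply]
      ring
    · filter_upwards [ae_restrict_mem measurableSet_Ioi] with u hu r hrs
      have hu0 : (0 : ℝ) < u := hu
      have huC : (u : ℂ) ≠ 0 := by exact_mod_cast hu0.ne'
      have e : (u : ℂ) ^ (a + 1 - 1) = (u : ℂ) ^ (a - 1) * u := by
        rw [add_sub_right_comm, cpow_add _ _ huC, cpow_one]
      rw [e, norm_mul, norm_mul, norm_mul, norm_mul, norm_neg, mul_assoc, mul_comm ‖(u : ℂ)‖]
      gcongr
      rw [norm_exp, norm_exp, Real.exp_le_exp]
      simp only [neg_re, mul_re, ofReal_re, ofReal_im, mul_zero, sub_zero]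
      have : r₀.re / 2 < r.re := hrs
      nlinarith
    · refine Eventually.of_forall fun u r _ => ?_
      have h1 : HasDerivAt (fun r : ℂ => -(r * u)) (-(u : ℂ)) r := by
        simpa only [id, one_mul] using ((hasDerivAt_id r).mul_const (u : ℂ)).fun_neg
      exact h1.cexp.const_mul _
  have hg : DifferentiableOn ℂ (fun r : ℂ => r ^ (-a) * Gamma a) U := by
    intro r hr
    refine DifferentiableAt.differentiableWithinAt ?_
    exact (differentiableAt_id.cpow_const (Or.inl hr)).mul_const _
  have hfreq : ∃ᶠ z in 𝓝[≠] (1 : ℂ),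
      ∫ u in Set.Ioi (0 : ℝ), (u : ℂ) ^ (a - 1) * cexp (-(z * u)) = z ^ (-a) * Gamma a := by
    have hmap : Tendsto (fun x : ℝ => (x : ℂ)) (𝓝[>] 1) (𝓝[≠] (1 : ℂ)) := by
      refine tendsto_nhdsWithin_iff.mpr ⟨?_, ?_⟩
      · have := (continuous_ofReal.tendsto (1 : ℝ)).mono_left
          (nhdsWithin_le_nhds (s := Set.Ioi (1 : ℝ)))
        simpa using this
      · filter_upwards [eventually_mem_nhdsWithin] with x hx
        have hx' : (1 : ℝ) < x := hx
        simp only [Set.mem_compl_iff, Set.mem_singleton_iff]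
        exact_mod_cast hx'.ne'
    refine hmap.frequently (Eventually.frequently ?_)
    filter_upwards [eventually_mem_nhdsWithin] with x hx
    have hx' : (1 : ℝ) < x := hx
    have hx0 : 0 < x := by linarith
    rw [Complex.integral_cpow_mul_exp_neg_mul_Ioi ha hx0, one_div, inv_cpow, cpow_neg]
    rw [arg_ofReal_of_nonneg hx0.le]
    exact Real.pi_pos.ne
  exact (hf.analyticOnNhd hUo).eqOn_of_preconnected_of_frequently_eq (hg.analyticOnNhd hUo) hUc
    (by simp [hU]) hfreq hr

/-- The decay `e^{-π|t|/2}` of `Γ` on a vertical line, uniformly in `t`. -/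
lemma exists_norm_Gamma_line_le {θ : ℂ} (hθ : 0 < θ.re) :
    ∃ C : ℝ, 0 < C ∧ ∀ t : ℝ, ‖Gamma (-(t * I) + θ)‖ * Real.exp (Real.pi / 2 * |t|) ≤
      C * (1 + |t|) ^ (θ.re - 1 / 2) := by
  have hcont : Continuous fun t : ℝ => Gamma (-(t * I) + θ) := by
    rw [continuous_iff_continuousAt]
    intro t
    have h : ContinuousAt Gamma (-(t * I) + θ) := by
      refine continuousAt_Gamma _ fun m h => ?_
      have hre := congrArg re h
      simp at hre
      have : (0 : ℝ) ≤ m := m.cast_nonneg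
      linarith
    exact ContinuousAt.comp (f := fun t : ℝ => (-(t * I) + θ : ℂ)) h (by fun_prop)
  have hO : (fun t : ℝ => Gamma (-(t * I) + θ) * (Real.exp (Real.pi / 2 * |t|) : ℂ)) =O[cocompact ℝ]
      (fun t : ℝ => |t| ^ (θ.re - 1 / 2)) := by
    have h : (fun t : ℝ => (Real.exp (Real.pi / 2 * |t|) : ℂ)) =O[cocompact ℝ]
        (fun t : ℝ => Real.exp (Real.pi / 2 * |t|)) := isBigO_of_le _ fun t => by
          rw [norm_real]
    refine ((isBigO_Gamma_line hθ).mul h).congr_right fun t => ?_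
    rw [mul_assoc, ← Real.exp_add]
    simp
  obtain ⟨C, hC0, hC⟩ := exists_bound_of_isBigO (hcont.mul (by fun_prop)) hO
  refine ⟨C, hC0, fun t => ?_⟩
  have h := hC t
  rwa [Pi.mul_apply, norm_mul, norm_real, Real.norm_of_nonneg (Real.exp_pos _).le] at h

lemma norm_cpow_mul_I_le {r : ℂ} (hr0 : r ≠ 0) (hr : 0 ≤ r.re) (t : ℝ) :
    ‖r ^ (t * I)‖ ≤ Real.exp (Real.pi / 2 * |t|) := by
  rw [norm_cpow_of_ne_zero hr0]
  have harg := abs_arg_le_pi_div_two_iff.mpr hr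
  simp only [mul_re, ofReal_re, I_re, mul_zero, ofReal_im, I_im, mul_one, sub_self, Real.rpow_zero,
    mul_im, add_zero]
  rw [one_div, ← Real.exp_neg, Real.exp_le_exp]
  calc -(arg r * t) ≤ |arg r * t| := neg_le_abs _
    _ = |arg r| * |t| := abs_mul _ _
    _ ≤ Real.pi / 2 * |t| := by gcongr

lemma norm_Gamma_mul_cpow_le {θ : ℂ} {C : ℝ}
    (hC : ∀ t : ℝ, ‖Gamma (-(t * I) + θ)‖ * Real.exp (Real.pi / 2 * |t|) ≤
      C * (1 + |t|) ^ (θ.re - 1 / 2)) {r : ℂ} (hr0 : r ≠ 0) (hr : 0 ≤ r.re) (t : ℝ) :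
    ‖Gamma (-(t * I) + θ) * r ^ (t * I)‖ ≤ C * (1 + |t|) ^ (θ.re - 1 / 2) := by
  refine le_trans ?_ (hC t)
  rw [norm_mul]
  gcongr
  exact norm_cpow_mul_I_le hr0 hr t

lemma continuous_Gamma_mul_cpow {θ : ℂ} (hθ : 0 < θ.re) {r : ℂ} (hr0 : r ≠ 0) :
    Continuous fun t : ℝ => Gamma (-(t * I) + θ) * r ^ (t * I) := by
  refine Continuous.mul ?_ ?_
  · rw [continuous_iff_continuousAt]
    intro t
    have h : ContinuousAt Gamma (-(t * I) + θ) := by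
      refine continuousAt_Gamma _ fun m h => ?_
      have hre := congrArg re h
      simp at hre
      have : (0 : ℝ) ≤ m := m.cast_nonneg
      linarith
    exact ContinuousAt.comp (f := fun t : ℝ => (-(t * I) + θ : ℂ)) h (by fun_prop)
  · exact Continuous.const_cpow (by fun_prop) (Or.inl hr0)

lemma integrable_mellin_mul_Gamma {v : ℝ → ℂ} {a b : ℝ} (hv : IsTest v a b) (ha : 0 < a) (σ : ℝ)
    {θ : ℂ} (hθ : 0 < θ.re) {r : ℂ} (hr0 : r ≠ 0) (hr : 0 ≤ r.re) :
    Integrable fun t : ℝ => mellin v (σ + t * I) * (Gamma (-(t * I) + θ) * r ^ (t * I)) := by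
  obtain ⟨C, hC0, hC⟩ := exists_norm_Gamma_line_le hθ
  exact hv.integrable_mellin_line ha σ (continuous_Gamma_mul_cpow hθ hr0).aestronglyMeasurable
    fun t => norm_Gamma_mul_cpow_le hC hr0 hr t

/-- Fubini, when the Laplace integral representing `Γ` converges absolutely. -/
lemma integral_mellin_mul_Gamma_of_re_pos {v : ℝ → ℂ} {a b : ℝ} (hv : IsTest v a b) (ha : 0 < a)
    (N : ℝ) {θ : ℂ} (hθ : 0 < θ.re) {r : ℂ} (hr : 0 < r.re) :
    ∫ t : ℝ, mellin v (-N + t * I) * (Gamma (-(t * I) + θ) * r ^ (t * I)) =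
      2 * Real.pi * r ^ θ * ∫ u : ℝ, cexp (-(r * u)) * ((u : ℂ) ^ (θ - N - 1) * v u) := by
  have hr0 : r ≠ 0 := by rintro rfl; simp at hr
  have hlap : ∀ t : ℝ, Gamma (-(t * I) + θ) * r ^ (t * I) =
      r ^ θ * ∫ u in Set.Ioi (0 : ℝ), (u : ℂ) ^ (-(t * I) + θ - 1) * cexp (-(r * u)) := by
    intro t
    rw [integral_cpow_mul_exp_neg (by simpa using hθ) hr, ← mul_assoc, ← cpow_add _ _ hr0, mul_comm]
    ring_nf
  set f : ℝ → ℝ → ℂ := fun t u =>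
    mellin v (-N + t * I) * ((u : ℂ) ^ (-(t * I) + θ - 1) * cexp (-(r * u))) with hf
  have hV : Integrable fun t : ℝ => mellin v (-N + t * I) := by
    have h := hv.integrable_mellin_line ha (-N) (f := fun _ => 1) aestronglyMeasurable_const
      (C := 1) (y := 0) (by simp)
    simpa using h
  have hker := integrableOn_cpow_mul_exp_neg hθ hr
  have hint : Integrable (Function.uncurry f) (volume.prod (volume.restrict (Set.Ioi 0))) := by
    refine (hV.mul_prod hker).mono ?_ ?_
    · have h1 : AEStronglyMeasurable (fun p : ℝ × ℝ => mellin v (-N + p.1 * I))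
          (volume.prod (volume.restrict (Set.Ioi 0))) := by
        have := hv.continuous_mellin_line ha (-N)
        push_cast at this
        exact (this.comp continuous_fst).aestronglyMeasurable
      refine h1.mul ?_
      refine Measurable.aestronglyMeasurable ?_
      have h2 : Measurable fun p : ℝ × ℝ => (p.2 : ℂ) ^ (-(p.1 * I) + θ - 1) :=
        (measurable_ofReal.comp measurable_snd).pow (by fun_prop)
      exact h2.mul (by fun_prop)
    · have hae : ∀ᵐ p ∂((volume : Measure ℝ).prod ((volume : Measure ℝ).restrict (Set.Ioi 0))),
          p.2 ∈ Set.Ioi (0 : ℝ) :=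
        Measure.quasiMeasurePreserving_snd.ae (ae_restrict_mem measurableSet_Ioi)
      filter_upwards [hae] with p hp
      have hp0 : 0 < p.2 := hp
      simp only [hf, Function.uncurry, norm_mul, norm_cpow_eq_rpow_re_of_pos hp0]
      simp
  have hswap := integral_integral_swap (f := f) hint
  calc ∫ t : ℝ, mellin v (-N + t * I) * (Gamma (-(t * I) + θ) * r ^ (t * I))
      = r ^ θ * ∫ t : ℝ, ∫ u in Set.Ioi (0 : ℝ), f t u := by
        rw [← integral_const_mul]
        refine integral_congr_ae (Eventually.of_forall fun t => ?_)
        simp only [hf]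
        rw [hlap, integral_const_mul]
        ring
    _ = r ^ θ * ∫ u in Set.Ioi (0 : ℝ), ∫ t : ℝ, f t u := by rw [hswap]
    _ = r ^ θ * ∫ u in Set.Ioi (0 : ℝ),
          2 * Real.pi * (cexp (-(r * u)) * ((u : ℂ) ^ (θ - N - 1) * v u)) := by
        congr 1
        refine setIntegral_congr_fun measurableSet_Ioi fun u hu => ?_
        have hu0 : (0 : ℝ) < u := hu
        have huC : (u : ℂ) ≠ 0 := by exact_mod_cast hu0.ne'
        have hinv := hv.integral_cpow_mul_mellin ha (-N) hu0
        have e : ∀ t : ℝ, f t u = cexp (-(r * u)) * (u : ℂ) ^ (θ - N - 1) *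
            ((u : ℂ) ^ (-(((-N : ℝ) : ℂ) + t * I)) * mellin v (((-N : ℝ) : ℂ) + t * I)) := by
          intro t
          have e1 : (u : ℂ) ^ (-(t * I) + θ - 1) =
              (u : ℂ) ^ (θ - N - 1) * (u : ℂ) ^ (-(((-N : ℝ) : ℂ) + t * I)) := by
            rw [← cpow_add _ _ huC]
            congr 1
            push_cast
            ring
          simp only [hf]
          rw [e1]
          push_cast
          ring
        simp only [e]
        rw [integral_const_mul, hinv]
        ring
    _ = _ := by
        rw [integral_const_mul, setIntegral_eq_integral_of_forall_compl_eq_zero fun u hu => ?_]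
        · ring
        · rw [hv.supp u fun h => hu (ha.trans_le h.1)]
          simp

/-- The same identity on the boundary of the half-plane of absolute convergence, in particular for
`r = ∓iM`, where `r^{it}` grows like `e^{±πt/2}`. -/
lemma integral_mellin_mul_Gamma {v : ℝ → ℂ} {a b : ℝ} (hv : IsTest v a b) (ha : 0 < a)
    (N : ℝ) {θ : ℂ} (hθ : 0 < θ.re) {r : ℂ} (hr : 0 ≤ r.re) (hrs : r ∈ slitPlane) :
    ∫ t : ℝ, mellin v (-N + t * I) * (Gamma (-(t * I) + θ) * r ^ (t * I)) =
      2 * Real.pi * r ^ θ * ∫ u : ℝ, cexp (-(r * u)) * ((u : ℂ) ^ (θ - N - 1) * v u) := by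
  obtain ⟨C, hC0, hC⟩ := exists_norm_Gamma_line_le hθ
  -- replace `r` by `r + ε` and let `ε → 0`: both integrals have integrable majorants
  set l : Filter ℝ := 𝓝[>] 0 with hl
  have hpos : ∀ᶠ ε in l, (0 : ℝ) < ε := eventually_mem_nhdsWithin
  have hlim : Tendsto (fun ε : ℝ => r + ε) l (𝓝 r) := by
    have h : Tendsto (fun ε : ℝ => r + (ε : ℂ)) (𝓝 0) (𝓝 (r + ((0 : ℝ) : ℂ))) :=
      (by fun_prop : Continuous fun ε : ℝ => r + (ε : ℂ)).tendsto 0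
    rw [ofReal_zero, add_zero] at h
    exact h.mono_left nhdsWithin_le_nhds
  have hre : ∀ ε : ℝ, 0 < ε → 0 < (r + ε).re := fun ε hε => by
    simp
    linarith
  have hne : ∀ ε : ℝ, 0 < ε → r + ε ≠ 0 := fun ε hε h => by
    have := hre ε hε
    rw [h] at this
    simp at this
  have hleft : Tendsto
      (fun ε : ℝ => ∫ t : ℝ, mellin v (-N + t * I) * (Gamma (-(t * I) + θ) * (r + ε) ^ (t * I))) l
      (𝓝 (∫ t : ℝ, mellin v (-N + t * I) * (Gamma (-(t * I) + θ) * r ^ (t * I)))) := by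
    have hbi : Integrable fun t : ℝ => mellin v ((-N : ℝ) + t * I) *
        ((C * (1 + |t|) ^ (θ.re - 1 / 2) : ℝ) : ℂ) := by
      refine hv.integrable_mellin_line ha (-N) (C := C) (y := θ.re - 1 / 2) ?_ fun t => ?_
      · have : Continuous fun t : ℝ => C * (1 + |t|) ^ (θ.re - 1 / 2) :=
          continuous_const.mul ((by fun_prop : Continuous fun t : ℝ => 1 + |t|).rpow_const
            fun t => Or.inl (by positivity))
        exact (continuous_ofReal.comp this).aestronglyMeasurable
      · rw [norm_real, Real.norm_of_nonneg (by positivity)]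
    have hVc := hv.continuous_mellin_line ha (-N)
    push_cast at hVc hbi
    refine tendsto_integral_filter_of_dominated_convergence _ ?_ ?_ hbi.norm ?_
    · filter_upwards [hpos] with ε hε
      exact (hVc.mul (continuous_Gamma_mul_cpow hθ (hne ε hε))).aestronglyMeasurable
    · filter_upwards [hpos] with ε hε
      refine Eventually.of_forall fun t => ?_
      have h := norm_Gamma_mul_cpow_le hC (hne ε hε) (hre ε hε).le t
      have e : ((C : ℂ) * (((1 + |t|) ^ (θ.re - 1 / 2) : ℝ) : ℂ)) =
          ((C * (1 + |t|) ^ (θ.re - 1 / 2) : ℝ) : ℂ) := by push_cast; rfl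
      rw [norm_mul, norm_mul (mellin v _), e, norm_real, Real.norm_of_nonneg (by positivity)]
      gcongr
    · refine Eventually.of_forall fun t => ?_
      have h : Tendsto (fun ε : ℝ => (r + ε) ^ (t * I)) l (𝓝 (r ^ (t * I))) :=
        ((continuousAt_id.cpow continuousAt_const hrs).tendsto).comp hlim
      exact (h.const_mul _).const_mul _
  have hright : Tendsto (fun ε : ℝ => 2 * Real.pi * (r + ε) ^ θ *
      ∫ u : ℝ, cexp (-((r + ε) * u)) * ((u : ℂ) ^ (θ - N - 1) * v u)) l
      (𝓝 (2 * Real.pi * r ^ θ * ∫ u : ℝ, cexp (-(r * u)) * ((u : ℂ) ^ (θ - N - 1) * v u))) := by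
    refine Tendsto.mul (Tendsto.const_mul _
      (((continuousAt_id.cpow continuousAt_const hrs).tendsto).comp hlim)) ?_
    have hi := hv.integrable_cpow_mul ha (θ - N - 1)
    refine tendsto_integral_filter_of_dominated_convergence _ ?_ ?_ hi.norm ?_
    · refine Eventually.of_forall fun ε => ?_
      exact Continuous.aestronglyMeasurable
        ((by fun_prop : Continuous fun u : ℝ => cexp (-((r + ε) * u))).mul
          (hv.continuous_cpow_mul ha _))
    · filter_upwards [hpos] with ε hε
      refine Eventually.of_forall fun u => ?_
      by_cases hu : u ∈ Set.Icc a b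
      · have hu0 : 0 < u := ha.trans_le hu.1
        rw [norm_mul]
        apply mul_le_of_le_one_left (norm_nonneg _)
        rw [norm_exp, Real.exp_le_one_iff]
        have := mul_pos (hre ε hε) hu0
        simp at this ⊢
        linarith
      · simp [hv.supp u hu]
    · refine Eventually.of_forall fun u => ?_
      refine Tendsto.mul_const _ ?_
      exact (continuous_exp.tendsto _).comp ((hlim.mul_const _).neg)
  refine tendsto_nhds_unique hleft (hright.congr' ?_)
  filter_upwards [hpos] with ε hε
  exact (integral_mellin_mul_Gamma_of_re_pos hv ha N hθ (hre ε hε)).symm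

/-! ### Oscillating wave packets -/

/-- The Fourier integral `∫ g(u) e^{iyu} du`. -/
noncomputable def fourierInt (g : ℝ → ℂ) (y : ℝ) : ℂ := ∫ u : ℝ, cexp (y * u * I) * g u

lemma abs_mul_norm_fourierInt {g : ℝ → ℂ} {a b : ℝ} (hg : IsTest g a b) (y : ℝ) :
    |y| * ‖fourierInt g y‖ = ‖fourierInt (deriv g) y‖ := by
  have hi : ∀ h : ℝ → ℂ, IsTest h a b → Integrable fun u : ℝ => cexp (y * u * I) * h u := by
    intro h hh
    exact ((by fun_prop : Continuous fun u : ℝ => cexp (y * u * I)).mul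
      hh.continuous).integrable_of_hasCompactSupport (hh.hasCompactSupport_mul _)
  have hder : ∀ u : ℝ, HasDerivAt (fun u : ℝ => cexp (y * u * I) * g u)
      (cexp (y * u * I) * deriv g u + y * I * (cexp (y * u * I) * g u)) u := by
    intro u
    have h0 : HasDerivAt (fun u : ℝ => (y * u * I : ℂ)) (y * I) u := by
      have := ((hasDerivAt_id (u : ℂ)).const_mul (y : ℂ)).mul_const I
      simpa using this.comp_ofReal
    have h2 : HasDerivAt g (deriv g u) u := ((hg.smooth.differentiable (by simp)) u).hasDerivAt
    convert! h0.cexp.mul h2 using 1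
    ring
  have h := integral_eq_zero_of_hasDerivAt_of_integrable hder
    ((hi _ hg.deriv).add ((hi g hg).const_mul (y * I))) (hi g hg)
  rw [integral_add (hi _ hg.deriv) ((hi g hg).const_mul _), integral_const_mul] at h
  have h' : fourierInt (deriv g) y = -(y * I * fourierInt g y) := by
    rw [fourierInt, fourierInt]
    linear_combination h
  rw [h', norm_neg, norm_mul, norm_mul, norm_I, mul_one, norm_real, Real.norm_eq_abs]

/-- Rapid decay of the Fourier integral of a smooth compactly supported function. -/
lemma exists_fourierInt_bound {g : ℝ → ℂ} {a b : ℝ} (hg : IsTest g a b) (J : ℕ) :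
    ∃ C : ℝ, 0 ≤ C ∧ ∀ y : ℝ, |y| ^ J * ‖fourierInt g y‖ ≤ C := by
  induction J generalizing g with
  | zero =>
    refine ⟨∫ u : ℝ, ‖g u‖, integral_nonneg fun u => norm_nonneg _, fun y => ?_⟩
    rw [pow_zero, one_mul]
    refine (norm_integral_le_integral_norm _).trans (le_of_eq ?_)
    refine integral_congr_ae (Eventually.of_forall fun u => ?_)
    have : (y * u * I : ℂ) = ((y * u : ℝ) : ℂ) * I := by push_cast; ring
    simp only [norm_mul]
    rw [this, norm_exp_ofReal_mul_I, one_mul]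
  | succ J ih =>
    obtain ⟨C, hC0, hC⟩ := ih hg.deriv
    refine ⟨C, hC0, fun y => ?_⟩
    rw [pow_succ, mul_assoc, abs_mul_norm_fourierInt hg]
    exact hC y

/-- The bump `g`, stretched by `H`, moved to `u₀`, and modulated with frequency `-M₀`. -/
noncomputable def packet (g : ℝ → ℂ) (H M₀ u₀ : ℝ) (u : ℝ) : ℂ :=
  g ((u - u₀) / H) * cexp (-(M₀ * (u - u₀) * I))

lemma isTest_packet {g : ℝ → ℂ} (hg : IsTest g (-1) 1) {H : ℝ} (hH : 0 < H) (M₀ u₀ : ℝ) :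
    IsTest (packet g H M₀ u₀) (u₀ - H) (u₀ + H) where
  smooth := by
    have h1 : ContDiff ℝ ∞ fun u : ℝ => g ((u - u₀) / H) :=
      hg.smooth.comp ((contDiff_id.sub contDiff_const).div_const H)
    have h2 : ContDiff ℝ ∞ fun u : ℝ => cexp (-(M₀ * (u - u₀) * I)) := by
      refine Complex.contDiff_exp.comp ?_
      exact ((contDiff_const.mul (ofRealCLM.contDiff.sub contDiff_const)).mul contDiff_const).neg
    exact h1.mul h2
  supp u hu := by
    rw [packet, hg.supp, zero_mul]
    intro h
    apply hu
    have h1 := h.1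
    have h2 := h.2
    rw [le_div_iff₀ hH] at h1
    rw [div_le_iff₀ hH] at h2
    constructor <;> linarith

lemma iterate_deriv_packet (g : ℝ → ℂ) (H M₀ u₀ : ℝ) (J : ℕ) :
    deriv^[J] (packet g H M₀ u₀) = fun u => deriv^[J] (packet g H M₀ 0) (u - u₀) := by
  induction J with
  | zero =>
    funext u
    simp [packet]
  | succ J ih =>
    rw [Function.iterate_succ_apply', ih, Function.iterate_succ_apply']
    funext u
    exact deriv_comp_sub_const (f := deriv^[J] (packet g H M₀ 0)) u₀ u

lemma integral_exp_mul_packet (g : ℝ → ℂ) {H : ℝ} (hH : 0 < H) (M₀ u₀ w : ℝ) :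
    ∫ u : ℝ, cexp (w * u * I) * packet g H M₀ u₀ u =
      H * cexp (w * u₀ * I) * fourierInt g (H * (w - M₀)) := by
  set F : ℝ → ℂ := fun u => cexp (w * u * I) * packet g H M₀ u₀ u with hF
  have h1 : ∫ u : ℝ, F u = ∫ u : ℝ, F (u + u₀) := (integral_add_right_eq_self (μ := volume) F u₀).symm
  have h2 : ∫ y : ℝ, F (H * y + u₀) = |H⁻¹| • ∫ u : ℝ, F (u + u₀) :=
    Measure.integral_comp_mul_left (fun u => F (u + u₀)) H
  rw [abs_of_pos (inv_pos.mpr hH), Complex.real_smul] at h2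
  have h3 : ∫ u : ℝ, F (u + u₀) = H * ∫ y : ℝ, F (H * y + u₀) := by
    rw [h2, ← mul_assoc, ← ofReal_mul, mul_inv_cancel₀ hH.ne', ofReal_one, one_mul]
  rw [h1, h3, fourierInt, mul_assoc]
  congr 1
  rw [← integral_const_mul]
  refine integral_congr_ae (Eventually.of_forall fun y => ?_)
  simp only [hF, packet, add_sub_cancel_right]
  rw [mul_div_cancel_left₀ _ hH.ne', mul_left_comm, ← Complex.exp_add, ← mul_assoc,
    ← Complex.exp_add, mul_comm]
  congr 2
  push_cast
  ring

/-- Mellin transforms of wave packets are concentrated on `|t| ≲ u₀`: by repeated integration by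
parts. -/
lemma exists_norm_mellin_packet_le {g : ℝ → ℂ} (hg : IsTest g (-1) 1) {H : ℝ} (hH : 0 < H)
    (M₀ : ℝ) (θ : ℂ) (J : ℕ) : ∃ C : ℝ, 0 ≤ C ∧ ∀ u₀ : ℝ, 2 * H ≤ u₀ → ∀ t : ℝ,
      ‖mellin (packet g H M₀ u₀) (1 - θ + t * I)‖ * (1 + |t - θ.im| / u₀) ^ J ≤
        C * u₀ ^ (-θ.re) := by
  have hbase : ∀ K : ℕ, ∃ C : ℝ, 0 ≤ C ∧ ∀ u₀ : ℝ, 2 * H ≤ u₀ → ∀ t : ℝ,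
      ‖mellin (packet g H M₀ u₀) (1 - θ + t * I)‖ * (|t - θ.im| / u₀) ^ K ≤ C * u₀ ^ (-θ.re) := by
    intro K
    obtain ⟨B, hB0, hB⟩ := ((isTest_packet hg hH M₀ 0).iterate_deriv K).exists_bound
    refine ⟨2 * H * B * 2 ^ |-θ.re + K|, by positivity, fun u₀ hu₀ t => ?_⟩
    have hu0 : 0 < u₀ := by linarith
    have hq := isTest_packet hg hH M₀ u₀
    have h1 := hq.abs_im_pow_mul_norm_mellin_le (by linarith) (1 - θ + t * I) K
    have h2 := (hq.iterate_deriv K).norm_mellin_le_rpow hu0 (by linarith) (by linarith)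
      (by linarith) (C := B) (fun u => by rw [iterate_deriv_packet]; exact hB _)
      (1 - θ + t * I + K)
    have him : (1 - θ + t * I : ℂ).im = t - θ.im := by simp; ring
    have hre : (1 - θ + t * I + K : ℂ).re - 1 = -θ.re + K := by simp; ring
    rw [him] at h1
    rw [hre] at h2
    have h3 := h1.trans h2
    rw [div_pow, mul_div_assoc', div_le_iff₀ (by positivity), mul_comm]
    refine h3.trans (le_of_eq ?_)
    rw [Real.rpow_add hu0, Real.rpow_natCast]
    ring
  obtain ⟨C₀, hC₀, h₀⟩ := hbase 0
  obtain ⟨C₁, hC₁, h₁⟩ := hbase J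
  refine ⟨2 ^ J * (C₀ + C₁), by positivity, fun u₀ hu₀ t => ?_⟩
  have hu0 : 0 < u₀ := by linarith
  set x := |t - θ.im| / u₀ with hx
  have hx0 : 0 ≤ x := by positivity
  have hpow : (1 + x) ^ J ≤ 2 ^ J * (1 + x ^ J) := by
    rcases le_total x 1 with h | h
    · calc (1 + x) ^ J ≤ 2 ^ J := by gcongr; linarith
        _ ≤ 2 ^ J * (1 + x ^ J) := by
          apply le_mul_of_one_le_right (by positivity)
          have : 0 ≤ x ^ J := by positivity
          linarith
    · calc (1 + x) ^ J ≤ (2 * x) ^ J := by gcongr; linarith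
        _ = 2 ^ J * x ^ J := mul_pow _ _ _
        _ ≤ 2 ^ J * (1 + x ^ J) := by gcongr; linarith
  have e0 := h₀ u₀ hu₀ t
  have e1 := h₁ u₀ hu₀ t
  rw [pow_zero, mul_one] at e0
  set V := ‖mellin (packet g H M₀ u₀) (1 - θ + t * I)‖
  calc V * (1 + x) ^ J ≤ V * (2 ^ J * (1 + x ^ J)) := by gcongr
    _ = 2 ^ J * (V + V * x ^ J) := by ring
    _ ≤ 2 ^ J * (C₀ * u₀ ^ (-θ.re) + C₁ * u₀ ^ (-θ.re)) := by gcongr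
    _ = 2 ^ J * (C₀ + C₁) * u₀ ^ (-θ.re) := by ring

/-- The contribution of the error term of the kernel: the packet has `L¹`-norm `≍ u₀^{1-Re θ}` on
the line, the error term has size `u₀^{Re θ - 3/2}` there. -/
lemma exists_integral_mellin_packet_le {g : ℝ → ℂ} (hg : IsTest g (-1) 1) {H : ℝ} (hH : 0 < H)
    (M₀ : ℝ) {θ : ℂ} (hθ : 3 / 2 ≤ θ.re) : ∃ C : ℝ, 0 ≤ C ∧ ∀ u₀ : ℝ, 2 * H ≤ u₀ → 1 ≤ u₀ →
      ∀ F : ℝ → ℂ, (∀ t, ‖F t‖ ≤ ‖mellin (packet g H M₀ u₀) (1 - θ + t * I)‖ *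
        (1 + |t|) ^ (θ.re - 3 / 2)) → ‖∫ t, F t‖ ≤ C * u₀ ^ (-(1 / 2) : ℝ) := by
  set y := θ.re - 3 / 2 with hy
  have hy0 : 0 ≤ y := by rw [hy]; linarith
  obtain ⟨C, hC0, hC⟩ := exists_norm_mellin_packet_le hg hH M₀ θ (⌈y⌉₊ + 2)
  refine ⟨C * (1 + |θ.im|) ^ y * Real.pi, by positivity, fun u₀ hu₀ hu1 F hF => ?_⟩
  have hu0 : 0 < u₀ := by linarith
  have hbound : ∀ t, ‖F t‖ ≤ C * (1 + |θ.im|) ^ y * u₀ ^ (-(3 / 2) : ℝ) *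
      (1 + ((t - θ.im) / u₀) ^ 2)⁻¹ := by
    intro t
    set x := |t - θ.im| / u₀ with hx
    have hx0 : 0 ≤ x := by positivity
    have hxsq : ((t - θ.im) / u₀) ^ 2 = x ^ 2 := by rw [hx, div_pow, div_pow, sq_abs]
    have h1 : 1 + |t| ≤ (1 + |θ.im|) * (u₀ * (1 + x)) := by
      have ht : |t| ≤ |t - θ.im| + |θ.im| := by
        have := abs_add_le (t - θ.im) θ.im
        simpa using this
      have hux : u₀ * (1 + x) = u₀ + |t - θ.im| := by rw [hx]; field_simp
      rw [hux]
      nlinarith [abs_nonneg (t - θ.im), abs_nonneg θ.im]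
    have h2 : (1 + |t|) ^ y ≤ (1 + |θ.im|) ^ y * (u₀ ^ y * (1 + x) ^ ⌈y⌉₊) := by
      calc (1 + |t|) ^ y ≤ ((1 + |θ.im|) * (u₀ * (1 + x))) ^ y :=
            Real.rpow_le_rpow (by positivity) h1 hy0
        _ = (1 + |θ.im|) ^ y * (u₀ ^ y * (1 + x) ^ y) := by
            rw [Real.mul_rpow (by positivity) (by positivity), Real.mul_rpow hu0.le (by positivity)]
        _ ≤ (1 + |θ.im|) ^ y * (u₀ ^ y * (1 + x) ^ ⌈y⌉₊) := by
            gcongr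
            rw [← Real.rpow_natCast]
            exact Real.rpow_le_rpow_of_exponent_le (by linarith) (Nat.le_ceil y)
    have h3 := hC u₀ hu₀ t
    rw [← hx] at h3
    set V := ‖mellin (packet g H M₀ u₀) (1 - θ + t * I)‖
    have h4 : u₀ ^ (-θ.re) * u₀ ^ y = u₀ ^ (-(3 / 2) : ℝ) := by
      rw [← Real.rpow_add hu0, hy]
      congr 1
      ring
    rw [hxsq, ← div_eq_mul_inv, le_div_iff₀ (by positivity)]
    calc ‖F t‖ * (1 + x ^ 2) ≤ (V * ((1 + |θ.im|) ^ y * (u₀ ^ y * (1 + x) ^ ⌈y⌉₊))) *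
          (1 + x) ^ 2 := by
          gcongr
          · exact (hF t).trans (by gcongr)
          · nlinarith
      _ = (1 + |θ.im|) ^ y * u₀ ^ y * (V * (1 + x) ^ (⌈y⌉₊ + 2)) := by ring
      _ ≤ (1 + |θ.im|) ^ y * u₀ ^ y * (C * u₀ ^ (-θ.re)) := by gcongr
      _ = C * (1 + |θ.im|) ^ y * (u₀ ^ (-θ.re) * u₀ ^ y) := by ring
      _ = C * (1 + |θ.im|) ^ y * u₀ ^ (-(3 / 2) : ℝ) := by rw [h4]
  have hint : Integrable fun t : ℝ => (1 + ((t - θ.im) / u₀) ^ 2)⁻¹ :=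
    (integrable_inv_one_add_sq.comp_div hu0.ne').comp_sub_right θ.im
  refine (norm_integral_le_of_norm_le (hint.const_mul _) (Eventually.of_forall hbound)).trans ?_
  have hval : ∫ t : ℝ, (1 + ((t - θ.im) / u₀) ^ 2)⁻¹ = u₀ * Real.pi := by
    rw [integral_sub_right_eq_self (fun t : ℝ => (1 + (t / u₀) ^ 2)⁻¹) θ.im,
      Measure.integral_comp_div (fun t : ℝ => (1 + t ^ 2)⁻¹) u₀, integral_univ_inv_one_add_sq,
      abs_of_pos hu0, smul_eq_mul]
  rw [integral_const_mul, hval]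
  have h5 : u₀ ^ (-(3 / 2) : ℝ) * u₀ = u₀ ^ (-(1 / 2) : ℝ) := by
    rw [← Real.rpow_add_one hu0.ne']
    norm_num
  rw [← h5]
  apply le_of_eq
  ring

/-- Multiplication by a power preserves test functions supported in `(0, ∞)`. -/
lemma IsTest.cpow_mul {v : ℝ → ℂ} {a b : ℝ} (hv : IsTest v a b) (ha : 0 < a) (c : ℂ) :
    IsTest (fun u => (u : ℂ) ^ c * v u) a b where
  smooth := by
    rw [contDiff_iff_contDiffAt]
    intro u
    rcases lt_or_ge u a with hu | hu
    · have h0 : (fun u : ℝ => (u : ℂ) ^ c * v u) =ᶠ[𝓝 u] fun _ => 0 := by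
        filter_upwards [eventually_lt_nhds hu] with x hx
        rw [hv.supp x fun h => by linarith [h.1], mul_zero]
      exact contDiffAt_const.congr_of_eventuallyEq h0
    · have hs : (u : ℂ) ∈ slitPlane := Or.inl (by simp; linarith)
      have h1 : ContDiffAt ℂ ∞ (fun z : ℂ => z ^ c) (u : ℂ) :=
        (analyticAt_id.cpow analyticAt_const hs).contDiffAt
      have h2 : ContDiffAt ℝ ∞ (fun u : ℝ => (u : ℂ) ^ c) u :=
        (h1.restrict_scalars ℝ).comp u ofRealCLM.contDiff.contDiffAt
      exact h2.mul hv.smooth.contDiffAt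
  supp u hu := by rw [hv.supp u hu, mul_zero]

lemma mellin_cpow_mul (v : ℝ → ℂ) (c z : ℂ) :
    mellin (fun u => (u : ℂ) ^ c * v u) z = mellin v (z + c) := mellin_cpow_smul v z c

lemma neg_mul_I_cpow {M s : ℝ} (hM : 0 < M) (hs : s = 1 ∨ s = -1) (w : ℂ) :
    (-((s * M : ℝ) * I) : ℂ) ^ w = (M : ℂ) ^ w * cexp (-(s * (Real.pi / 2) * I * w)) := by
  have hs0 : s ≠ 0 := by rcases hs with rfl | rfl <;> norm_num
  have hMC : (M : ℂ) ≠ 0 := by exact_mod_cast hM.ne'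
  have hne : (-((s * M : ℝ) * I) : ℂ) ≠ 0 := by simp [hs0, hM.ne']
  rw [cpow_def_of_ne_zero hne, cpow_def_of_ne_zero hMC, ← Complex.exp_add,
    log_neg_mul_I (mul_ne_zero hs0 hM.ne')]
  congr 1
  rcases hs with rfl | rfl
  · rw [one_mul, abs_of_pos hM, sign_pos hM, ofReal_log hM.le]
    push_cast
    simp
    ring
  · rw [neg_one_mul, abs_neg, abs_of_pos hM, sign_neg (by linarith), ofReal_log hM.le]
    push_cast
    simp
    ring

/-! ### The summation formula with a wave packet as test function -/

lemma exists_norm_eval_line_le (P : Polynomial ℂ) (c : ℝ) : ∃ C : ℝ, 0 ≤ C ∧ ∀ t : ℝ,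
    ‖P.eval (c + t * I)‖ ≤ C * (1 + |t|) ^ P.natDegree := by
  refine ⟨∑ i ∈ Finset.range (P.natDegree + 1), ‖P.coeff i‖ * (1 + |c|) ^ i, by positivity,
    fun t => ?_⟩
  rw [Polynomial.eval_eq_sum_range, Finset.sum_mul]
  refine (norm_sum_le _ _).trans (Finset.sum_le_sum fun i hi => ?_)
  have hi' : i ≤ P.natDegree := by
    rw [Finset.mem_range] at hi
    omega
  have hz : ‖(c + t * I : ℂ)‖ ≤ (1 + |c|) * (1 + |t|) := by
    refine (norm_add_le _ _).trans ?_
    rw [norm_mul, norm_I, mul_one, norm_real, norm_real, Real.norm_eq_abs, Real.norm_eq_abs]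
    nlinarith [abs_nonneg c, abs_nonneg t]
  rw [norm_mul, norm_pow, mul_assoc]
  gcongr
  calc ‖(c + t * I : ℂ)‖ ^ i ≤ ((1 + |c|) * (1 + |t|)) ^ i := by gcongr
    _ = (1 + |c|) ^ i * (1 + |t|) ^ i := mul_pow _ _ _
    _ ≤ (1 + |c|) ^ i * (1 + |t|) ^ P.natDegree := by
        gcongr
        linarith [abs_nonneg t]

lemma norm_ofReal_cpow_line {x : ℝ} (hx : 0 < x) (c t : ℝ) : ‖(x : ℂ) ^ (c + t * I : ℂ)‖ = x ^ c := by
  rw [norm_cpow_eq_rpow_re_of_pos hx]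
  simp

lemma norm_tsum_cpow_line_le {b : ℕ → ℂ} {m : ℕ → ℝ} (hm : ∀ n, 0 < m n) {c : ℝ}
    (hb : Summable fun n => ‖b n‖ * m n ^ c) (t : ℝ) :
    ‖∑' n, b n * (m n : ℂ) ^ (c + t * I : ℂ)‖ ≤ ∑' n, ‖b n‖ * m n ^ c := by
  refine tsum_of_norm_bounded hb.hasSum fun n => ?_
  rw [norm_mul, norm_ofReal_cpow_line (hm n)]

/-- Termwise integration of a Dirichlet series against a Mellin transform and a kernel of
polynomial growth. -/
lemma hasSum_integral_mellin_mul {v : ℝ → ℂ} {A B : ℝ} (hv : IsTest v A B) (hA : 0 < A) {c : ℝ}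
    {b : ℕ → ℂ} {m : ℕ → ℝ} (hm : ∀ n, 0 < m n) (hb : Summable fun n => ‖b n‖ * m n ^ c) (σ : ℝ)
    {K : ℝ → ℂ} (hK : Continuous K) {C y : ℝ} (hC : ∀ t, ‖K t‖ ≤ C * (1 + |t|) ^ y) :
    HasSum (fun n => ∫ t : ℝ, mellin v (σ + t * I) * (K t * (b n * (m n : ℂ) ^ (c + t * I : ℂ))))
      (∫ t : ℝ, mellin v (σ + t * I) * (K t * ∑' n, b n * (m n : ℂ) ^ (c + t * I : ℂ))) := by
  have hVK := hv.integrable_mellin_line hA σ hK.aestronglyMeasurable hC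
  have hnorm : ∀ n (t : ℝ), ‖mellin v (σ + t * I) * (K t * (b n * (m n : ℂ) ^ (c + t * I : ℂ)))‖ =
      ‖mellin v (σ + t * I) * K t‖ * (‖b n‖ * m n ^ c) := by
    intro n t
    rw [← mul_assoc, norm_mul, norm_mul (b n), norm_ofReal_cpow_line (hm n)]
  have hcont : ∀ n, Continuous fun t : ℝ =>
      mellin v (σ + t * I) * (K t * (b n * (m n : ℂ) ^ (c + t * I : ℂ))) := by
    intro n
    have hmC : (m n : ℂ) ≠ 0 := by exact_mod_cast (hm n).ne'
    have h1 : Continuous fun t : ℝ => (m n : ℂ) ^ (c + t * I : ℂ) :=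
      Continuous.const_cpow (by fun_prop) (Or.inl hmC)
    exact (hv.continuous_mellin_line hA σ).mul (hK.mul (continuous_const.mul h1))
  have h := hasSum_integral_of_summable_integral_norm (μ := volume)
    (F := fun n (t : ℝ) => mellin v (σ + t * I) * (K t * (b n * (m n : ℂ) ^ (c + t * I : ℂ)))) ?_ ?_
  · simpa only [tsum_mul_left] using h
  · intro n
    refine (hVK.norm.mul_const (‖b n‖ * m n ^ c)).mono' (hcont n).aestronglyMeasurable
      (Eventually.of_forall fun t => (hnorm n t).le)
  · simp only [hnorm]
    simp only [integral_mul_const]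
    exact hb.mul_left _

/-- On the right line the pairing of the Dirichlet series with the Mellin transform of a test
function only sees the frequencies in the support, so it vanishes if there are none. The factor `P`
is absorbed by a differential operator. -/
lemma integral_mellin_mul_eq_zero_right {v : ℝ → ℂ} {A B : ℝ} (hv : IsTest v A B) (hA : 0 < A)
    (P : Polynomial ℂ) {c : ℝ} {a : ℕ → ℂ} {l : ℕ → ℝ} (hl : ∀ n, 0 < l n)
    (ha : Summable fun n => ‖a n‖ * l n ^ (-c)) (hgap : ∀ n, l n ∉ Set.Icc A B) :
    ∫ t : ℝ, mellin v (c + t * I) *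
      (P.eval (c + t * I) * ∑' n, a n * (l n : ℂ) ^ (-(c + t * I) : ℂ)) = 0 := by
  obtain ⟨w, hw, e⟩ := hv.exists_mellin_polynomial hA P
  have hlinv : ∀ n (t : ℝ), (((l n)⁻¹ : ℝ) : ℂ) ^ (c + t * I : ℂ) = (l n : ℂ) ^ (-(c + t * I) : ℂ) := by
    intro n t
    rw [ofReal_inv, inv_cpow, cpow_neg]
    rw [arg_ofReal_of_nonneg (hl n).le]
    exact Real.pi_pos.ne
  have hsum := hasSum_integral_mellin_mul hw hA (c := c) (m := fun n => (l n)⁻¹) (b := a)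
    (fun n => inv_pos.mpr (hl n)) (by
      refine ha.congr fun n => ?_
      rw [Real.inv_rpow (hl n).le, Real.rpow_neg (hl n).le]) c
    (K := fun _ => 1) continuous_const (C := 1) (y := 0) (by simp)
  have hzero : ∀ n, ∫ t : ℝ, mellin w (c + t * I) *
      (1 * (a n * (((l n)⁻¹ : ℝ) : ℂ) ^ (c + t * I : ℂ))) = 0 := by
    intro n
    have h := hw.integral_cpow_mul_mellin hA c (hl n)
    rw [hw.supp _ (hgap n), mul_zero] at h
    have h2 : ∀ t : ℝ, mellin w (c + t * I) * (1 * (a n * (((l n)⁻¹ : ℝ) : ℂ) ^ (c + t * I : ℂ))) =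
        a n * ((l n : ℂ) ^ (-(c + t * I) : ℂ) * mellin w (c + t * I)) := by
      intro t
      rw [hlinv]
      ring
    simp only [h2]
    rw [integral_const_mul, h, mul_zero]
  simp only [hzero] at hsum
  have h0 := hsum.unique hasSum_zero
  rw [← h0]
  refine integral_congr_ae (Eventually.of_forall fun t => ?_)
  simp only [hlinv, e]
  ring

/-- The pairing also vanishes on the left line, by a contour shift: `mellin v * E` is entire. -/
lemma integral_mellin_mul_eq_zero_left {v : ℝ → ℂ} {A B : ℝ} (hv : IsTest v A B) (hA : 0 < A)
    (P : Polynomial ℂ) {N c : ℝ} (hNc : -N < c) {a : ℕ → ℂ} {l : ℕ → ℝ} (hl : ∀ n, 0 < l n)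
    (ha : Summable fun n => ‖a n‖ * l n ^ (-c)) (hgap : ∀ n, l n ∉ Set.Icc A B)
    {E : ℂ → ℂ} (hE : Differentiable ℂ E) {G ρ T : ℝ}
    (hgrow : ∀ z : ℂ, -N ≤ z.re → z.re ≤ c → T ≤ |z.im| → ‖E z‖ ≤ Real.exp (G * (1 + |z.im|) ^ ρ))
    (hright : ∀ t : ℝ, E (c + t * I) =
      P.eval (c + t * I) * ∑' n, a n * (l n : ℂ) ^ (-(c + t * I) : ℂ))
    {C y : ℝ} (hleft : ∀ t : ℝ, ‖E (-N + t * I)‖ ≤ C * (1 + |t|) ^ y) :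
    ∫ t : ℝ, mellin v (-N + t * I) * E (-N + t * I) = 0 := by
  obtain ⟨D, hD0, hD⟩ := exists_norm_eval_line_le P c
  have hC0 : 0 ≤ C := by
    have := (norm_nonneg _).trans (hleft 0)
    simpa using this
  set S := ∑' n, ‖a n‖ * l n ^ (-c) with hS
  have hS0 : 0 ≤ S := tsum_nonneg fun n => mul_nonneg (norm_nonneg _) (Real.rpow_nonneg (hl n).le _)
  set M : ℕ := max P.natDegree ⌈y⌉₊ with hM
  have hbase : ∀ t : ℝ, 1 ≤ 1 + |t| := fun t => by linarith [abs_nonneg t]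
  have hline : ∀ z : ℂ, (z.re : ℂ) + z.im * I = z := fun z => re_add_im z
  obtain ⟨C', hC'⟩ := norm_le_pow_of_vertical_strip hE hNc hgrow (C := max C (D * S)) (M := M)
    (fun z hz => by
      have h := hleft z.im
      have e : (-N + z.im * I : ℂ) = z := by
        rw [← hline z, hz]
        simp
      rw [e] at h
      refine h.trans ?_
      have h1 : (1 + |z.im|) ^ y ≤ (1 + |z.im|) ^ M := by
        rw [← Real.rpow_natCast]
        refine Real.rpow_le_rpow_of_exponent_le (hbase _) ((Nat.le_ceil y).trans ?_)
        exact_mod_cast le_max_right _ _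
      calc C * (1 + |z.im|) ^ y ≤ C * (1 + |z.im|) ^ M := by gcongr
        _ ≤ max C (D * S) * (1 + |z.im|) ^ M := by gcongr; exact le_max_left _ _)
    (fun z hz => by
      have e : (c + z.im * I : ℂ) = z := by
        rw [← hline z, hz]
        simp
      have h := hright z.im
      have h2 : ‖∑' n, a n * (l n : ℂ) ^ (-(c + z.im * I) : ℂ)‖ ≤ S := by
        have h3 := norm_tsum_cpow_line_le hl ha (-z.im)
        have e2 : (((-c : ℝ) : ℂ) + ((-z.im : ℝ) : ℂ) * I) = -(c + z.im * I) := by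
          push_cast; ring
        rwa [e2] at h3
      have h4 := hD z.im
      rw [e] at h h2 h4
      rw [h, norm_mul]
      calc ‖P.eval z‖ * ‖∑' n, a n * (l n : ℂ) ^ (-z)‖
          ≤ (D * (1 + |z.im|) ^ P.natDegree) * S := by gcongr
        _ = D * S * (1 + |z.im|) ^ P.natDegree := by ring
        _ ≤ D * S * (1 + |z.im|) ^ M := by
            gcongr
            · exact hbase _
            · exact le_max_left _ _
        _ ≤ max C (D * S) * (1 + |z.im|) ^ M := by gcongr; exact le_max_right _ _)
  have hC'0 : 0 ≤ C' := by
    have := (norm_nonneg _).trans (hC' c (by simpa using hNc.le) (by simp))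
    simpa using this
  obtain ⟨W, hW0, hW⟩ := hv.norm_mellin_mul_pow_le hA (-N) c (M + 2)
  have hshift := integral_vertical_line_eq ((hv.differentiable_mellin hA).mul hE) hNc.le
    (C := W * C') (fun x t h1 h2 => by
      have e1 := hW (x + t * I) (by simpa using h1) (by simpa using h2)
      have e2 := hC' (x + t * I) (by simpa using h1) (by simpa using h2)
      have him : (x + t * I : ℂ).im = t := by simp
      rw [him] at e1 e2
      have h3 : 1 + t ^ 2 ≤ (1 + |t|) ^ 2 := by nlinarith [abs_nonneg t, sq_abs t]
      rw [Pi.mul_apply, norm_mul, ← div_eq_mul_inv, le_div_iff₀ (by positivity)]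
      calc ‖mellin v (x + t * I)‖ * ‖E (x + t * I)‖ * (1 + t ^ 2)
          ≤ ‖mellin v (x + t * I)‖ * (C' * (1 + |t|) ^ M) * (1 + |t|) ^ 2 := by gcongr
        _ = ‖mellin v (x + t * I)‖ * (1 + |t|) ^ (M + 2) * C' := by ring
        _ ≤ W * C' := by gcongr)
  simp only [Pi.mul_apply] at hshift
  push_cast at hshift
  rw [hshift, ← integral_mellin_mul_eq_zero_right hv hA P hl ha hgap]
  refine integral_congr_ae (Eventually.of_forall fun t => ?_)
  simp only [hright]

/-- The contribution of one frequency `M` to the dual side, for the oscillation of sign `s = ±1`,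
up to the factor `2πH`: a power of `-isM`, a phase, and the Fourier integral of the bump at
`H (sM - M₀)`. -/
noncomputable def wave (g : ℝ → ℂ) (θ : ℂ) (H M₀ u₀ M s : ℝ) : ℂ :=
  (-((s * M : ℝ) * I) : ℂ) ^ θ * (cexp ((s * M : ℝ) * u₀ * I) * fourierInt g (H * (s * M - M₀)))

lemma integral_mellin_packet_mul_Gamma {g : ℝ → ℂ} (hg : IsTest g (-1) 1) {H M₀ u₀ : ℝ} (hH : 0 < H)
    (hu₀ : H < u₀) (N : ℝ) {θ : ℂ} (hθ : 0 < θ.re) {M s : ℝ} (hM : 0 < M) (hs : s = 1 ∨ s = -1) :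
    ∫ t : ℝ, mellin (fun u => (u : ℂ) ^ (1 + N - θ) * packet g H M₀ u₀ u) (-N + t * I) *
      (Gamma (-(t * I) + θ) * (-((s * M : ℝ) * I) : ℂ) ^ (t * I : ℂ)) =
      2 * Real.pi * H * wave g θ H M₀ u₀ M s := by
  have hs0 : s ≠ 0 := by rcases hs with rfl | rfl <;> norm_num
  have hA : 0 < u₀ - H := by linarith
  have hq := isTest_packet hg hH M₀ u₀
  rw [integral_mellin_mul_Gamma (hq.cpow_mul hA _) hA N hθ (by simp) (by
    rw [mem_slitPlane_iff]
    right
    simp [hs0, hM.ne'])]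
  have hint : ∫ u : ℝ, cexp (-(-((s * M : ℝ) * I) * u)) *
      ((u : ℂ) ^ (θ - N - 1) * ((u : ℂ) ^ (1 + N - θ) * packet g H M₀ u₀ u)) =
      ∫ u : ℝ, cexp ((s * M : ℝ) * u * I) * packet g H M₀ u₀ u := by
    refine integral_congr_ae (Eventually.of_forall fun u => ?_)
    by_cases hu : u ∈ Set.Icc (u₀ - H) (u₀ + H)
    · have hu0 : u ≠ 0 := by linarith [hu.1]
      have huC : (u : ℂ) ≠ 0 := by exact_mod_cast hu0
      simp only
      rw [← mul_assoc ((u : ℂ) ^ _), ← cpow_add _ _ huC,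
        show θ - N - 1 + (1 + N - θ) = 0 by ring, cpow_zero, one_mul]
      congr 2
      ring
    · simp [hq.supp u hu]
  rw [hint, integral_exp_mul_packet g hH, wave]
  ring

/-- One term of the dual side: the two waves of the kernel, up to an error that tends to zero as
`u₀ → ∞`. -/
lemma norm_integral_sub_wave_le {g : ℝ → ℂ} (hg : IsTest g (-1) 1) {H M₀ u₀ : ℝ} (hH : 0 < H)
    (hu₀ : H < u₀) (N : ℝ) {θ : ℂ} (hθ : 3 / 2 ≤ θ.re) {K : ℝ → ℂ} (hK : Continuous K) {e₁ e₂ : ℂ}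
    {q C : ℝ} (hC : 0 < C)
    (hKC : ∀ t : ℝ, ‖K t - cexp (q * (t * I)) * Gamma (-(t * I) + θ) *
      (e₁ * cexp (Real.pi / 2 * t) + e₂ * cexp (-(Real.pi / 2 * t)))‖ ≤
        C * (1 + |t|) ^ (θ.re - 3 / 2))
    {C' y : ℝ} (hKb : ∀ t, ‖K t‖ ≤ C' * (1 + |t|) ^ y) {D : ℝ}
    (hD : ∀ F : ℝ → ℂ, (∀ t, ‖F t‖ ≤ ‖mellin (packet g H M₀ u₀) (1 - θ + t * I)‖ *
        (1 + |t|) ^ (θ.re - 3 / 2)) → ‖∫ t, F t‖ ≤ D)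
    {m M : ℝ} (hm : 0 < m) (hMm : M = m * Real.exp q) :
    ‖(∫ t : ℝ, mellin (fun u => (u : ℂ) ^ (1 + N - θ) * packet g H M₀ u₀ u) (-N + t * I) *
        (K t * (m : ℂ) ^ (t * I : ℂ))) -
      2 * Real.pi * H * (e₁ * wave g θ H M₀ u₀ M 1 + e₂ * wave g θ H M₀ u₀ M (-1))‖ ≤ C * D := by
  have hA : 0 < u₀ - H := by linarith
  have hM : 0 < M := by rw [hMm]; positivity
  have hθ0 : 0 < θ.re := by linarith
  have hmC : (m : ℂ) ≠ 0 := by exact_mod_cast hm.ne'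
  have hv := (isTest_packet hg hH M₀ u₀).cpow_mul hA (1 + N - θ)
  set v := fun u : ℝ => (u : ℂ) ^ (1 + N - θ) * packet g H M₀ u₀ u with hvdef
  have hVcast : ∀ t : ℝ, mellin v (-N + t * I) = mellin v (((-N : ℝ) : ℂ) + t * I) := fun t => by
    push_cast; rfl
  have hne : ∀ s : ℝ, s = 1 ∨ s = -1 → (-((s * M : ℝ) * I) : ℂ) ≠ 0 := by
    intro s hs
    have hs0 : s ≠ 0 := by rcases hs with rfl | rfl <;> norm_num
    simp [hs0, hM.ne']
  have hI : ∀ s : ℝ, s = 1 ∨ s = -1 → Integrable fun t : ℝ => mellin v (-N + t * I) *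
      (Gamma (-(t * I) + θ) * (-((s * M : ℝ) * I) : ℂ) ^ (t * I : ℂ)) := by
    intro s hs
    have h := integrable_mellin_mul_Gamma hv hA (-N) hθ0 (hne s hs) (by simp)
    simpa only [← hVcast] using h
  have hmI : Continuous fun t : ℝ => (m : ℂ) ^ (t * I : ℂ) :=
    Continuous.const_cpow (by fun_prop) (Or.inl hmC)
  have hmn : ∀ t : ℝ, ‖(m : ℂ) ^ (t * I : ℂ)‖ = 1 := by
    intro t
    rw [norm_cpow_eq_rpow_re_of_pos hm]
    simp
  have hI0 : Integrable fun t : ℝ => mellin v (-N + t * I) * (K t * (m : ℂ) ^ (t * I : ℂ)) := by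
    have h := hv.integrable_mellin_line hA (-N) (hK.mul hmI).aestronglyMeasurable
      (C := C') (y := y) (fun t => by
        rw [Pi.mul_apply, norm_mul, hmn, mul_one]
        exact hKb t)
    simpa only [← hVcast, Pi.mul_apply] using h
  have hwave : ∀ s : ℝ, s = 1 ∨ s = -1 → ∀ t : ℝ, (-((s * M : ℝ) * I) : ℂ) ^ (t * I : ℂ) =
      cexp (q * (t * I)) * (m : ℂ) ^ (t * I : ℂ) * cexp (s * (Real.pi / 2 * t)) := by
    intro s hs t
    rw [neg_mul_I_cpow hM hs, hMm, ofReal_mul, mul_cpow_ofReal_nonneg hm.le (Real.exp_pos _).le]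
    have e1 : ((Real.exp q : ℝ) : ℂ) ^ (t * I : ℂ) = cexp (q * (t * I)) := by
      rw [cpow_def_of_ne_zero (by exact_mod_cast (Real.exp_pos q).ne'), ← ofReal_log
        (Real.exp_pos q).le, Real.log_exp]
    have e2 : (-(s * (Real.pi / 2) * I * (t * I)) : ℂ) = s * (Real.pi / 2 * t) := by
      linear_combination (-(s * (Real.pi / 2) * t : ℂ)) * I_sq
    rw [e1, e2]
    ring
  have h1 := integral_mellin_packet_mul_Gamma hg (M₀ := M₀) hH hu₀ N hθ0 hM (Or.inl rfl)
  have h2 := integral_mellin_packet_mul_Gamma hg (M₀ := M₀) hH hu₀ N hθ0 hM (Or.inr rfl)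
  rw [← hvdef] at h1 h2
  -- the two waves are integrals against the same Mellin transform, so the difference is one
  -- integral against the error term of the kernel
  have hsplit : (∫ t : ℝ, mellin v (-N + t * I) * (K t * (m : ℂ) ^ (t * I : ℂ))) -
      2 * Real.pi * H * (e₁ * wave g θ H M₀ u₀ M 1 + e₂ * wave g θ H M₀ u₀ M (-1)) =
      ∫ t : ℝ, mellin v (-N + t * I) * (K t * (m : ℂ) ^ (t * I : ℂ)) -
        (e₁ * (mellin v (-N + t * I) *
          (Gamma (-(t * I) + θ) * (-(((1 : ℝ) * M : ℝ) * I) : ℂ) ^ (t * I : ℂ))) +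
        e₂ * (mellin v (-N + t * I) *
          (Gamma (-(t * I) + θ) * (-(((-1 : ℝ) * M : ℝ) * I) : ℂ) ^ (t * I : ℂ)))) := by
    have hadd : Integrable fun t : ℝ => e₁ * (mellin v (-N + t * I) *
          (Gamma (-(t * I) + θ) * (-(((1 : ℝ) * M : ℝ) * I) : ℂ) ^ (t * I : ℂ))) +
        e₂ * (mellin v (-N + t * I) *
          (Gamma (-(t * I) + θ) * (-(((-1 : ℝ) * M : ℝ) * I) : ℂ) ^ (t * I : ℂ))) :=
      ((hI 1 (Or.inl rfl)).const_mul e₁).add ((hI (-1) (Or.inr rfl)).const_mul e₂)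
    rw [integral_sub hI0 hadd,
      integral_add ((hI 1 (Or.inl rfl)).const_mul e₁) ((hI (-1) (Or.inr rfl)).const_mul e₂),
      integral_const_mul, integral_const_mul, h1, h2]
    ring
  rw [hsplit]
  set F : ℝ → ℂ := fun t => mellin v (-N + t * I) * (K t * (m : ℂ) ^ (t * I : ℂ)) -
        (e₁ * (mellin v (-N + t * I) *
          (Gamma (-(t * I) + θ) * (-(((1 : ℝ) * M : ℝ) * I) : ℂ) ^ (t * I : ℂ))) +
        e₂ * (mellin v (-N + t * I) *
          (Gamma (-(t * I) + θ) * (-(((-1 : ℝ) * M : ℝ) * I) : ℂ) ^ (t * I : ℂ)))) with hF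
  have hFb : ∀ t, ‖F t‖ ≤ C * (‖mellin (packet g H M₀ u₀) (1 - θ + t * I)‖ *
        (1 + |t|) ^ (θ.re - 3 / 2)) := by
    intro t
    have e : F t = mellin v (-N + t * I) * ((m : ℂ) ^ (t * I : ℂ) * (K t -
        cexp (q * (t * I)) * Gamma (-(t * I) + θ) *
      (e₁ * cexp (Real.pi / 2 * t) + e₂ * cexp (-(Real.pi / 2 * t))))) := by
      simp only [hF]
      rw [hwave 1 (Or.inl rfl), hwave (-1) (Or.inr rfl)]
      push_cast
      rw [one_mul, neg_one_mul]
      ring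
    have e2 : mellin v (-N + t * I) = mellin (packet g H M₀ u₀) (1 - θ + t * I) := by
      rw [hvdef, mellin_cpow_mul]
      congr 1
      ring
    rw [e, e2, norm_mul, norm_mul, hmn, one_mul]
    exact (mul_le_mul_of_nonneg_left (hKC t) (norm_nonneg _)).trans (le_of_eq (by ring))
  have hCF := hD (fun t => (C : ℂ)⁻¹ * F t) (fun t => by
    rw [norm_mul, norm_inv, norm_real, Real.norm_of_nonneg hC.le, inv_mul_le_iff₀ hC]
    exact hFb t)
  rw [integral_const_mul, norm_mul, norm_inv, norm_real, Real.norm_of_nonneg hC.le,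
    inv_mul_le_iff₀ hC] at hCF
  exact hCF

/-! ### Isolating the lowest frequency of the dual series -/

lemma exists_isTest_fourierInt_ne_zero : ∃ g : ℝ → ℂ, IsTest g (-1) 1 ∧ fourierInt g 0 ≠ 0 := by
  let f : ContDiffBump (0 : ℝ) := ⟨1 / 2, 1, by norm_num, by norm_num⟩
  refine ⟨fun u => (f u : ℂ), ⟨ofRealCLM.contDiff.comp f.contDiff, fun u hu => ?_⟩, ?_⟩
  · have : f u = 0 := by
      apply f.zero_of_le_dist
      rw [dist_zero_right, Real.norm_eq_abs]
      by_contra hcon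
      push Not at hcon
      have := abs_lt.mp hcon
      exact hu ⟨this.1.le, this.2.le⟩
    rw [this, ofReal_zero]
  · have h := f.integral_pos (μ := volume)
    have e : fourierInt (fun u => (f u : ℂ)) 0 = ((∫ u, f u : ℝ) : ℂ) := by
      simp only [fourierInt, ofReal_zero, zero_mul, Complex.exp_zero, one_mul]
      exact integral_ofReal
    rw [e]
    exact_mod_cast h.ne'

lemma norm_neg_mul_I_cpow {M s : ℝ} (hM : 0 < M) (hs : s = 1 ∨ s = -1) (θ : ℂ) :
    ‖(-((s * M : ℝ) * I) : ℂ) ^ θ‖ = M ^ θ.re * Real.exp (s * (Real.pi / 2) * θ.im) := by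
  rw [neg_mul_I_cpow hM hs, norm_mul, norm_cpow_eq_rpow_re_of_pos hM, norm_exp]
  congr 2
  have e : (-(s * (Real.pi / 2) * I * θ) : ℂ) = -(((s * (Real.pi / 2) : ℝ) : ℂ) * (I * θ)) := by
    push_cast; ring
  rw [e, neg_re, re_ofReal_mul]
  simp

lemma norm_wave {g : ℝ → ℂ} {θ : ℂ} {H M₀ u₀ M s : ℝ} (hM : 0 < M) (hs : s = 1 ∨ s = -1) :
    ‖wave g θ H M₀ u₀ M s‖ = M ^ θ.re * Real.exp (s * (Real.pi / 2) * θ.im) *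
      ‖fourierInt g (H * (s * M - M₀))‖ := by
  have e : ((s * M : ℝ) * u₀ * I : ℂ) = ((s * M * u₀ : ℝ) : ℂ) * I := by push_cast; ring
  rw [wave, norm_mul, norm_mul, norm_neg_mul_I_cpow hM hs, e, norm_exp_ofReal_mul_I, one_mul]

/-- Waves of frequency `sM` away from the frequency `M₀` of the packet are small, by a factor `1/H`,
uniformly in `M`. -/
lemma exists_norm_wave_le {g : ℝ → ℂ} (hg : IsTest g (-1) 1) {θ : ℂ} (hθ : 0 < θ.re)
    {M₀ κ : ℝ} (hM₀ : 0 < M₀) (hκ : 0 < κ) : ∃ D : ℝ, 0 ≤ D ∧ ∀ H u₀ M s : ℝ, 1 ≤ H → M₀ ≤ M →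
      s = 1 ∨ s = -1 → κ * M ≤ |s * M - M₀| → ‖wave g θ H M₀ u₀ M s‖ ≤ D / H := by
  set J := ⌈θ.re⌉₊ with hJ
  have hJ1 : 1 ≤ J := Nat.one_le_ceil_iff.mpr hθ
  obtain ⟨C, hC0, hC⟩ := exists_fourierInt_bound hg J
  refine ⟨Real.exp (Real.pi / 2 * |θ.im|) * C * κ⁻¹ ^ J * M₀ ^ (θ.re - J), by positivity,
    fun H u₀ M s hH hM hs hsep => ?_⟩
  have hMpos : 0 < M := by linarith
  have hHpos : 0 < H := by linarith
  rw [norm_wave hMpos hs]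
  have h1 : ‖fourierInt g (H * (s * M - M₀))‖ ≤ C / (H * (κ * M)) ^ J := by
    rw [le_div_iff₀ (by positivity), mul_comm]
    refine le_trans ?_ (hC (H * (s * M - M₀)))
    gcongr
    rw [abs_mul, abs_of_pos hHpos]
    gcongr
  have h2 : Real.exp (s * (Real.pi / 2) * θ.im) ≤ Real.exp (Real.pi / 2 * |θ.im|) := by
    rw [Real.exp_le_exp]
    have hpi := Real.pi_pos
    rcases hs with rfl | rfl
    · nlinarith [le_abs_self θ.im]
    · nlinarith [neg_le_abs θ.im]
  have h3 : M ^ (θ.re - J) ≤ M₀ ^ (θ.re - J) :=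
    Real.rpow_le_rpow_of_nonpos hM₀ hM (by linarith [Nat.le_ceil θ.re])
  have h4 : (H⁻¹) ^ J ≤ H⁻¹ := by
    have := pow_le_pow_of_le_one (inv_pos.mpr hHpos).le (inv_le_one_of_one_le₀ hH) hJ1
    simpa using this
  calc M ^ θ.re * Real.exp (s * (Real.pi / 2) * θ.im) * ‖fourierInt g (H * (s * M - M₀))‖
      ≤ M ^ θ.re * Real.exp (Real.pi / 2 * |θ.im|) * (C / (H * (κ * M)) ^ J) := by gcongr
    _ = Real.exp (Real.pi / 2 * |θ.im|) * C * κ⁻¹ ^ J * M ^ (θ.re - J) * (H⁻¹) ^ J := by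
        rw [Real.rpow_sub hMpos, Real.rpow_natCast, mul_pow, mul_pow, inv_pow, inv_pow]
        field_simp
    _ ≤ Real.exp (Real.pi / 2 * |θ.im|) * C * κ⁻¹ ^ J * M₀ ^ (θ.re - J) * H⁻¹ := by gcongr
    _ = _ := (div_eq_mul_inv _ _).symm

/-- The kernel is of polynomial growth. -/
lemma exists_norm_kernel_le {θ : ℂ} (hθ : 0 < θ.re) {K : ℝ → ℂ} {e₁ e₂ : ℂ} {q C : ℝ} (hC : 0 < C)
    (hKC : ∀ t : ℝ, ‖K t - cexp (q * (t * I)) * Gamma (-(t * I) + θ) *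
      (e₁ * cexp (Real.pi / 2 * t) + e₂ * cexp (-(Real.pi / 2 * t)))‖ ≤
        C * (1 + |t|) ^ (θ.re - 3 / 2)) :
    ∃ C' : ℝ, ∀ t, ‖K t‖ ≤ C' * (1 + |t|) ^ (θ.re - 1 / 2) := by
  obtain ⟨G, hG0, hG⟩ := exists_norm_Gamma_line_le hθ
  refine ⟨C + (‖e₁‖ + ‖e₂‖) * G, fun t => ?_⟩
  have hbase : 1 ≤ 1 + |t| := by linarith [abs_nonneg t]
  have h1 : ‖cexp (q * (t * I)) * Gamma (-(t * I) + θ) *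
      (e₁ * cexp (Real.pi / 2 * t) + e₂ * cexp (-(Real.pi / 2 * t)))‖ ≤
      (‖e₁‖ + ‖e₂‖) * G * (1 + |t|) ^ (θ.re - 1 / 2) := by
    have e1 : (q * (t * I) : ℂ) = ((q * t : ℝ) : ℂ) * I := by push_cast; ring
    have hexp : ∀ x : ℝ, x ≤ Real.pi / 2 * |t| → ‖cexp (x : ℂ)‖ ≤ Real.exp (Real.pi / 2 * |t|) := by
      intro x hx
      rw [norm_exp, ofReal_re, Real.exp_le_exp]
      exact hx
    have hpi := Real.pi_pos
    have h2 := hexp (Real.pi / 2 * t) (by gcongr; exact le_abs_self t)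
    have h3 := hexp (-(Real.pi / 2 * t)) (by nlinarith [neg_le_abs t])
    push_cast at h2 h3
    rw [norm_mul, norm_mul, e1, norm_exp_ofReal_mul_I, one_mul]
    calc ‖Gamma (-(t * I) + θ)‖ * ‖e₁ * cexp (Real.pi / 2 * t) + e₂ * cexp (-(Real.pi / 2 * t))‖
        ≤ ‖Gamma (-(t * I) + θ)‖ * (‖e₁‖ * Real.exp (Real.pi / 2 * |t|) +
            ‖e₂‖ * Real.exp (Real.pi / 2 * |t|)) := by
          gcongr
          refine (norm_add_le _ _).trans ?_
          rw [norm_mul, norm_mul]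
          gcongr
      _ = (‖e₁‖ + ‖e₂‖) * (‖Gamma (-(t * I) + θ)‖ * Real.exp (Real.pi / 2 * |t|)) := by ring
      _ ≤ (‖e₁‖ + ‖e₂‖) * (G * (1 + |t|) ^ (θ.re - 1 / 2)) :=
          mul_le_mul_of_nonneg_left (hG t) (by positivity)
      _ = _ := by ring
  have h4 : (1 + |t|) ^ (θ.re - 3 / 2) ≤ (1 + |t|) ^ (θ.re - 1 / 2) :=
    Real.rpow_le_rpow_of_exponent_le hbase (by linarith)
  have h5 := norm_add_le (K t - cexp (q * (t * I)) * Gamma (-(t * I) + θ) *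
      (e₁ * cexp (Real.pi / 2 * t) + e₂ * cexp (-(Real.pi / 2 * t))))
      (cexp (q * (t * I)) * Gamma (-(t * I) + θ) *
      (e₁ * cexp (Real.pi / 2 * t) + e₂ * cexp (-(Real.pi / 2 * t))))
  rw [sub_add_cancel] at h5
  calc ‖K t‖ ≤ C * (1 + |t|) ^ (θ.re - 3 / 2) +
        (‖e₁‖ + ‖e₂‖) * G * (1 + |t|) ^ (θ.re - 1 / 2) := h5.trans (add_le_add (hKC t) h1)
    _ ≤ C * (1 + |t|) ^ (θ.re - 1 / 2) +
        (‖e₁‖ + ‖e₂‖) * G * (1 + |t|) ^ (θ.re - 1 / 2) := by gcongr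
    _ = _ := by ring

/-- If an entire function is a Dirichlet series with frequencies `l n` (times a polynomial) on a
line to the right, and on a line to the left the product of the kernel `K` with a Dirichlet series
of frequencies `m n`, then the `l n` meet every interval of a fixed length far enough out.
Otherwise the wave packet of frequency `-m 0` supported in such an interval, stretched by a large
`H`, would detect the first term `b 0` of the dual series, while its pairing is zero. -/
theorem exists_frequency_near {P : Polynomial ℂ} {N c : ℝ} (hNc : -N < c) {a b : ℕ → ℂ}
    {l m : ℕ → ℝ} (hl : ∀ n, 0 < l n) (hm : ∀ n, 0 < m n) (hmono : StrictMono m) (hb0 : b 0 ≠ 0)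
    (ha : Summable fun n => ‖a n‖ * l n ^ (-c)) (hb : Summable fun n => ‖b n‖ * m n ^ (-N))
    {E : ℂ → ℂ} (hE : Differentiable ℂ E) {G ρ T : ℝ}
    (hgrow : ∀ z : ℂ, -N ≤ z.re → z.re ≤ c → T ≤ |z.im| → ‖E z‖ ≤ Real.exp (G * (1 + |z.im|) ^ ρ))
    (hright : ∀ t : ℝ, E (c + t * I) =
      P.eval (c + t * I) * ∑' n, a n * (l n : ℂ) ^ (-(c + t * I) : ℂ))
    {K : ℝ → ℂ} (hK : Continuous K)
    (hleft : ∀ t : ℝ, E (-N + t * I) = K t * ∑' n, b n * (m n : ℂ) ^ (-N + t * I : ℂ))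
    {θ : ℂ} (hθ : 3 / 2 ≤ θ.re) {e₁ e₂ : ℂ} (he₁ : e₁ ≠ 0) {q C : ℝ} (hC : 0 < C)
    (hKC : ∀ t : ℝ, ‖K t - cexp (q * (t * I)) * Gamma (-(t * I) + θ) *
      (e₁ * cexp (Real.pi / 2 * t) + e₂ * cexp (-(Real.pi / 2 * t)))‖ ≤
        C * (1 + |t|) ^ (θ.re - 3 / 2)) :
    ∃ H : ℝ, 0 < H ∧ ∃ U : ℝ, ∀ u₀, U ≤ u₀ → ∃ n, |l n - u₀| ≤ H := by
  have hθ0 : 0 < θ.re := by linarith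
  obtain ⟨g, hg, hg0⟩ := exists_isTest_fourierInt_ne_zero
  obtain ⟨C', hKb⟩ := exists_norm_kernel_le hθ0 hC hKC
  set M : ℕ → ℝ := fun n => m n * Real.exp q with hM
  have hMpos : ∀ n, 0 < M n := fun n => mul_pos (hm n) (Real.exp_pos _)
  have hMmono : StrictMono M := fun i j hij => mul_lt_mul_of_pos_right (hmono hij) (Real.exp_pos _)
  -- relative distance from the frequency `M 0` of the packet to all other frequencies `±M n`
  set κ : ℝ := 1 - M 0 / M 1 with hκ
  have h01 : M 0 / M 1 < 1 := by rw [div_lt_one (hMpos 1)]; exact hMmono Nat.zero_lt_one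
  have hκ0 : 0 < κ := by rw [hκ]; linarith
  have hκ1 : κ ≤ 1 := by
    rw [hκ]
    linarith [div_nonneg (hMpos 0).le (hMpos 1).le]
  obtain ⟨D, hD0, hD⟩ := exists_norm_wave_le hg hθ0 (hMpos 0) hκ0
  have hsepneg : ∀ n, κ * M n ≤ |(-1) * M n - M 0| := by
    intro n
    rw [abs_of_nonpos (by linarith [hMpos n, hMpos 0])]
    nlinarith [hMpos n, hMpos 0]
  have hseppos : ∀ n, n ≠ 0 → κ * M n ≤ |1 * M n - M 0| := by
    intro n hn
    have h1 : M 1 ≤ M n := hMmono.monotone (Nat.one_le_iff_ne_zero.mpr hn)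
    have h2 : M 0 ≤ M 0 / M 1 * M n := by
      rw [div_mul_eq_mul_div, le_div_iff₀ (hMpos 1)]
      exact mul_le_mul_of_nonneg_left h1 (hMpos 0).le
    refine le_trans ?_ (le_abs_self _)
    rw [hκ]
    linarith
  have hM0 : ∀ n, M 0 ≤ M n := fun n => hMmono.monotone (Nat.zero_le n)
  set S := ∑' n, ‖b n‖ * m n ^ (-N) with hS
  have hS0 : 0 ≤ S := tsum_nonneg fun n => mul_nonneg (norm_nonneg _) (Real.rpow_nonneg (hm n).le _)
  -- the size of the dominant wave, per unit of `H`
  set μ : ℝ := ‖b 0‖ * m 0 ^ (-N) * (2 * Real.pi * (‖e₁‖ *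
    (M 0 ^ θ.re * Real.exp (1 * (Real.pi / 2) * θ.im) * ‖fourierInt g 0‖))) with hμ
  have hμ0 : 0 < μ := by
    have h1 := norm_pos_iff.mpr hb0
    have h2 := norm_pos_iff.mpr he₁
    have h3 := norm_pos_iff.mpr hg0
    have h4 := Real.rpow_pos_of_pos (hm 0) (-N)
    have h5 := Real.rpow_pos_of_pos (hMpos 0) θ.re
    have := Real.pi_pos
    positivity
  -- the dominant wave, of size `μ H`, must exceed all others and the error terms together
  set H : ℝ := max 1 ((S * (2 * Real.pi * ((‖e₁‖ + ‖e₂‖) * D)) + S + 1) / μ) with hH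
  have hH1 : 1 ≤ H := le_max_left _ _
  have hHpos : 0 < H := by linarith
  have hHμ : S * (2 * Real.pi * ((‖e₁‖ + ‖e₂‖) * D)) + S + 1 ≤ μ * H := by
    rw [mul_comm μ H, ← div_le_iff₀ hμ0]
    exact le_max_right _ _
  obtain ⟨W, hW0, hW⟩ := exists_integral_mellin_packet_le hg hHpos (M 0) hθ
  have hlim : Tendsto (fun u : ℝ => C * (W * u ^ (-(1 / 2) : ℝ))) atTop (𝓝 0) := by
    have h := (tendsto_rpow_neg_atTop (y := (1 / 2 : ℝ)) (by norm_num)).const_mul W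
    simpa using h.const_mul C
  obtain ⟨U, hU⟩ := eventually_atTop.mp (hlim.eventually_le_const one_pos)
  refine ⟨H, hHpos, max U (2 * H), fun u₀ hu₀ => ?_⟩
  by_contra hcon
  push Not at hcon
  have hu2 : 2 * H ≤ u₀ := (le_max_right _ _).trans hu₀
  have hu1 : 1 ≤ u₀ := by linarith
  have hHu : H < u₀ := by linarith
  have hA : 0 < u₀ - H := by linarith
  have hW1 := hU u₀ ((le_max_left _ _).trans hu₀)
  have hv := (isTest_packet hg hHpos (M 0) u₀).cpow_mul hA (1 + N - θ)
  -- the power of `u` compensates the one in `integral_mellin_mul_Gamma`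
  set v := fun u : ℝ => (u : ℂ) ^ (1 + N - θ) * packet g H (M 0) u₀ u with hvdef
  have hgap : ∀ n, l n ∉ Set.Icc (u₀ - H) (u₀ + H) := by
    intro n hn
    have := hcon n
    rw [lt_abs] at this
    rcases this with h | h
    · linarith [hn.2]
    · linarith [hn.1]
  have hEb : ∀ t : ℝ, ‖E (-N + t * I)‖ ≤ (C' * S) * (1 + |t|) ^ (θ.re - 1 / 2) := by
    intro t
    have h1 := norm_tsum_cpow_line_le hm hb t
    push_cast at h1
    have h2 := (norm_nonneg _).trans (hKb t)
    rw [hleft, norm_mul]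
    calc ‖K t‖ * ‖∑' n, b n * (m n : ℂ) ^ (-N + t * I : ℂ)‖
        ≤ (C' * (1 + |t|) ^ (θ.re - 1 / 2)) * S := mul_le_mul (hKb t) h1 (norm_nonneg _) h2
      _ = _ := by ring
  have hzero := integral_mellin_mul_eq_zero_left hv hA P hNc hl ha hgap hE hgrow hright hEb
  have hsum := hasSum_integral_mellin_mul hv hA hm hb (-N) hK hKb
  push_cast at hsum
  simp only [← hleft] at hsum
  rw [hzero] at hsum
  set wv : ℕ → ℂ := fun n => 2 * Real.pi * H *
    (e₁ * wave g θ H (M 0) u₀ (M n) 1 + e₂ * wave g θ H (M 0) u₀ (M n) (-1)) with hwv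
  set β : ℕ → ℂ := fun n => b n * ((m n ^ (-N) : ℝ) : ℂ) with hβ
  have hβn : ∀ n, ‖β n‖ = ‖b n‖ * m n ^ (-N) := by
    intro n
    rw [hβ]
    simp only
    rw [norm_mul, norm_real, Real.norm_of_nonneg (Real.rpow_nonneg (hm n).le _)]
  set Φ : ℕ → ℂ := fun n => ∫ t : ℝ, mellin v (-N + t * I) * (K t * (m n : ℂ) ^ (t * I : ℂ)) with hΦ
  have hterm : ∀ n, ∫ t : ℝ, mellin v (-N + t * I) * (K t * (b n * (m n : ℂ) ^ (-N + t * I : ℂ))) =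
      β n * Φ n := by
    intro n
    rw [hΦ]
    simp only
    rw [← integral_const_mul]
    refine integral_congr_ae (Eventually.of_forall fun t => ?_)
    have hmC : (m n : ℂ) ≠ 0 := by exact_mod_cast (hm n).ne'
    simp only [hβ]
    rw [cpow_add _ _ hmC, ofReal_cpow (hm n).le]
    push_cast
    ring
  simp only [hterm] at hsum
  have hΦb : ∀ n, ‖Φ n - wv n‖ ≤ 1 := fun n =>
    (norm_integral_sub_wave_le hg hHpos hHu N hθ hK hC hKC hKb (hW u₀ hu2 hu1) (hm n) rfl).trans hW1
  have hneg : ∀ n, ‖wave g θ H (M 0) u₀ (M n) (-1)‖ ≤ D / H := fun n =>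
    hD H u₀ (M n) (-1) hH1 (hM0 n) (Or.inr rfl) (hsepneg n)
  have hpos : ∀ n, n ≠ 0 → ‖wave g θ H (M 0) u₀ (M n) 1‖ ≤ D / H := fun n hn =>
    hD H u₀ (M n) 1 hH1 (hM0 n) (Or.inl rfl) (hseppos n hn)
  set main : ℂ := β 0 * (2 * Real.pi * H * (e₁ * wave g θ H (M 0) u₀ (M 0) 1)) with hmain
  have hpiH : ‖(2 * Real.pi * H : ℂ)‖ = 2 * Real.pi * H := by
    have e : (2 * Real.pi * H : ℂ) = ((2 * Real.pi * H : ℝ) : ℂ) := by push_cast; ring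
    rw [e, norm_real, Real.norm_of_nonneg (by positivity)]
  have hmainnorm : ‖main‖ = μ * H := by
    have e0 : H * (1 * M 0 - M 0) = 0 := by ring
    rw [hmain, norm_mul, hβn, norm_mul, norm_mul e₁, norm_wave (hMpos 0) (Or.inl rfl), e0, hpiH, hμ]
    ring
  set δ : ℝ := 2 * Real.pi * ((‖e₁‖ + ‖e₂‖) * D) + 1 with hδ
  have hsub := hsum.sub (hasSum_ite_eq 0 main)
  rw [zero_sub] at hsub
  have hbound : ∀ n, ‖β n * Φ n - (if n = 0 then main else 0)‖ ≤ ‖b n‖ * m n ^ (-N) * δ := by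
    intro n
    have hD' : 2 * Real.pi * H * (‖e₁‖ * (D / H) + ‖e₂‖ * (D / H)) =
        2 * Real.pi * ((‖e₁‖ + ‖e₂‖) * D) := by
      field_simp
    have hkey : ∀ w : ℂ, ‖wv n - w‖ ≤ 2 * Real.pi * H * (‖e₁‖ * (D / H) + ‖e₂‖ * (D / H)) →
        ‖β n * Φ n - β n * w‖ ≤ ‖b n‖ * m n ^ (-N) * δ := by
      intro w hw
      rw [← mul_sub, norm_mul, hβn]
      have hbn : 0 ≤ ‖b n‖ * m n ^ (-N) :=
        mul_nonneg (norm_nonneg _) (Real.rpow_nonneg (hm n).le _)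
      refine mul_le_mul_of_nonneg_left ?_ hbn
      have h1 : Φ n - w = (Φ n - wv n) + (wv n - w) := by ring
      rw [h1, hδ, ← hD']
      refine (norm_add_le _ _).trans ?_
      linarith [hΦb n]
    have hDH : 0 ≤ D / H := by positivity
    by_cases hn : n = 0
    · rw [if_pos hn, hmain]
      subst hn
      refine hkey _ ?_
      have e : wv 0 - 2 * Real.pi * H * (e₁ * wave g θ H (M 0) u₀ (M 0) 1) =
          2 * Real.pi * H * (e₂ * wave g θ H (M 0) u₀ (M 0) (-1)) := by
        rw [hwv]
        ring
      rw [e, norm_mul, hpiH, norm_mul]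
      gcongr
      have h1 : ‖e₂‖ * ‖wave g θ H (M 0) u₀ (M 0) (-1)‖ ≤ ‖e₂‖ * (D / H) := by
        gcongr
        exact hneg 0
      have h2 : 0 ≤ ‖e₁‖ * (D / H) := by positivity
      linarith
    · rw [if_neg hn]
      have h := hkey 0 (by
        rw [sub_zero, hwv]
        simp only
        rw [norm_mul, hpiH]
        gcongr
        refine (norm_add_le _ _).trans ?_
        rw [norm_mul, norm_mul]
        gcongr
        · exact hpos n hn
        · exact hneg n)
      rwa [mul_zero] at h
  have hfinal := tsum_of_norm_bounded (hb.hasSum.mul_right δ) hbound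
  rw [hsub.tsum_eq, norm_neg, hmainnorm] at hfinal
  have : S * δ = S * (2 * Real.pi * ((‖e₁‖ + ‖e₂‖) * D)) + S := by rw [hδ]; ring
  linarith

end

/-! ### Growth in vertical strips -/

/-- In every vertical strip, `f` grows at most like the exponential of a power of `|Im s|`. -/
def HasStripGrowth (f : ℂ → ℂ) : Prop :=
  ∀ x y : ℝ, ∃ G ρ T : ℝ, 0 ≤ G ∧ 0 ≤ ρ ∧ ∀ s : ℂ, x ≤ s.re → s.re ≤ y → T ≤ |s.im| →
    ‖f s‖ ≤ Real.exp (G * (1 + |s.im|) ^ ρ)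

lemma HasStripGrowth.mul {f g : ℂ → ℂ} (hf : HasStripGrowth f) (hg : HasStripGrowth g) :
    HasStripGrowth fun s => f s * g s := by
  intro x y
  obtain ⟨G, ρ, T, hG, hρ, h⟩ := hf x y
  obtain ⟨G', ρ', T', hG', hρ', h'⟩ := hg x y
  refine ⟨G + G', max ρ ρ', max T T', by positivity, hρ.trans (le_max_left _ _),
    fun s hx hy hT => ?_⟩
  have h1 := h s hx hy ((le_max_left _ _).trans hT)
  have h2 := h' s hx hy ((le_max_right _ _).trans hT)
  have hb : 1 ≤ 1 + |s.im| := by linarith [abs_nonneg s.im]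
  have h3 : (1 + |s.im|) ^ ρ ≤ (1 + |s.im|) ^ max ρ ρ' :=
    Real.rpow_le_rpow_of_exponent_le hb (le_max_left _ _)
  have h4 : (1 + |s.im|) ^ ρ' ≤ (1 + |s.im|) ^ max ρ ρ' :=
    Real.rpow_le_rpow_of_exponent_le hb (le_max_right _ _)
  rw [norm_mul]
  refine (mul_le_mul h1 h2 (norm_nonneg _) (Real.exp_pos _).le).trans ?_
  rw [← Real.exp_add, Real.exp_le_exp, add_mul]
  gcongr

lemma HasStripGrowth.congr {f g : ℂ → ℂ} (hf : HasStripGrowth f) {T : ℝ}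
    (h : ∀ s : ℂ, T ≤ |s.im| → g s = f s) : HasStripGrowth g := by
  intro x y
  obtain ⟨G, ρ, T', hG, hρ, h'⟩ := hf x y
  refine ⟨G, ρ, max T T', hG, hρ, fun s hx hy hT => ?_⟩
  rw [h s ((le_max_left _ _).trans hT)]
  exact h' s hx hy ((le_max_right _ _).trans hT)

lemma hasStripGrowth_const (c : ℂ) : HasStripGrowth fun _ => c := by
  intro x y
  refine ⟨‖c‖, 0, 0, norm_nonneg _, le_rfl, fun s _ _ _ => ?_⟩
  rw [Real.rpow_zero, mul_one]
  linarith [Real.add_one_le_exp ‖c‖]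

lemma HasStripGrowth.prod {ι : Type*} (S : Finset ι) {f : ι → ℂ → ℂ}
    (hf : ∀ i ∈ S, HasStripGrowth (f i)) : HasStripGrowth fun s => ∏ i ∈ S, f i s := by
  classical
  induction S using Finset.induction_on with
  | empty => simpa using hasStripGrowth_const 1
  | insert i S hi ih =>
    simp only [Finset.prod_insert hi]
    exact (hf i (Finset.mem_insert_self i S)).mul
      (ih fun j hj => hf j (Finset.mem_insert_of_mem hj))

lemma norm_le_mul_one_add_abs_im {x y : ℝ} {s : ℂ} (hx : x ≤ s.re) (hy : s.re ≤ y) :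
    ‖s‖ ≤ (1 + |x| + |y|) * (1 + |s.im|) := by
  have h1 := norm_le_abs_re_add_abs_im s
  have h2 : |s.re| ≤ |x| + |y| := by
    rw [abs_le]
    constructor
    · linarith [neg_abs_le x, abs_nonneg y]
    · linarith [le_abs_self y, abs_nonneg x]
  nlinarith [abs_nonneg x, abs_nonneg y, abs_nonneg s.im]

/-- Functions of finite order have moderate growth in vertical strips. -/
lemma hasStripGrowth_of_finite_order {f : ℂ → ℂ} {C ρ : ℝ}
    (h : ∀ s, ‖f s‖ ≤ C * Real.exp (‖s‖ ^ ρ)) : HasStripGrowth f := by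
  intro x y
  set L := 1 + |x| + |y| with hL
  have hL1 : 1 ≤ L := by linarith [abs_nonneg x, abs_nonneg y]
  refine ⟨|C| + L ^ |ρ|, |ρ|, 1, by positivity, abs_nonneg _, fun s hx hy hT => ?_⟩
  have hs : ‖s‖ ≤ L * (1 + |s.im|) := norm_le_mul_one_add_abs_im hx hy
  have hs1 : 1 ≤ ‖s‖ := hT.trans (abs_im_le_norm s)
  have hb : 1 ≤ 1 + |s.im| := by linarith [abs_nonneg s.im]
  have h1 : ‖s‖ ^ ρ ≤ L ^ |ρ| * (1 + |s.im|) ^ |ρ| := by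
    rw [← Real.mul_rpow (by positivity) (by positivity)]
    exact (Real.rpow_le_rpow_of_exponent_le hs1 (le_abs_self ρ)).trans
      (Real.rpow_le_rpow (norm_nonneg _) hs (abs_nonneg _))
  have h2 : 1 ≤ (1 + |s.im|) ^ |ρ| := Real.one_le_rpow hb (abs_nonneg _)
  have h3 : C ≤ Real.exp (|C| * (1 + |s.im|) ^ |ρ|) := by
    refine (le_abs_self C).trans ?_
    have := Real.add_one_le_exp (|C| * (1 + |s.im|) ^ |ρ|)
    nlinarith [abs_nonneg C]
  refine (h s).trans ?_
  rw [add_mul, Real.exp_add]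
  gcongr

lemma hasStripGrowth_polynomial (P : Polynomial ℂ) : HasStripGrowth fun s => P.eval s := by
  refine hasStripGrowth_of_finite_order (ρ := 1)
    (C := ∑ i ∈ Finset.range (P.natDegree + 1), ‖P.coeff i‖ * i.factorial) fun s => ?_
  rw [Polynomial.eval_eq_sum_range, Finset.sum_mul, Real.rpow_one]
  refine norm_sum_le_of_le _ fun i _ => ?_
  rw [norm_mul, norm_pow, mul_assoc]
  gcongr
  have h := Real.pow_div_factorial_le_exp ‖s‖ (norm_nonneg s) i
  rwa [div_le_iff₀ (by positivity), mul_comm] at h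

lemma norm_Gamma_le_Gamma_re {z : ℂ} (hz : 0 < z.re) : ‖Gamma z‖ ≤ Real.Gamma z.re := by
  rw [Gamma_eq_integral hz, GammaIntegral, Real.Gamma_eq_integral hz]
  refine (norm_integral_le_integral_norm _).trans (le_of_eq ?_)
  refine setIntegral_congr_fun measurableSet_Ioi fun x hx => ?_
  simp only [norm_mul, norm_real, Real.norm_of_nonneg (Real.exp_pos _).le]
  rw [norm_cpow_eq_rpow_re_of_pos hx, sub_re, one_re]

lemma norm_sin_le_exp (z : ℂ) : ‖Complex.sin z‖ ≤ Real.exp |z.im| := by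
  rw [Complex.sin, norm_div, norm_mul, norm_I, mul_one]
  have h1 : ‖cexp (-z * I)‖ ≤ Real.exp |z.im| := by
    rw [norm_exp, Real.exp_le_exp]
    simpa using le_abs_self z.im
  have h2 : ‖cexp (z * I)‖ ≤ Real.exp |z.im| := by
    rw [norm_exp, Real.exp_le_exp]
    simpa using neg_le_abs z.im
  have h3 := norm_sub_le (cexp (-z * I)) (cexp (z * I))
  have h4 : ‖(2 : ℂ)‖ = 2 := by simp
  rw [h4, div_le_iff₀ two_pos]
  linarith

lemma norm_Gamma_add_one_inv_le {z : ℂ} (hz : 1 ≤ |z.im|) :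
    ‖(Gamma (z + 1))⁻¹‖ ≤ ‖(Gamma z)⁻¹‖ := by
  have h1 : 1 ≤ ‖z‖ := hz.trans (abs_im_le_norm z)
  have h0 : z ≠ 0 := norm_pos_iff.mp (by linarith)
  rw [Gamma_add_one z h0, mul_inv, norm_mul, norm_inv z]
  exact mul_le_of_le_one_left (norm_nonneg _) (inv_le_one_of_one_le₀ h1)

lemma norm_Gamma_add_nat_inv_le {z : ℂ} (hz : 1 ≤ |z.im|) (n : ℕ) :
    ‖(Gamma (z + n))⁻¹‖ ≤ ‖(Gamma z)⁻¹‖ := by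
  induction n with
  | zero => simp
  | succ n ih =>
    refine le_trans ?_ ih
    have := norm_Gamma_add_one_inv_le (z := z + n) (by simpa using hz)
    simpa [add_assoc] using this

lemma hasStripGrowth_Gamma_inv : HasStripGrowth fun s => (Gamma s)⁻¹ := by
  intro x y
  -- shifting by `m` moves the strip to `Re ≤ 0`, where the reflection formula gives the bound
  set m := ⌈|y|⌉₊ with hm
  have hmy : y ≤ m := (le_abs_self y).trans (Nat.le_ceil _)
  have hcont : ContinuousOn Real.Gamma (Set.Icc 1 (1 + m + |x|)) := fun r hr =>
    (Real.differentiableAt_Gamma fun n => by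
      have : (0 : ℝ) ≤ n := Nat.cast_nonneg n
      have := hr.1
      intro h
      linarith).continuousAt.continuousWithinAt
  obtain ⟨B, hB⟩ := isCompact_Icc.exists_bound_of_continuousOn hcont
  have hpi := Real.pi_pos
  refine ⟨|B| + Real.pi, 1, 1, by positivity, zero_le_one, fun s hx hy hT => ?_⟩
  set w := s - m with hw
  have hwim : w.im = s.im := by simp [hw]
  have hwre : w.re = s.re - m := by simp [hw]
  have h1 : ‖(Gamma s)⁻¹‖ ≤ ‖(Gamma w)⁻¹‖ := by
    have := norm_Gamma_add_nat_inv_le (z := w) (by rwa [hwim]) m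
    rwa [hw, sub_add_cancel] at this
  have hre : (1 - w).re = 1 - s.re + m := by rw [sub_re, hwre, one_re]; ring
  have hpos : 0 < (1 - w).re := by rw [hre]; linarith
  have h2 : ‖Gamma (1 - w)‖ ≤ |B| := by
    refine (norm_Gamma_le_Gamma_re hpos).trans (((Real.le_norm_self _).trans (hB _ ?_)).trans
      (le_abs_self B))
    rw [hre]
    constructor
    · linarith
    · linarith [neg_abs_le x]
  have h3 : ‖Complex.sin (Real.pi * w) / Real.pi‖ ≤ Real.exp (Real.pi * |s.im|) := by
    have := norm_sin_le_exp (Real.pi * w)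
    rw [im_ofReal_mul, hwim, abs_mul, abs_of_pos hpi] at this
    rw [norm_div, norm_real, Real.norm_of_nonneg hpi.le]
    exact (div_le_self (norm_nonneg _) (by linarith [Real.pi_gt_three])).trans this
  refine h1.trans ?_
  rw [Gamma_inv_eq_mul_sin hpos, norm_mul, Real.rpow_one, add_mul, Real.exp_add]
  refine mul_le_mul (h2.trans ?_) (h3.trans ?_) (norm_nonneg _) (Real.exp_pos _).le
  · have := Real.add_one_le_exp (|B| * (1 + |s.im|))
    nlinarith [abs_nonneg B, abs_nonneg s.im, mul_nonneg (abs_nonneg B) (abs_nonneg s.im)]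
  · rw [Real.exp_le_exp]
    nlinarith

lemma HasStripGrowth.comp_mul_add {f : ℂ → ℂ} (hf : HasStripGrowth f) {r : ℝ} (hr : 0 < r) (β : ℂ) :
    HasStripGrowth fun s => f (r * s + β) := by
  intro x y
  obtain ⟨G, ρ, T, hG, hρ, h⟩ := hf (r * x + β.re) (r * y + β.re)
  refine ⟨G * (1 + r + |β.im|) ^ ρ, ρ, (|T| + |β.im|) / r, by positivity, hρ,
    fun s hx hy hT => ?_⟩
  have hre : (r * s + β).re = r * s.re + β.re := by rw [add_re, re_ofReal_mul]
  have him : (r * s + β).im = r * s.im + β.im := by rw [add_im, im_ofReal_mul]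
  have habs : |r * s.im| = r * |s.im| := by rw [abs_mul, abs_of_pos hr]
  rw [div_le_iff₀ hr] at hT
  refine (h _ (by rw [hre]; gcongr) (by rw [hre]; gcongr) ?_).trans ?_
  · rw [him]
    have := abs_sub_abs_le_abs_sub (r * s.im) (-β.im)
    rw [sub_neg_eq_add, abs_neg, habs] at this
    linarith [le_abs_self T]
  · rw [Real.exp_le_exp, mul_assoc, ← Real.mul_rpow (by positivity) (by positivity)]
    gcongr
    rw [him]
    have := abs_add_le (r * s.im) β.im
    rw [habs] at this
    nlinarith [abs_nonneg s.im, abs_nonneg β.im, mul_nonneg (abs_nonneg s.im) (abs_nonneg β.im)]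

/-! ### Gamma factors -/

section

variable {d : ℕ}

lemma hasStripGrowth_gammaFactor_inv {α : Fin d → ℝ} (hα : ∀ ν, 0 < α ν) (β : Fin d → ℂ) :
    HasStripGrowth fun s => (gammaFactor α β s)⁻¹ := by
  simp only [gammaFactor, ← Finset.prod_inv_distrib]
  exact HasStripGrowth.prod _ fun ν _ => hasStripGrowth_Gamma_inv.comp_mul_add (hα ν) (β ν)

lemma differentiable_gammaFactor_inv (α : Fin d → ℝ) (β : Fin d → ℂ) :
    Differentiable ℂ fun s => (gammaFactor α β s)⁻¹ := by
  simp only [gammaFactor, ← Finset.prod_inv_distrib]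
  refine Differentiable.fun_finsetProd fun ν _ => ?_
  exact differentiable_one_div_Gamma.comp ((differentiable_id.const_mul _).add_const _)

lemma gammaFactor_ne_zero_of_re_pos {α : Fin d → ℝ} {β : Fin d → ℂ} {s : ℂ}
    (h : ∀ ν, 0 < (α ν * s + β ν).re) : gammaFactor α β s ≠ 0 :=
  Finset.prod_ne_zero_iff.mpr fun ν _ => Gamma_ne_zero_of_re_pos (h ν)

lemma eventually_forall_re_pos {α : Fin d → ℝ} (hα : ∀ ν, 0 < α ν) (β : Fin d → ℂ) :
    ∀ᶠ x : ℝ in atTop, ∀ ν, 0 < α ν * x + (β ν).re := by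
  rw [eventually_all]
  intro ν
  exact (tendsto_atTop_add_const_right _ _ (tendsto_id.const_mul_atTop (hα ν))).eventually_gt_atTop 0

/-- Reciprocals of gamma factors are entire and not identically zero. -/
lemma eventually_gammaFactor_ne_zero {α : Fin d → ℝ} (hα : ∀ ν, 0 < α ν) (β : Fin d → ℂ) (s : ℂ) :
    ∀ᶠ z in 𝓝[≠] s, gammaFactor α β z ≠ 0 := by
  have han : AnalyticOnNhd ℂ (fun s => (gammaFactor α β s)⁻¹) Set.univ :=
    analyticOnNhd_univ_iff_differentiable.mpr (differentiable_gammaFactor_inv α β)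
  by_contra hcon
  rw [not_eventually] at hcon
  have h0 := han.eqOn_zero_of_preconnected_of_frequently_eq_zero isPreconnected_univ
    (Set.mem_univ s) (hcon.mono fun z hz => by simpa using hz)
  obtain ⟨x, hx⟩ := (eventually_forall_re_pos hα β).exists
  have h1 := h0 (Set.mem_univ (x : ℂ))
  refine gammaFactor_ne_zero_of_re_pos (s := (x : ℂ)) (fun ν => ?_) (inv_eq_zero.mp h1)
  rw [add_re, re_ofReal_mul, ofReal_re]
  exact hx ν

lemma exists_gammaFactor_ne_zero_of_le_abs_im {α : Fin d → ℝ} (hα : ∀ ν, 0 < α ν)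
    (β : Fin d → ℂ) : ∃ T : ℝ, ∀ s : ℂ, T ≤ |s.im| → gammaFactor α β s ≠ 0 := by
  have h : ∀ᶠ x : ℝ in atTop, ∀ ν, 0 < α ν * x + (-|(β ν).im|) := by
    rw [eventually_all]
    intro ν
    exact (tendsto_atTop_add_const_right _ _
      (tendsto_id.const_mul_atTop (hα ν))).eventually_gt_atTop 0
  obtain ⟨T, hT⟩ := eventually_atTop.mp h
  refine ⟨T, fun s hs => Finset.prod_ne_zero_iff.mpr fun ν _ => Gamma_ne_zero fun m hm => ?_⟩
  have him := congrArg Complex.im hm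
  rw [add_im, im_ofReal_mul, neg_im, natCast_im, neg_zero] at him
  have h1 := hT _ hs ν
  have h2 : |α ν * s.im| = |(β ν).im| := by
    rw [eq_neg_of_add_eq_zero_left him, abs_neg]
  rw [abs_mul, abs_of_pos (hα ν)] at h2
  linarith

lemma meromorphicAt_gammaFactor (α : Fin d → ℝ) (β : Fin d → ℂ) (s : ℂ) :
    MeromorphicAt (gammaFactor α β) s := by
  have h := ((analyticOnNhd_univ_iff_differentiable.mpr (differentiable_gammaFactor_inv α β))
    s (Set.mem_univ s)).meromorphicAt.inv
  refine h.congr (Eventually.of_forall fun z => ?_)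
  simp

/-- Multiplication by a gamma factor removes no poles, as its reciprocal is entire. -/
lemma isPole_gammaFactor_mul {α : Fin d → ℝ} (hα : ∀ ν, 0 < α ν) (β : Fin d → ℂ) {φ : ℂ → ℂ}
    {s : ℂ} (hφ : MeromorphicAt φ s) (hs : IsPole φ s) :
    IsPole (fun z => gammaFactor α β z * φ z) s := by
  have han : AnalyticAt ℂ (fun s => (gammaFactor α β s)⁻¹) s :=
    (analyticOnNhd_univ_iff_differentiable.mpr (differentiable_gammaFactor_inv α β))
    s (Set.mem_univ s)
  have hm : MeromorphicAt (fun z => gammaFactor α β z * φ z) s :=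
    (meromorphicAt_gammaFactor α β s).mul hφ
  have hcongr : (fun s => (gammaFactor α β s)⁻¹) * (fun z => gammaFactor α β z * φ z)
      =ᶠ[𝓝[≠] s] φ := by
    filter_upwards [eventually_gammaFactor_ne_zero hα β s] with z hz
    rw [Pi.mul_apply, inv_mul_cancel_left₀ hz]
  by_contra hcon
  rw [IsPole, not_lt] at hcon
  refine absurd hs (not_lt.mpr ?_)
  rw [← meromorphicOrderAt_congr hcongr, meromorphicOrderAt_mul han.meromorphicAt hm]
  exact add_nonneg han.meromorphicOrderAt_nonneg hcon

end

/-! ### From the functional equation to the spacing of the frequencies -/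

lemma IsDirichletSum.summable {c : ℕ → ℂ} {ℓ : ℕ → ℝ} {σ : ℝ} {f : ℂ → ℂ}
    (h : IsDirichletSum c ℓ σ f) (hℓ : ∀ n, 0 < ℓ n) {x : ℝ} (hx : σ ≤ x) :
    Summable fun n => ‖c n‖ * ℓ n ^ (-x) := by
  refine (h x (by simpa using hx)).1.congr fun n => ?_
  rw [norm_mul, norm_cpow_eq_rpow_re_of_pos (hℓ n)]
  simp

lemma IsDirichletSum.continuousAt {c : ℕ → ℂ} {ℓ : ℕ → ℝ} {σ : ℝ} {f : ℂ → ℂ}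
    (h : IsDirichletSum c ℓ σ f) (hℓ : ∀ n, 0 < ℓ n) {s : ℂ} (hs : σ < s.re) :
    ContinuousAt f s := by
  set V : Set ℂ := {z | σ < z.re} ∩ {z | z.re < s.re + 1} with hV
  have hVo : IsOpen V :=
    (isOpen_lt continuous_const continuous_re).inter (isOpen_lt continuous_re continuous_const)
  have hVs : s ∈ V := ⟨hs, by simp⟩
  have hcont : ContinuousOn (fun z => ∑' n, c n * (ℓ n : ℂ) ^ (-z)) V := by
    refine continuousOn_tsum (u := fun n => ‖c n‖ * ℓ n ^ (-σ) + ‖c n‖ * ℓ n ^ (-(s.re + 1)))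
      (fun n => ?_) ((h.summable hℓ le_rfl).add (h.summable hℓ (by linarith))) fun n z hz => ?_
    · refine (continuous_const.mul (Continuous.const_cpow continuous_neg (Or.inl ?_))).continuousOn
      exact_mod_cast (hℓ n).ne'
    · rw [norm_mul, norm_cpow_eq_rpow_re_of_pos (hℓ n), neg_re, ← mul_add]
      refine mul_le_mul_of_nonneg_left ?_ (norm_nonneg _)
      rcases le_total 1 (ℓ n) with h1 | h1
      · have := Real.rpow_le_rpow_of_exponent_le h1 (neg_le_neg hz.1.le)
        linarith [Real.rpow_nonneg (hℓ n).le (-(s.re + 1))]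
      · have := Real.rpow_le_rpow_of_exponent_ge (hℓ n) h1 (neg_le_neg hz.2.le)
        linarith [Real.rpow_nonneg (hℓ n).le (-σ)]
  refine (hcont.continuousAt (hVo.mem_nhds hVs)).congr ?_
  filter_upwards [hVo.mem_nhds hVs] with z hz
  exact (h z hz.1.le).2.tsum_eq

lemma eventually_nhdsNE_of_codiscrete {p : ℂ → Prop} (h : ∀ᶠ z in codiscrete ℂ, p z) (s : ℂ) :
    ∀ᶠ z in 𝓝[≠] s, p z := by
  have := mem_codiscrete.mp h s
  rw [disjoint_principal_right, compl_compl] at this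
  exact this

/-- The functional equation, solved for `E`, holds pointwise in a left half-plane. -/
lemma eq_of_functionalEq {d : ℕ} {α : Fin d → ℝ} (hα : ∀ ν, 0 < α ν) {β β' : Fin d → ℂ} {ω : ℂ}
    {P : Polynomial ℂ} {b : ℕ → ℂ} {mu : ℕ → ℝ} (hmu : ∀ n, 0 < mu n) {σ : ℝ} {E ψ : ℂ → ℂ}
    (hψ : IsDirichletSum b mu σ ψ) (hE : Differentiable ℂ E)
    (hfe : (fun s => gammaFactor α β s * E s) =ᶠ[codiscrete ℂ]
      fun s => P.eval s * (ω * gammaFactor α β' (1 - s) * ψ (1 - s))) {s : ℂ}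
    (hs : σ < (1 - s).re) (hs' : ∀ ν, 0 < (α ν * (1 - s) + β' ν).re) :
    E s = P.eval s * (ω * gammaFactor α β' (1 - s) * ψ (1 - s)) * (gammaFactor α β s)⁻¹ := by
  have hsub : ContinuousAt (fun z : ℂ => 1 - z) s := by fun_prop
  have hψc : ContinuousAt (fun z => ψ (1 - z)) s :=
    (hψ.continuousAt hmu hs).comp_of_eq hsub rfl
  have hΓ : ContinuousAt (fun z => gammaFactor α β' (1 - z)) s := by
    simp only [gammaFactor]
    refine tendsto_finsetProd _ fun ν _ => ?_
    have h1 : ContinuousAt Gamma (α ν * (1 - s) + β' ν) := by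
      refine (differentiableAt_Gamma _ fun m hm => ?_).continuousAt
      have := hs' ν
      rw [hm, neg_re, natCast_re] at this
      linarith [(Nat.cast_nonneg m : (0 : ℝ) ≤ m)]
    exact ContinuousAt.comp_of_eq (f := fun z : ℂ => α ν * (1 - z) + β' ν) h1 (by fun_prop) rfl
  have hΔ : ContinuousAt (fun z => (gammaFactor α β z)⁻¹) s :=
    (differentiable_gammaFactor_inv α β).continuous.continuousAt
  have hR : ContinuousAt (fun z => P.eval z * (ω * gammaFactor α β' (1 - z) * ψ (1 - z)) *
      (gammaFactor α β z)⁻¹) s :=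
    ((P.continuous.continuousAt).mul ((continuousAt_const.mul hΓ).mul hψc)).mul hΔ
  refine ((hE.continuous.continuousAt.eventuallyEq_nhds_iff_eventuallyEq_nhdsNE hR).mp
    ?_).eq_of_nhds
  filter_upwards [eventually_nhdsNE_of_codiscrete hfe s, eventually_gammaFactor_ne_zero hα β s]
    with z h1 h2
  rw [← h1, mul_comm (gammaFactor α β z), mul_inv_cancel_right₀ h2]

/-- In the normalisation `λ_n ↦ λ_n^{1/(2A)}`, the frequencies meet every interval of some fixed
length far enough out. Here `E = P φ` is entire, for a polynomial `P` that clears the poles. -/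
theorem exists_rpow_frequency_near {d : ℕ} {α : Fin d → ℝ} (hα : ∀ ν, 0 < α ν)
    (hA : 0 < 2 * sumA α) {β β' : Fin d → ℂ} {ω : ℂ} (hω : ω ≠ 0) {P : Polynomial ℂ} (hP : P ≠ 0)
    {a b : ℕ → ℂ} {lam mu : ℕ → ℝ} (hlam : ∀ n, 0 < lam n) (hmu : ∀ n, 0 < mu n)
    (hmono : StrictMono mu) (hb0 : b 0 ≠ 0) {σ : ℝ} {φ ψ E : ℂ → ℂ}
    (hφ : IsDirichletSum a lam σ φ) (hψ : IsDirichletSum b mu σ ψ) (hE : Differentiable ℂ E)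
    (hgrow : HasStripGrowth E) (hEφ : ∀ s : ℂ, σ ≤ s.re → E s = P.eval s * φ s)
    (hfe : (fun s => gammaFactor α β s * E s) =ᶠ[codiscrete ℂ]
      fun s => P.eval s * (ω * gammaFactor α β' (1 - s) * ψ (1 - s))) :
    ∃ H : ℝ, 0 < H ∧ ∃ U : ℝ, ∀ u₀, U ≤ u₀ → ∃ n, |lam n ^ (1 / (2 * sumA α)) - u₀| ≤ H := by
  set k : ℝ := 2 * sumA α with hk
  have hk0 : (k : ℂ) ≠ 0 := by exact_mod_cast hA.ne'
  set α' : Fin d → ℝ := fun ν => α ν / k with hα'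
  have hα'0 : ∀ ν, 0 < α' ν := fun ν => div_pos (hα ν) hA
  have hsum : ∑ ν, α' ν = 1 / 2 := by
    have hAne : sumA α ≠ 0 := by linarith
    rw [hα', ← Finset.sum_div, ← sumA, hk]
    field_simp
  -- `z = k s` rescales the gamma factors to total weight `1/2`
  set P' : Polynomial ℂ :=
    (Polynomial.C ω * P).comp (Polynomial.C ((k : ℂ)⁻¹) * Polynomial.X) with hP'
  have hP'0 : P' ≠ 0 := by
    intro h0
    refine mul_ne_zero (Polynomial.C_ne_zero.mpr hω) hP ?_
    have hX : (Polynomial.C ((k : ℂ)⁻¹) * Polynomial.X).comp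
        (Polynomial.C (k : ℂ) * Polynomial.X) = Polynomial.X := by
      simp [← mul_assoc, ← Polynomial.C_mul, inv_mul_cancel₀ hk0]
    have := congrArg (fun Q => Q.comp (Polynomial.C (k : ℂ) * Polynomial.X)) h0
    simpa only [hP', Polynomial.comp_assoc, hX, Polynomial.comp_X, Polynomial.zero_comp] using this
  have hP'e : ∀ z : ℂ, P'.eval z = ω * P.eval (z / k) := by
    intro z
    simp [hP', Polynomial.eval_comp, div_eq_inv_mul]
  set w : ℝ := (1 / 2 + ∑ ν, (β' ν - β ν) + k / 2 + P'.natDegree : ℂ).re with hw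
  -- far to the left, Stirling's formula applies to all `Γ`-factors and `ψ(1 - s)` is a series
  obtain ⟨N, hN1, hN2, hN3, hN4, hN5⟩ :=
    ((((eventually_forall_re_pos hα'0 (fun ν => α' ν * k + β' ν))).and
      (((eventually_forall_re_pos hα'0 (fun ν => 1 - β ν))).and
      ((eventually_ge_atTop (3 / 2 - w)).and ((eventually_gt_atTop (k * (σ - 1))).and
      (eventually_gt_atTop (-(k * σ)))))))).exists
  set θ : ℂ := 1 / 2 + ∑ ν, (β' ν - β ν) + k / 2 + P'.natDegree + N with hθ
  have hθre : 3 / 2 ≤ θ.re := by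
    rw [hθ, add_re, ofReal_re, ← hw]
    linarith
  obtain ⟨hKcont, q, e₁, e₂, C, he₁, hC, hKC⟩ :=
    exists_kernel_asymptotics hα'0 hsum hP'0 (k := k) (N := N) (β := β) (β' := β')
      (fun ν => by
        have := hN1 ν
        rw [add_re, re_ofReal_mul, ofReal_re] at this
        rw [add_re, re_ofReal_mul, add_re, ofReal_re, ofReal_re]
        linarith)
      (fun ν => by
        have := hN2 ν
        rw [add_re, re_ofReal_mul, ofReal_re]
        linarith)
      (θ := θ) (by linarith) (by rw [hθ]; ring)
  have hdiv : ∀ x t : ℝ, ((x + t * I : ℂ) / k).re = x / k ∧ ((x + t * I : ℂ) / k).im = t / k := by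
    intro x t
    constructor
    · rw [div_ofReal_re]; simp
    · rw [div_ofReal_im]; simp
  -- powers of the rescaled frequencies
  have hpow : ∀ (x : ℝ) (z : ℂ), 0 < x → ((x ^ (1 / k) : ℝ) : ℂ) ^ z = (x : ℂ) ^ (z / k) := by
    intro x z hx
    have hxC : (x : ℂ) ≠ 0 := by exact_mod_cast hx.ne'
    have hx' : ((x ^ (1 / k) : ℝ) : ℂ) ≠ 0 := by exact_mod_cast (Real.rpow_pos_of_pos hx _).ne'
    rw [cpow_def_of_ne_zero hxC, cpow_def_of_ne_zero hx',
      ← ofReal_log (Real.rpow_pos_of_pos hx _).le, ← ofReal_log hx.le, Real.log_rpow hx]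
    congr 1
    push_cast
    field_simp
  have hrpow : ∀ x y : ℝ, 0 < x → (x ^ (1 / k)) ^ y = x ^ (y / k) := by
    intro x y hx
    rw [← Real.rpow_mul hx.le]
    congr 1
    field_simp
  obtain ⟨G, ρ, T, hG, hρ, hEg⟩ :=
    (hgrow.comp_mul_add (inv_pos.mpr hA) 0) (-N) (k * σ)
  have hleft : ∀ t : ℝ, E ((-N + t * I) / k) =
      (P'.eval (-N + t * I) * (∏ ν, Gamma (α' ν * (k - (-N + t * I)) + β' ν)) *
          (∏ ν, Gamma (α' ν * (-N + t * I) + β ν))⁻¹) *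
        ∑' n, (b n * ((mu n)⁻¹ : ℝ)) * ((mu n ^ (1 / k) : ℝ) : ℂ) ^ (-N + t * I : ℂ) := by
    intro t
    set s : ℂ := (-N + t * I) / k with hs
    have hks : (-N + t * I : ℂ) = k * s := by rw [hs, mul_div_cancel₀ _ hk0]
    have hsre : s.re = -N / k := by
      have := (hdiv (-N) t).1
      push_cast at this
      exact this
    have h1s : (1 - s).re = 1 + N / k := by
      rw [sub_re, one_re, hsre]; ring
    have hσs : σ < (1 - s).re := by
      rw [h1s, ← sub_lt_iff_lt_add', lt_div_iff₀ hA]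
      linarith
    have hcoef : ∀ (ν : Fin d), (α' ν : ℂ) * k = α ν := by
      intro ν
      rw [hα']
      push_cast
      exact div_mul_cancel₀ _ hk0
    have hs' : ∀ ν, 0 < (α ν * (1 - s) + β' ν).re := by
      intro ν
      have := hN1 ν
      rw [← hcoef ν, mul_assoc, add_re, re_ofReal_mul, re_ofReal_mul, h1s]
      rw [add_re, re_ofReal_mul, ofReal_re] at this
      have e : k * (1 + N / k) = k + N := by field_simp
      rw [e]
      linarith
    rw [eq_of_functionalEq hα hmu hψ hE hfe hσs hs', hP'e, ← (hψ (1 - s) hσs.le).2.tsum_eq]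
    have e1 : gammaFactor α β s = ∏ ν, Gamma (α' ν * (-N + t * I) + β ν) := by
      refine Finset.prod_congr rfl fun ν _ => ?_
      rw [hks, ← mul_assoc, hcoef]
    have e2 : gammaFactor α β' (1 - s) = ∏ ν, Gamma (α' ν * (k - (-N + t * I)) + β' ν) := by
      refine Finset.prod_congr rfl fun ν _ => ?_
      rw [hks, ← hcoef ν]
      congr 2
      ring
    have e3 : ∀ n, b n * (mu n : ℂ) ^ (-(1 - s)) =
        (b n * ((mu n)⁻¹ : ℝ)) * ((mu n ^ (1 / k) : ℝ) : ℂ) ^ (-N + t * I : ℂ) := by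
      intro n
      have hmuC : (mu n : ℂ) ≠ 0 := by exact_mod_cast (hmu n).ne'
      rw [hpow _ _ (hmu n), ← hs, neg_sub, cpow_sub _ _ hmuC, cpow_one, ofReal_inv, mul_assoc,
        div_eq_inv_mul]
    rw [e1, e2, tsum_congr e3, ← hs]
    ring
  refine exists_frequency_near (P := P') (N := N) (c := k * σ) (by linarith)
    (a := fun n => ω⁻¹ * a n) (b := fun n => b n * ((mu n)⁻¹ : ℝ)) (l := fun n => lam n ^ (1 / k))
    (m := fun n => mu n ^ (1 / k)) (fun n => Real.rpow_pos_of_pos (hlam n) _)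
    (fun n => Real.rpow_pos_of_pos (hmu n) _)
    (fun i j hij => Real.rpow_lt_rpow (hmu i).le (hmono hij) (by positivity))
    ?_ ?_ ?_ (E := fun z => E (z / k)) (hE.comp (differentiable_id.div_const _))
    (G := G) (ρ := ρ) (T := T) ?_ ?_ hKcont hleft hθre he₁ hC hKC
  · exact mul_ne_zero hb0 (by exact_mod_cast (inv_pos.mpr (hmu 0)).ne')
  · refine ((hφ.summable hlam le_rfl).mul_left ‖ω⁻¹‖).congr fun n => ?_
    rw [hrpow _ _ (hlam n), norm_mul, mul_assoc]
    congr 3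
    field_simp
  · have h1 : σ ≤ 1 + N / k := by
      rw [← sub_le_iff_le_add', le_div_iff₀ hA]
      linarith
    refine (hψ.summable hmu h1).congr fun n => ?_
    rw [hrpow _ _ (hmu n), norm_mul, norm_real, Real.norm_of_nonneg (inv_pos.mpr (hmu n)).le,
      mul_assoc, ← Real.rpow_neg_one, ← Real.rpow_add (hmu n)]
    congr 2
    ring
  · intro z h1 h2 h3
    have := hEg z h1 h2 h3
    beta_reduce at this
    rwa [add_zero, ofReal_inv, ← div_eq_inv_mul] at this
  · intro t
    have hre := (hdiv (k * σ) t).1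
    have hσk : k * σ / k = σ := by field_simp
    rw [hσk] at hre
    have h1 := hφ (((k * σ : ℝ) + t * I : ℂ) / k) hre.ge
    rw [hEφ _ hre.ge, hP'e, ← h1.2.tsum_eq]
    have e : ∀ n, ω⁻¹ * a n * ((lam n ^ (1 / k) : ℝ) : ℂ) ^ (-((k * σ : ℝ) + t * I) : ℂ) =
        ω⁻¹ * (a n * (lam n : ℂ) ^ (-(((k * σ : ℝ) + t * I : ℂ) / k))) := by
      intro n
      rw [hpow _ _ (hlam n), mul_assoc, neg_div]
    rw [tsum_congr e, tsum_mul_left]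
    field_simp

/-- If `λ_n^p`, `p ≥ 1`, meets every far interval of length `2H`, then consecutive `λ_n` are close.
The mean value inequality `y^p - x^p ≥ x^{p-1}(y - x)` transfers the gaps. -/
lemma exists_gap_le {lam : ℕ → ℝ} (hpos : ∀ n, 0 < lam n) (hmono : StrictMono lam)
    (htop : Tendsto lam atTop atTop) {p : ℝ} (hp : 1 ≤ p) {H U : ℝ} (hH : 0 < H)
    (h : ∀ u₀, U ≤ u₀ → ∃ n, |lam n ^ p - u₀| ≤ H) :
    ∃ C : ℝ, 0 < C ∧ ∀ᶠ n in atTop, lam (n + 1) - lam n ≤ C * lam n ^ (1 - p) := by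
  have hp0 : 0 < p := by linarith
  refine ⟨2 * H, by linarith, ?_⟩
  filter_upwards [((tendsto_rpow_atTop hp0).comp htop).eventually_ge_atTop U] with n hn
  simp only [Function.comp_apply] at hn
  by_contra hcon
  push Not at hcon
  set x := lam n with hx
  set y := lam (n + 1) with hy
  have hx0 : 0 < x := hpos n
  have hxy : x < y := hmono n.lt_succ_self
  have hpw : y ^ p = y ^ (p - 1) * y := by
    rw [← Real.rpow_add_one (hpos _).ne', sub_add_cancel]
  have hpx : x ^ p = x ^ (p - 1) * x := by
    rw [← Real.rpow_add_one hx0.ne', sub_add_cancel]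
  have h1 : x ^ (p - 1) ≤ y ^ (p - 1) := Real.rpow_le_rpow hx0.le hxy.le (by linarith)
  have h2 : x ^ (p - 1) * (y - x) ≤ y ^ p - x ^ p := by
    rw [hpw, hpx]
    nlinarith [hpos (n + 1)]
  have h3 : x ^ (p - 1) * x ^ (1 - p) = 1 := by
    rw [← Real.rpow_add hx0]
    simp
  have h4 : 2 * H < x ^ (p - 1) * (y - x) := by
    have := mul_lt_mul_of_pos_left hcon (Real.rpow_pos_of_pos hx0 (p - 1))
    calc 2 * H = x ^ (p - 1) * (2 * H * x ^ (1 - p)) := by rw [mul_left_comm, h3, mul_one]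
      _ < _ := this
  -- the midpoint of a gap longer than `2H` is at distance more than `H` from both ends
  obtain ⟨i, hi⟩ := h ((x ^ p + y ^ p) / 2) (by linarith [Real.rpow_lt_rpow hx0.le hxy hp0])
  rw [abs_le] at hi
  rcases le_or_gt i n with hin | hin
  · have := Real.rpow_le_rpow (hpos i).le (hmono.monotone hin) hp0.le
    linarith [hi.1]
  · have := Real.rpow_le_rpow (hpos _).le (hmono.monotone (Nat.succ_le_of_lt hin)) hp0.le
    linarith [hi.2]

/-- A meromorphic function with poles in a disk becomes entire after multiplication by a
polynomial. -/
lemma exists_polynomial_mul_differentiable {φ : ℂ → ℂ} (hφ : MeromorphicNFOn φ Set.univ) {R : ℝ}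
    (hpoles : ∀ s, IsPole φ s → ‖s‖ < R) :
    ∃ P : Polynomial ℂ, P ≠ 0 ∧ Differentiable ℂ fun s => P.eval s * φ s := by
  have hmero : ∀ s, MeromorphicAt φ s := fun s => (hφ (Set.mem_univ s)).meromorphicAt
  have hfin : {s | IsPole φ s}.Finite := by
    refine ((MeromorphicOn.divisor φ (Metric.closedBall 0 R)).finiteSupport
      (isCompact_closedBall 0 R)).subset fun s hs => ?_
    have hball : s ∈ Metric.closedBall (0 : ℂ) R := by simpa using (hpoles s hs).le
    rw [Function.mem_support, MeromorphicOn.divisor_apply (fun z _ => hmero z) hball]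
    have hs' : meromorphicOrderAt φ s < 0 := hs
    intro h0
    rcases WithTop.untop₀_eq_zero.mp h0 with h | h <;> rw [h] at hs' <;> simp at hs'
  -- `(z - s)^{n s} φ z` is analytic at `s`, by the definition of meromorphy
  choose n hn using hmero
  refine ⟨∏ ρ ∈ hfin.toFinset, (Polynomial.X - Polynomial.C ρ) ^ n ρ,
    Finset.prod_ne_zero_iff.mpr fun ρ _ => pow_ne_zero _ (Polynomial.X_sub_C_ne_zero ρ), ?_⟩
  rw [← analyticOnNhd_univ_iff_differentiable]
  intro s _
  by_cases hs : IsPole φ s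
  · have hmem : s ∈ hfin.toFinset := hfin.mem_toFinset.mpr hs
    have e : (fun z => (∏ ρ ∈ hfin.toFinset, (Polynomial.X - Polynomial.C ρ) ^ n ρ).eval z * φ z) =
        fun z => (∏ ρ ∈ hfin.toFinset.erase s, (Polynomial.X - Polynomial.C ρ) ^ n ρ).eval z *
          ((z - s) ^ n s • φ z) := by
      funext z
      rw [← Finset.mul_prod_erase _ _ hmem, Polynomial.eval_mul, Polynomial.eval_pow,
        Polynomial.eval_sub, Polynomial.eval_X, Polynomial.eval_C, smul_eq_mul]
      ring
    rw [e]
    exact (AnalyticOnNhd.eval_polynomial _ s (Set.mem_univ s)).mul (hn s)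
  · rw [IsPole, not_lt, (hφ (Set.mem_univ s)).meromorphicOrderAt_nonneg_iff_analyticAt] at hs
    exact (AnalyticOnNhd.eval_polynomial _ s (Set.mem_univ s)).mul hs

/-- Short gaps between the frequencies of a Dirichlet series with a functional equation of degree
`2A < 1`. -/
theorem Assumptions.exists_gap_le {d : ℕ} {a b : ℕ → ℂ} {lam mu : ℕ → ℝ} {α : Fin d → ℝ}
    {β β' : Fin d → ℂ} {ω : ℂ} {φ ψ : ℂ → ℂ} (h : Assumptions a b lam mu α β β' ω φ ψ)
    (hA : 0 < 2 * sumA α) (hA1 : 2 * sumA α < 1) :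
    ∃ C : ℝ, 0 < C ∧ ∀ᶠ n in atTop,
      lam (n + 1) - lam n ≤ C * lam n ^ (1 - 1 / (2 * sumA α)) := by
  have hα := h.alpha_pos
  obtain ⟨R, -, hR⟩ := h.poles_bounded
  obtain ⟨σ, -, hφ, hψ⟩ := h.absConv
  have hmero : ∀ s, MeromorphicAt φ s :=
    fun s => (h.meromorphic_left (Set.mem_univ s)).meromorphicAt
  obtain ⟨P, hP, hE⟩ := exists_polynomial_mul_differentiable h.meromorphic_left
    fun s hs => hR s (isPole_gammaFactor_mul hα β (hmero s) hs)
  have hprod : HasStripGrowth fun s => gammaFactor α β s * φ s := by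
    intro x y
    obtain ⟨T, hT⟩ := h.decay x y 1 one_pos
    refine ⟨0, 0, T, le_rfl, le_rfl, fun s hx hy hs => ?_⟩
    rw [zero_mul, Real.exp_zero]
    exact (hT s hx hy hs).le
  obtain ⟨T, hT⟩ := exists_gammaFactor_ne_zero_of_le_abs_im hα β
  have hgrow : HasStripGrowth fun s => P.eval s * φ s :=
    (hasStripGrowth_polynomial P).mul <|
      ((hasStripGrowth_gammaFactor_inv hα β).mul hprod).congr (T := T) fun s hs => by
        rw [inv_mul_cancel_left₀ (hT s hs)]
  obtain ⟨H, hH, U, hU⟩ := exists_rpow_frequency_near hα hA (ω := ω) (β := β) (β' := β')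
    (norm_pos_iff.mp (by rw [h.norm_omega]; exact one_pos)) hP h.datum_left.pos h.datum_right.pos
    h.datum_right.strictMono h.datum_right.first_ne_zero hφ hψ hE hgrow (fun s _ => rfl) (by
      filter_upwards [h.functionalEq] with s hs
      rw [← hs]
      ring)
  exact ShortGap.exists_gap_le h.datum_left.pos h.datum_left.strictMono h.datum_left.tendsto
    (by rw [le_div_iff₀ hA]; linarith) hH hU

/-! ### The Selberg class -/

/-- The Euler product normalises the first coefficient: `1` is not a prime power. -/
lemma IsSelbergSeries.coeff_one {a : ℕ → ℂ} {F : ℂ → ℂ} (h : IsSelbergSeries a F) : a 1 = 1 := by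
  obtain ⟨b, -, -, -, hb, -, hF⟩ := h.euler
  have hasum : LSeriesSummable a 2 := (h.dirichlet 2 (by simp)).LSeriesSummable
  have habs : ∀ f : ℕ → ℂ, LSeriesSummable f 2 → LSeries.abscissaOfAbsConv f < ⊤ := fun f hf =>
    hf.abscissaOfAbsConv_le.trans_lt (EReal.coe_lt_top _)
  have h1 := LSeries.tendsto_atTop (habs a hasum)
  have h2 := LSeries.tendsto_atTop (habs b (hF 2 (by simp)).1)
  rw [hb 1 not_isPrimePow_one] at h2
  have h3 : Tendsto (fun x : ℝ => cexp (LSeries b x)) atTop (𝓝 1) := by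
    rw [← Complex.exp_zero]
    exact (Complex.continuous_exp.tendsto 0).comp h2
  refine tendsto_nhds_unique h1 (h3.congr' ?_)
  filter_upwards [eventually_gt_atTop 1] with x hx
  rw [← (hF x (by simpa using hx)).2, (h.dirichlet x (by simpa using hx)).LSeries_eq]

lemma conj_ofReal_cpow {x : ℝ} (hx : 0 < x) (s : ℂ) :
    (starRingEnd ℂ) ((x : ℂ) ^ s) = (x : ℂ) ^ (starRingEnd ℂ) s := by
  rw [cpow_conj _ _ (by rw [arg_ofReal_of_nonneg hx.le]; exact Real.pi_ne_zero.symm), conj_ofReal]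

lemma conj_gammaFactor {r : ℕ} (α : Fin r → ℝ) (β : Fin r → ℂ) (s : ℂ) :
    (starRingEnd ℂ) (gammaFactor α β s) =
      gammaFactor α (fun j => (starRingEnd ℂ) (β j)) ((starRingEnd ℂ) s) := by
  rw [gammaFactor, gammaFactor, map_prod]
  refine Finset.prod_congr rfl fun j _ => ?_
  rw [← Gamma_conj, map_add, map_mul, conj_ofReal]

/-- A Dirichlet series `F` as a general Dirichlet series `Q^s F(s)` with frequencies `n/Q`. -/
lemma IsSelbergSeries.isDirichletSum {a : ℕ → ℂ} {F : ℂ → ℂ} (h : IsSelbergSeries a F) {Q : ℝ}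
    (hQ : 0 < Q) : IsDirichletSum (fun n => a (n + 1)) (fun n => ((n : ℝ) + 1) / Q) 2
      fun s => (Q : ℂ) ^ s * F s := by
  intro s hs
  have h1 : HasSum (LSeries.term a s) (F s) := h.dirichlet s (by linarith)
  have h2 : HasSum (fun n => LSeries.term a s (n + 1)) (F s) := by
    rw [hasSum_nat_add_iff 1]
    simpa using h1
  have h3 : HasSum (fun n : ℕ => a (n + 1) * ((((n : ℝ) + 1) / Q : ℝ) : ℂ) ^ (-s))
      ((Q : ℂ) ^ s * F s) := by
    refine (h2.mul_left ((Q : ℂ) ^ s)).congr_fun fun n => ?_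
    have hn : (0 : ℝ) < (n : ℝ) + 1 := by positivity
    rw [LSeries.term_of_ne_zero n.succ_ne_zero, div_eq_mul_inv ((n : ℝ) + 1), ofReal_mul,
      mul_cpow_ofReal_nonneg hn.le (inv_nonneg.mpr hQ.le), ofReal_inv, cpow_neg,
      inv_cpow _ _ (by rw [arg_ofReal_of_nonneg hQ.le]; exact Real.pi_ne_zero.symm), cpow_neg,
      inv_inv]
    push_cast
    ring
  exact ⟨h3.summable.norm, h3⟩

lemma IsDirichletSum.conj {c : ℕ → ℂ} {ℓ : ℕ → ℝ} {σ : ℝ} {f : ℂ → ℂ}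
    (h : IsDirichletSum c ℓ σ f) (hℓ : ∀ n, 0 < ℓ n) :
    IsDirichletSum (fun n => (starRingEnd ℂ) (c n)) ℓ σ
      fun s => (starRingEnd ℂ) (f ((starRingEnd ℂ) s)) := by
  intro s hs
  have h1 := (h ((starRingEnd ℂ) s) (by simpa using hs)).2
  have h2 : HasSum (fun n => (starRingEnd ℂ) (c n) * (ℓ n : ℂ) ^ (-s))
      ((starRingEnd ℂ) (f ((starRingEnd ℂ) s))) := by
    refine (h1.map (starRingEnd ℂ) continuous_conj).congr_fun fun n => ?_
    rw [Function.comp_apply, map_mul, conj_ofReal_cpow (hℓ n), map_neg, conj_conj]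
  exact ⟨h2.summable.norm, h2⟩

lemma hasStripGrowth_cpow {Q : ℝ} (hQ : 0 < Q) : HasStripGrowth fun s => (Q : ℂ) ^ s := by
  intro x y
  refine ⟨|Real.log Q| * (|x| + |y|), 0, 0, by positivity, le_rfl, fun s hx hy _ => ?_⟩
  rw [norm_cpow_eq_rpow_re_of_pos hQ, Real.rpow_zero, mul_one, Real.rpow_def_of_pos hQ,
    Real.exp_le_exp]
  refine (le_abs_self _).trans ?_
  rw [abs_mul]
  gcongr
  rw [abs_le]
  constructor
  · linarith [neg_abs_le x, abs_nonneg y]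
  · linarith [le_abs_self y, abs_nonneg x]

/-- For `0 < D < 1`, short gaps contradict the constant gaps of the frequencies `n/Q`. -/
theorem selbergClass_eq_empty {D : ℝ} (hD : 0 < D) (hD1 : D < 1) : selbergClass D = ∅ := by
  rw [Set.eq_empty_iff_forall_notMem]
  rintro F ⟨⟨a, hF⟩, r, Q, α, β, ω, hfe, hdeg⟩
  have hQ := hfe.Q_pos
  obtain ⟨m, G, hG, hGF, C₀, ρ, hGρ⟩ := hF.continuation
  have hQC : (Q : ℂ) ≠ 0 := by exact_mod_cast hQ.ne'
  set lam : ℕ → ℝ := fun n => ((n : ℝ) + 1) / Q with hlam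
  have hpos : ∀ n, 0 < lam n := fun n => by positivity
  have hmono : StrictMono lam := by
    intro i j hij
    have : (i : ℝ) < j := by exact_mod_cast hij
    simp only [hlam]
    gcongr
  have htop : Tendsto lam atTop atTop :=
    (tendsto_atTop_add_const_right _ _ tendsto_natCast_atTop_atTop).atTop_div_const hQ
  have hφ := hF.isDirichletSum hQ
  have hψ := hφ.conj hpos
  set P : Polynomial ℂ := (Polynomial.X - Polynomial.C 1) ^ m with hP
  have hPe : ∀ s, P.eval s = (s - 1) ^ m := fun s => by simp [hP]
  obtain ⟨H, hH, U, hU⟩ := exists_rpow_frequency_near hfe.alpha_pos (by rw [hdeg]; exact hD)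
    (β := β) (β' := fun j => (starRingEnd ℂ) (β j)) (ω := ω)
    (norm_pos_iff.mp (by rw [hfe.norm_omega]; exact one_pos))
    (P := P) (pow_ne_zero _ (Polynomial.X_sub_C_ne_zero 1)) hpos hpos hmono
    (by simp [hF.coeff_one]) hφ hψ (E := fun s => (Q : ℂ) ^ s * G s)
    ((differentiable_id.const_cpow (Or.inl hQC)).mul hG)
    ((hasStripGrowth_cpow hQ).mul (hasStripGrowth_of_finite_order hGρ))
    (fun s hs => by
      rw [← hGF s (by rintro rfl; norm_num at hs), hPe]
      ring)
    (by
      filter_upwards [hfe.eq, (Set.finite_singleton (1 : ℂ)).compl_mem_codiscrete] with s hs hs1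
      rw [← hGF s hs1, hPe]
      have h1 : (starRingEnd ℂ) (1 - (starRingEnd ℂ) s) = 1 - s := by simp
      have h2 : (starRingEnd ℂ) (1 - s) = 1 - (starRingEnd ℂ) s := by simp
      simp only [completed, map_mul, conj_gammaFactor, h1, conj_ofReal_cpow hQ] at hs
      rw [h2, map_mul, conj_ofReal_cpow hQ, h1]
      linear_combination (s - 1) ^ m * hs)
  rw [hdeg] at hU
  have hp : 1 < 1 / D := by rw [lt_div_iff₀ hD]; linarith
  obtain ⟨C, hC, hgap⟩ := exists_gap_le hpos hmono htop hp.le hH hU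
  have hlim : Tendsto (fun n => C * lam n ^ (1 - 1 / D)) atTop (𝓝 0) := by
    have h := ((tendsto_rpow_neg_atTop (y := 1 / D - 1) (by linarith)).comp htop).const_mul C
    simpa using h
  obtain ⟨n, h1, h2⟩ := (hgap.and (hlim.eventually_lt_const (inv_pos.mpr hQ))).exists
  have h3 : lam (n + 1) - lam n = Q⁻¹ := by
    simp only [hlam]
    push_cast
    field_simp
    ring
  linarith

end ShortGap

theorem theorem3 :
    (∀ (d : ℕ) (a b : ℕ → ℂ) (lam mu : ℕ → ℝ) (α : Fin d → ℝ) (β β' : Fin d → ℂ) (ω : ℂ)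
        (φ ψ : ℂ → ℂ),
      ShortGap.Assumptions a b lam mu α β β' ω φ ψ →
      0 < 2 * ShortGap.sumA α → 2 * ShortGap.sumA α < 1 →
      (Differentiable ℂ φ ∨
        (ShortGap.xi α β β' = 0 ∧ ∀ s : ℂ, ShortGap.IsPole φ s → s.im = 0) ∨
        (∀ s : ℂ, ShortGap.IsPole φ s →
          s.re < 1 - ShortGap.vartheta α β β' + 1 / (2 * ShortGap.sumA α))) →
      ∃ C : ℝ, 0 < C ∧ ∀ᶠ n in Filter.atTop,
        lam (n + 1) - lam n ≤ C * lam n ^ (1 - 1 / (2 * ShortGap.sumA α))) ∧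
    (∀ D : ℝ, 0 < D → D < 1 → ShortGap.selbergClass D = ∅) :=
  ⟨fun _ _ _ _ _ _ _ _ _ _ _ h hA hA1 _ => h.exists_gap_le hA hA1,
    fun _ hD hD1 => ShortGap.selbergClass_eq_empty hD hD1⟩
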